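/- Let $(\Omega,\mathfrak F,P)$ be a probability space and let $X_\Delta=(X_\Delta(t),t\in\mathbb R)$, $\Delta>0$, be measurable, stationary, centered, real-valued Gaussian processes on it, with non-negative continuous spectral densities $f_\Delta$ such that, with $K_\Delta(t)=\mathbb E X_\Delta(s+t)X_\Delta(s)=\int_{-\infty}^{\infty}e^{i\lambda t}f_\Delta(\lambda)\,d\lambda$, (a) $f_\Delta(-\lambda)=f_\Delta(\lambda)$; (b) $\sup_{\Delta>0}\|f_\Delta\|_\infty<\infty$; (c) $f_\Delta\in L_1(\mathbb R)$; (d) for some $c\in(0,\infty)$ and every $a\in(0,\infty)$, $\lim_{\Delta\to\infty}\sup_{|\lambda|\le a}|f_\Delta(\lambda)-\frac{c}{2\pi}|=0$; (e) $K_\Delta\in L_1(\mathbb R)$. Let $H\in L_2(\mathbb R)$ be real-valued, with Fourier–Plancherel transform $H^*(\lambda)=\int_{-\infty}^{\infty}e^{-i\lambda x}H(x)\,dx$. For $T,\Delta>0$ and $t,\tau\in\mathbb R$ put $$Y_\Delta(t)=\int_{-\infty}^{\infty}H(s)X_\Delta(t-s)\,ds,\qquad H_{T,\Delta}(\tau)=\frac1{cT}\int_0^T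 Y_\Delta(t+\tau)X_\Delta(t)\,dt,$$ $$Z_{T,\Delta}(\tau)=\sqrt T\,[H_{T,\Delta}(\tau)-\mathbb E H_{T,\Delta}(\tau)],$$ where the first integral is the mean-square limit of $\int_{-A}^{B}H(s)X_\Delta(t-s)\,ds$ as $A,B\to\infty$ and the second is a mean-square Riemann integral. Let $$C_\infty(\tau_1,\tau_2)=\frac1{2\pi}\int_{-\infty}^{\infty}\Big[e^{i(\tau_1-\tau_2)\lambda}|H^*(\lambda)|^2+e^{i(\tau_1+\tau_2)\lambda}(H^*(\lambda))^2\Big]d\lambda .$$ Then the two mean-square integrals exist, all mixed moments of $Z_{T,\Delta}$ are finite, and, as $T\to\infty$ and $\Delta\to\infty$ simultaneously in any manner: (1) for all $m\in\mathbb N$ and $\tau_1,\dots,\tau_m\in\mathbb R$, the joint cumulants satisfy $$\lim_{(T,\Delta)\to\infty}\mathrm{cum}(Z_{T,\Delta}(\tau_1),\dots,Z_{T,\Delta}(\tau_m))=\begin{cases}0,&m=1;\\ C_\infty(\tau_1,\tau_2),&m=2;\\ 0,&m\ge3.\end{cases}$$ (2) There exists a centered real Gaussian process $Z=(Z(\tau),\tau\in\mathbb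 R)$ with $\mathbb E Z(\tau_1)Z(\tau_2)=C_\infty(\tau_1,\tau_2)$, and for every such process, all finite-dimensional distributions of $Z_{T,\Delta}$ converge weakly to the corresponding ones of $Z$. (3) For every such process $Z$, all $m\in\mathbb N$ and $\tau_1,\dots,\tau_m\in\mathbb R$, $$\lim_{(T,\Delta)\to\infty}\mathbb E\Big[\prod_{j=1}^m Z_{T,\Delta}(\tau_j)\Big]=\mathbb E\Big[\prod_{j=1}^m Z(\tau_j)\Big].$$ -/

import Mathlib

open MeasureTheory ProbabilityTheory Filter Topology
open scoped FourierTransform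

namespace Correlogram

noncomputable section

/-- The Fourier–Plancherel transform `H*(lam) = ∫ e^{-i lam x} H(x) dx` of `H ∈ L₂(ℝ)`.
Mathlib's transform on `L²` has the kernel `e^{-2π i x ξ}`, whence the argument `lam / 2π`. -/
def fourierPlancherel (H : ℝ → ℝ) (hH : MemLp H 2 volume) (lam : ℝ) : ℂ :=
  (𝓕 ((MemLp.ofReal (K := ℂ) hH).toLp (fun x : ℝ => (H x : ℂ))) : Lp (α := ℝ) ℂ 2 volume)
    (lam / (2 * Real.pi))

/-- The limit covariance
`C_∞(s,t) = (1/2π) ∫ [e^{i(s-t)lam} |H*(lam)|² + e^{i(s+t)lam} H*(lam)²] dlam`. -/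
def limitCov (H : ℝ → ℝ) (hH : MemLp H 2 volume) (s t : ℝ) : ℂ :=
  (1 / (2 * Real.pi : ℝ) : ℂ) * ∫ lam : ℝ,
    (Complex.exp (Complex.I * ((s - t) * lam : ℝ)) * ((‖fourierPlancherel H hH lam‖ ^ 2 : ℝ) : ℂ)
      + Complex.exp (Complex.I * ((s + t) * lam : ℝ)) * fourierPlancherel H hH lam ^ 2)

/-- The function `K(t) = ∫ e^{i lam t} f(lam) dlam` with spectral density `f`. -/
def spectralCov (f : ℝ → ℝ) (t : ℝ) : ℂ :=
  ∫ lam : ℝ, Complex.exp (Complex.I * (lam * t : ℝ)) * (f lam : ℂ)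

section Probability

variable {Ω : Type*} [MeasurableSpace Ω]

/-- A centered real Gaussian process on `ℝ` with covariance function `C`. -/
structure IsCenteredGaussian (P : Measure Ω) (Z : ℝ → Ω → ℝ) (C : ℝ → ℝ → ℂ) : Prop where
  gaussian : IsGaussianProcess Z P
  centered : ∀ t, ∫ ω, Z t ω ∂P = 0
  cov : ∀ s t, ((∫ ω, Z s ω * Z t ω ∂P : ℝ) : ℂ) = C s t

/-- The family of input processes `X Δ`, `Δ > 0`: measurable stationary centered Gaussian
processes with spectral densities `f Δ`, close to a white noise as `Δ → ∞`. -/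
structure IsInputFamily (P : Measure Ω) (X : ℝ → ℝ → Ω → ℝ) (f : ℝ → ℝ → ℝ) (c : ℝ) : Prop where
  measurable : ∀ Δ, 0 < Δ → Measurable (fun p : ℝ × Ω => X Δ p.1 p.2)
  gaussian : ∀ Δ, 0 < Δ →
    IsCenteredGaussian P (X Δ) (fun s t => spectralCov (f Δ) (s - t))
  density_nonneg : ∀ Δ, 0 < Δ → ∀ lam, 0 ≤ f Δ lam
  density_continuous : ∀ Δ, 0 < Δ → Continuous (f Δ)
  density_even : ∀ Δ, 0 < Δ → ∀ lam, f Δ (-lam) = f Δ lam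
  density_bounded : ∃ M : ℝ, ∀ Δ, 0 < Δ → ∀ lam, f Δ lam ≤ M
  density_integrable : ∀ Δ, 0 < Δ → Integrable (f Δ)
  c_pos : 0 < c
  density_tendsto : ∀ a : ℝ, 0 < a →
    TendstoUniformlyOn f (fun _ => c / (2 * Real.pi)) atTop (Set.Icc (-a) a)
  cov_integrable : ∀ Δ, 0 < Δ → Integrable (spectralCov (f Δ))

/-- `ξ` is the mean-square limit of the random variables `S i` along `l`. -/
def IsMSLim {ι : Type*} (P : Measure Ω) (l : Filter ι) (S : ι → Ω → ℝ) (ξ : Ω → ℝ) : Prop :=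
  MemLp ξ 2 P ∧ Tendsto (fun i => eLpNorm (S i - ξ) 2 P) l (𝓝 0)

open Classical in
/-- A version of the mean-square limit (unique up to almost sure equality when `l` is proper),
and `0` if there is none. -/
def msLim {ι : Type*} (P : Measure Ω) (l : Filter ι) (S : ι → Ω → ℝ) : Ω → ℝ :=
  if h : ∃ ξ, IsMSLim P l S ξ then h.choose else 0

/-- The truncations `∫_{-A}^{B} H(s) X(t-s) ds`, indexed by `(A, B)`. -/
def truncatedResponse (H : ℝ → ℝ) (X : ℝ → Ω → ℝ) (t : ℝ) (p : ℝ × ℝ) (ω : Ω) : ℝ :=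
  ∫ s in (-p.1)..p.2, H s * X (t - s) ω

/-- The response `Y(t) = ∫_{-∞}^{∞} H(s) X(t-s) ds`, the mean-square limit of the truncations. -/
def response (P : Measure Ω) (H : ℝ → ℝ) (X : ℝ → Ω → ℝ) (t : ℝ) : Ω → ℝ :=
  msLim P (atTop ×ˢ atTop) (truncatedResponse H X t)

/-- Tagged partitions of `[a, b]`. -/
structure TaggedPartition (a b : ℝ) where
  n : ℕ
  point : Fin (n + 1) → ℝ
  tag : Fin n → ℝ
  monotone : Monotone point
  first : point 0 = a
  last : point (Fin.last n) = b
  tag_mem : ∀ i : Fin n, tag i ∈ Set.Icc (point i.castSucc) (point i.succ)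

/-- The length of the longest interval of a tagged partition. -/
def TaggedPartition.mesh {a b : ℝ} (π : TaggedPartition a b) : ℝ :=
  ⨆ i : Fin π.n, (π.point i.succ - π.point i.castSucc)

/-- The filter "mesh tends to zero". -/
def meshFilter (a b : ℝ) : Filter (TaggedPartition a b) :=
  comap TaggedPartition.mesh (𝓝 0)

/-- The Riemann sum of a random function. -/
def riemannSum {a b : ℝ} (F : ℝ → Ω → ℝ) (π : TaggedPartition a b) (ω : Ω) : ℝ :=
  ∑ i : Fin π.n, (π.point i.succ - π.point i.castSucc) * F (π.tag i) ω

/-- The mean-square Riemann integral of a random function over `[a, b]`. -/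
def msIntegral (P : Measure Ω) (F : ℝ → Ω → ℝ) (a b : ℝ) : Ω → ℝ :=
  msLim P (meshFilter a b) (riemannSum F)

/-- The integrand `Y(t + τ) X(t)` of the correlogram. -/
def corrIntegrand (P : Measure Ω) (H : ℝ → ℝ) (X : ℝ → Ω → ℝ) (τ t : ℝ) (ω : Ω) : ℝ :=
  response P H X (t + τ) ω * X t ω

/-- The correlogram estimator `(1/(cT)) ∫_0^T Y(t + τ) X(t) dt`. -/
def estimator (P : Measure Ω) (H : ℝ → ℝ) (X : ℝ → Ω → ℝ) (c T τ : ℝ) (ω : Ω) : ℝ :=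
  1 / (c * T) * msIntegral P (corrIntegrand P H X τ) 0 T ω

/-- The normalized estimator `Z_{T,Δ}(τ) = √T [H_{T,Δ}(τ) - E H_{T,Δ}(τ)]`. -/
def normalized (P : Measure Ω) (H : ℝ → ℝ) (X : ℝ → ℝ → Ω → ℝ) (c : ℝ) (T Δ τ : ℝ) (ω : Ω) : ℝ :=
  Real.sqrt T * (estimator P H (X Δ) c T τ ω - ∫ ω', estimator P H (X Δ) c T τ ω' ∂P)

/-- The joint cumulant of `ξ_1, …, ξ_m` (for `m ≥ 1`):
the sum over all partitions `{ν_1, …, ν_p}` of the index set of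
`(-1)^{p-1} (p-1)! ∏_k E ∏_{j ∈ ν_k} ξ_j`. -/
def cumulant {m : ℕ} (P : Measure Ω) (ξ : Fin m → Ω → ℝ) : ℝ :=
  ∑ π : Finpartition (Finset.univ : Finset (Fin m)),
    (-1 : ℝ) ^ (π.parts.card - 1) * ((π.parts.card - 1).factorial : ℝ)
      * ∏ B ∈ π.parts, ∫ ω, ∏ j ∈ B, ξ j ω ∂P

end Probability

end

end Correlogram

open MeasureTheory ProbabilityTheory Filter Topology
open scoped FourierTransform

set_option linter.unusedSectionVars false

/-! The lags are absorbed into the impulse response. For fixed T and Δ let `fluct` be 1/(c√T) times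
the integral over [0,T], in L²(P), of the centered product Y(t)X(t) - E Y(t)X(t), where Y is X
filtered by h. It is linear in h, and replacing Y(t) by Y(t+τ) amounts to translating h by τ. Hence
Σ u_j Z(τ_j) is again a fluctuation, for the response Σ u_j `shift (τ j)` H. By the Cramér–Wold
principle the finite-dimensional limits follow from a single scalar statement,
`tendsto_charInt_fluct`: the characteristic function of the fluctuation of h tends to that of a
centered Gaussian law with variance `limitVar h` = ‖h‖² + ⟨h, h reflected at 0⟩.

Gaussianity comes from a spectral bound and not from a computation of higher cumulants. The
variables X(t) and Y(t) lie in a Gaussian Hilbert space, so the fluctuation is an L² limit of forms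
Σ l_k (g_k² - 1) with independent standard normal g_k. Expanding the characteristic function of g² -
1 to third order shows that such a form differs from a Gaussian variable of the same variance, in
characteristic function, by at most a constant times max|l_k| times the variance
(`norm_charInt_diag_sub_le`, `norm_charInt_integral_sub_le`). For integrable h a Bessel inequality
for stationary curves with bounded spectral density (`integral_inner_sq_le`) gives max|l_k| =
O(T^{-1/2}), uniformly in Δ.

By Wick's formula the variance is a sum of averages over [0,T]² of products of covariances. Each is
an integral of spectral densities against a Fejér kernel that concentrates on the diagonal. For
Schwartz h dominated convergence yields the limit (`tendsto_average_spectralInt_mul`). The bound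
‖fluct‖ ≤ K‖h‖ with K independent of T and Δ (`norm_fluct_le`) carries the result over to all h in
L² by density.

Quadratic forms of small norm have explicitly bounded exponential moments
(`lintegral_exp_integral_le`). Together with `norm_fluct_le` this bounds every moment uniformly
(`exists_moment_bound`), so weak convergence entails convergence of mixed moments and therefore of
cumulants. The cumulants of the limit are found from the Wick recursion by a combinatorial argument
on partitions (`setCumulant_eq_pairCumulant`). The limit process itself is an isonormal process
evaluated along the curve (h_τ + reflected h_τ)/√2. -/

namespace Correlogram
-- Gaussian subspaces of L²(P), characterised by characteristic functions
section GaussianSubspace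

variable {Ω : Type*} [MeasurableSpace Ω] {P : Measure Ω} [IsProbabilityMeasure P]

/-- The characteristic function of `ξ`, evaluated at `1`. -/
noncomputable def charInt (P : Measure Ω) (ξ : Ω → ℝ) : ℂ :=
  ∫ ω, Complex.exp (Complex.I * ξ ω) ∂P

theorem charInt_congr {ξ η : Ω → ℝ} (h : ξ =ᵐ[P] η) : charInt P ξ = charInt P η := by
  refine integral_congr_ae ?_
  filter_upwards [h] with ω hω
  rw [hω]

theorem integrable_exp_I {ξ : Ω → ℝ} (hξ : AEStronglyMeasurable ξ P) :
    Integrable (fun ω => Complex.exp (Complex.I * ξ ω)) P := by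
  refine Integrable.of_bound (C := 1) ?_ ?_
  · exact (Complex.continuous_exp.comp (continuous_const.mul
      Complex.continuous_ofReal)).comp_aestronglyMeasurable hξ
  · refine Eventually.of_forall fun ω => ?_
    rw [mul_comm, Complex.norm_exp_ofReal_mul_I]

theorem norm_exp_I_sub_le (x y : ℝ) :
    ‖Complex.exp (Complex.I * x) - Complex.exp (Complex.I * y)‖ ≤ |x - y| := by
  have h : Complex.exp (Complex.I * x) - Complex.exp (Complex.I * y)
      = Complex.exp (Complex.I * y) * (Complex.exp (Complex.I * ((x - y : ℝ) : ℂ)) - 1) := by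
    rw [mul_sub, ← Complex.exp_add, mul_one]
    congr 2
    push_cast
    ring
  rw [h, norm_mul, mul_comm Complex.I (y : ℂ), Complex.norm_exp_ofReal_mul_I, one_mul]
  exact Real.norm_exp_I_mul_ofReal_sub_one_le

theorem integral_abs_le_norm (ξ : Lp ℝ 2 P) : ∫ ω, |ξ ω| ∂P ≤ ‖ξ‖ := by
  have h1 : ∫ ω, |ξ ω| ∂P = (eLpNorm ξ 1 P).toReal := by
    rw [eLpNorm_one_eq_lintegral_enorm, ← integral_norm_eq_lintegral_enorm
      (Lp.aestronglyMeasurable ξ)]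
    rfl
  rw [h1, Lp.norm_def]
  refine ENNReal.toReal_mono (Lp.eLpNorm_ne_top ξ) ?_
  exact eLpNorm_le_eLpNorm_of_exponent_le (by norm_num) (Lp.aestronglyMeasurable ξ)

/-- The map x ↦ e^{ix} is 1-Lipschitz, and on a probability space the L¹ norm is at most the L²
norm. All later approximations in L² pass to characteristic functions through this bound. -/
theorem norm_charInt_sub_le (ξ η : Lp ℝ 2 P) : ‖charInt P ξ - charInt P η‖ ≤ ‖ξ - η‖ := by
  unfold charInt
  rw [← integral_sub (integrable_exp_I (Lp.aestronglyMeasurable ξ))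
    (integrable_exp_I (Lp.aestronglyMeasurable η))]
  refine (norm_integral_le_integral_norm _).trans ?_
  refine le_trans ?_ (integral_abs_le_norm (ξ - η))
  have hint : Integrable (fun ω => |(ξ - η : Lp ℝ 2 P) ω|) P :=
    ((Lp.memLp (ξ - η)).integrable (by norm_num)).abs
  refine integral_mono_of_nonneg (Eventually.of_forall fun _ => norm_nonneg _) hint ?_
  filter_upwards [Lp.coeFn_sub ξ η] with ω hω
  rw [hω]
  exact norm_exp_I_sub_le _ _

theorem continuous_charInt : Continuous (fun ξ : Lp ℝ 2 P => charInt P ξ) := by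
  refine LipschitzWith.continuous (K := 1) (LipschitzWith.of_dist_le_mul fun ξ η => ?_)
  rw [dist_eq_norm, dist_eq_norm, NNReal.coe_one, one_mul]
  exact norm_charInt_sub_le ξ η

/-- A space of square integrable random variables, all of which are centered Gaussian. -/
def IsGaussianSubspace (S : Submodule ℝ (Lp ℝ 2 P)) : Prop :=
  ∀ ξ ∈ S, charInt P ξ = Complex.exp (-((‖ξ‖ ^ 2 / 2 : ℝ) : ℂ))

/-- Both sides of the defining identity are continuous in ξ, so the set where it holds is closed. -/
theorem IsGaussianSubspace.topologicalClosure {S : Submodule ℝ (Lp ℝ 2 P)}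
    (hS : IsGaussianSubspace S) : IsGaussianSubspace S.topologicalClosure := by
  have hc : IsClosed {ξ : Lp ℝ 2 P |
      charInt P ξ = Complex.exp (-((‖ξ‖ ^ 2 / 2 : ℝ) : ℂ))} := by
    refine isClosed_eq continuous_charInt ?_
    fun_prop
  intro ξ hξ
  exact closure_minimal (fun η hη => hS η hη) hc hξ

/-- The characteristic function of ξ at t is `charInt` of t • ξ, which stays in the subspace.
Testing at the single point 1 therefore determines the whole law. -/
theorem IsGaussianSubspace.map_eq {S : Submodule ℝ (Lp ℝ 2 P)} (hS : IsGaussianSubspace S)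
    {ξ : Lp ℝ 2 P} (hξ : ξ ∈ S) :
    P.map ξ = gaussianReal 0 (‖ξ‖ ^ 2).toNNReal := by
  have hm : AEMeasurable ξ P := (Lp.aestronglyMeasurable ξ).aemeasurable
  have : IsProbabilityMeasure (P.map ξ) := Measure.isProbabilityMeasure_map hm
  refine Measure.ext_of_charFun ?_
  ext t
  rw [charFun_gaussianReal, charFun_apply_real, integral_map hm (by fun_prop)]
  have h1 := hS (t • ξ) (S.smul_mem t hξ)
  rw [charInt_congr (Lp.coeFn_smul t ξ)] at h1
  have h2 : charInt P (t • ⇑ξ) = ∫ ω, Complex.exp (t * ξ ω * Complex.I) ∂P := by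
    unfold charInt
    congr 1
    ext ω
    congr 1
    simp
    ring
  rw [h2] at h1
  rw [h1]
  congr 1
  rw [norm_smul, Real.coe_toNNReal _ (sq_nonneg _), mul_pow, Real.norm_eq_abs, sq_abs]
  push_cast
  ring

theorem inner_eq_integral_mul (ξ η : Lp ℝ 2 P) : inner ℝ ξ η = ∫ ω, ξ ω * η ω ∂P := by
  rw [L2.inner_def]
  congr 1
  ext ω
  simp [mul_comm]

theorem coeFn_sum {ι : Type*} (s : Finset ι) (f : ι → Lp ℝ 2 P) :
    ⇑(∑ i ∈ s, f i) =ᵐ[P] fun ω => ∑ i ∈ s, f i ω := by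
  have := Lp.coeFn_finsetSum s f
  filter_upwards [this] with ω hω
  rw [hω, Finset.sum_apply]

theorem coeFn_sum_smul {ι : Type*} (s : Finset ι) (c : ι → ℝ) (f : ι → Lp ℝ 2 P) :
    ⇑(∑ i ∈ s, c i • f i) =ᵐ[P] fun ω => ∑ i ∈ s, c i * f i ω := by
  have h : ∀ᵐ ω ∂P, ∀ i ∈ s, (c i • f i : Lp ℝ 2 P) ω = c i * f i ω := by
    refine (Finset.eventually_all s).2 fun i _ => ?_
    filter_upwards [Lp.coeFn_smul (c i) (f i)] with ω hω
    rw [hω]; rfl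
  filter_upwards [h, coeFn_sum s (fun i => c i • f i)] with ω h1 h2
  rw [h2]
  exact Finset.sum_congr rfl h1

/-- Every linear functional of the vector is again an element of the subspace, hence Gaussian. -/
theorem IsGaussianSubspace.hasGaussianLaw {S : Submodule ℝ (Lp ℝ 2 P)}
    (hS : IsGaussianSubspace S) {ι : Type*} [Fintype ι] {ξ : ι → Lp ℝ 2 P} (hξ : ∀ i, ξ i ∈ S) :
    HasGaussianLaw (fun ω i => ξ i ω) P := by
  classical
  have hm : AEMeasurable (fun ω i => ξ i ω) P :=
    aemeasurable_pi_lambda _ fun i => (Lp.aestronglyMeasurable (ξ i)).aemeasurable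
  refine ⟨isGaussian_of_map_eq_gaussianReal fun L => ?_⟩
  refine ⟨0, (‖∑ i, L (Pi.single i 1) • ξ i‖ ^ 2).toNNReal, ?_⟩
  rw [AEMeasurable.map_map_of_aemeasurable (by fun_prop) hm,
    ← hS.map_eq (S.sum_mem fun i _ => S.smul_mem _ (hξ i))]
  refine Measure.map_congr ?_
  filter_upwards [coeFn_sum_smul Finset.univ (fun i => L (Pi.single i 1)) ξ] with ω hω
  rw [hω, Function.comp_apply]
  conv_lhs => rw [pi_eq_sum_univ' (fun i => ξ i ω)]
  rw [map_sum]
  refine Finset.sum_congr rfl fun i _ => ?_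
  rw [map_smul, smul_eq_mul, mul_comm]

theorem IsGaussianSubspace.memLp {S : Submodule ℝ (Lp ℝ 2 P)}
    (hS : IsGaussianSubspace S) {ξ : Lp ℝ 2 P} (hξ : ξ ∈ S) {p : ENNReal} (hp : p ≠ ⊤) :
    MemLp ξ p P :=
  ((hS.hasGaussianLaw (ι := Unit) (ξ := fun _ => ξ) (fun _ => hξ)).eval ()).memLp hp

theorem IsGaussianSubspace.integral_eq_zero {S : Submodule ℝ (Lp ℝ 2 P)}
    (hS : IsGaussianSubspace S) {ξ : Lp ℝ 2 P} (hξ : ξ ∈ S) : ∫ ω, ξ ω ∂P = 0 := by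
  have h := integral_map (μ := P) (φ := ξ) (f := fun x : ℝ => x)
    (Lp.aestronglyMeasurable ξ).aemeasurable (by fun_prop)
  rw [← h, hS.map_eq hξ, integral_id_gaussianReal]

theorem IsGaussianSubspace.iIndepFun {S : Submodule ℝ (Lp ℝ 2 P)}
    (hS : IsGaussianSubspace S) {ι : Type*} [Fintype ι] {ξ : ι → Lp ℝ 2 P} (hξ : ∀ i, ξ i ∈ S)
    (ho : Orthonormal ℝ ξ) : iIndepFun (fun i ω => ξ i ω) P := by
  classical
  refine (hS.hasGaussianLaw hξ).iIndepFun_of_covariance_eq_zero fun i j hij => ?_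
  rw [covariance_eq_sub (hS.memLp (hξ i) (by norm_num)) (hS.memLp (hξ j) (by norm_num)),
    hS.integral_eq_zero (hξ i), zero_mul, sub_zero]
  have : inner ℝ (ξ i) (ξ j) = 0 := ho.2 hij
  rw [inner_eq_integral_mul] at this
  exact this

/-- The linear span of a centered Gaussian process is a Gaussian subspace. -/
theorem isGaussianSubspace_span {T : Type*} {X : T → Ω → ℝ} (hX : IsGaussianProcess X P)
    (h0 : ∀ t, ∫ ω, X t ω ∂P = 0) (x : T → Lp ℝ 2 P) (hx : ∀ t, x t =ᵐ[P] X t) :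
    IsGaussianSubspace (Submodule.span ℝ (Set.range x)) := by
  classical
  intro ξ hξ
  obtain ⟨c, rfl⟩ := (Finsupp.mem_span_range_iff_exists_finsupp).1 hξ
  rw [Finsupp.sum]
  set s := c.support
  set η : Ω → ℝ := fun ω => ∑ t ∈ s, c t * X t ω with hη
  have hae : ⇑(∑ t ∈ s, c t • x t) =ᵐ[P] η := by
    have h : ∀ᵐ ω ∂P, ∀ t ∈ s, x t ω = X t ω := (Finset.eventually_all s).2 fun t _ => hx t
    filter_upwards [h, coeFn_sum_smul s c x] with ω h1 h2
    rw [h2]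
    exact Finset.sum_congr rfl fun t ht => by rw [h1 t ht]
  have hL : HasGaussianLaw η P := by
    have := (hX.smul c).hasGaussianLaw_fun_sum (I := s)
    exact this
  have hmean : ∫ ω, η ω ∂P = 0 := by
    rw [hη, integral_finsetSum]
    · simp [integral_const_mul, h0]
    · intro t _
      exact (hX.hasGaussianLaw_eval t).integrable.const_mul _
  have hvar : Var[η; P] = ‖∑ t ∈ s, c t • x t‖ ^ 2 := by
    rw [variance_of_integral_eq_zero hL.aemeasurable hmean, ← real_inner_self_eq_norm_sq,
      inner_eq_integral_mul]
    refine integral_congr_ae ?_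
    filter_upwards [hae] with ω hω
    rw [hω, sq]
  rw [charInt_congr hae]
  have h1 := hL.map_eq_gaussianReal
  have h2 : charInt P η = charFun (P.map η) 1 := by
    rw [charFun_apply_real, integral_map hL.aemeasurable (by fun_prop)]
    unfold charInt
    congr 1
    ext ω
    congr 1
    simp [mul_comm]
  rw [h2, h1, charFun_gaussianReal, hmean, hvar, Real.coe_toNNReal _ (sq_nonneg _)]
  congr 1
  push_cast
  ring

end GaussianSubspace

/-! ### Wick's formula by differentiation of characteristic functions -/

section Wick

variable {Ω : Type*} [MeasurableSpace Ω] {P : Measure Ω} [IsProbabilityMeasure P]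

/-- Hölder with both exponents equal to 2p. The variables with all finite moments thus form an
algebra, which makes every product of Gaussian variables integrable. -/
theorem memLp_mul_of_forall {f g : Ω → ℝ} (hf : ∀ p : ENNReal, p ≠ ⊤ → MemLp f p P)
    (hg : ∀ p : ENNReal, p ≠ ⊤ → MemLp g p P) {p : ENNReal} (hp : p ≠ ⊤) :
    MemLp (fun ω => f ω * g ω) p P := by
  have h : ENNReal.HolderTriple (p * 2) (p * 2) p := by
    constructor
    rw [ENNReal.mul_inv (Or.inr (by norm_num)) (Or.inl hp), ← mul_add, ENNReal.inv_two_add_inv_two,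
      mul_one]
  exact (hg (p * 2) (ENNReal.mul_ne_top hp (by norm_num))).mul
    (hf (p * 2) (ENNReal.mul_ne_top hp (by norm_num)))

theorem memLp_prod_of_forall {ι : Type*} {f : ι → Ω → ℝ} (s : Finset ι)
    (hf : ∀ i ∈ s, ∀ p : ENNReal, p ≠ ⊤ → MemLp (f i) p P) {p : ENNReal} (hp : p ≠ ⊤) :
    MemLp (fun ω => ∏ i ∈ s, f i ω) p P := by
  classical
  induction s using Finset.induction_on generalizing p with
  | empty => simpa using memLp_const (1 : ℝ)
  | insert a s ha ih =>
    simp_rw [Finset.prod_insert ha]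
    exact memLp_mul_of_forall (hf a (Finset.mem_insert_self _ _))
      (fun q hq => ih (fun i hi => hf i (Finset.mem_insert_of_mem hi)) hq) hp

theorem integrable_mul_exp_I {g : Ω → ℝ} (hg : Integrable g P) {u : Ω → ℝ}
    (hu : AEStronglyMeasurable u P) :
    Integrable (fun ω => (g ω : ℂ) * Complex.exp (Complex.I * u ω)) P := by
  refine hg.ofReal.mul_bdd (c := 1) (integrable_exp_I hu).aestronglyMeasurable ?_
  refine Eventually.of_forall fun ω => ?_
  rw [mul_comm, Complex.norm_exp_ofReal_mul_I]

/-- Differentiation of `E g e^{i(u + r a)}` in `r`. -/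
theorem hasDerivAt_integral_mul_exp_I {g : Ω → ℝ} (hg : Integrable g P) (u a : Lp ℝ 2 P)
    (hga : Integrable (fun ω => g ω * a ω) P) :
    HasDerivAt (fun r : ℝ => ∫ ω, (g ω : ℂ) * Complex.exp (Complex.I * (u + r • a : Lp ℝ 2 P) ω) ∂P)
      (Complex.I * ∫ ω, ((g ω * a ω : ℝ) : ℂ) * Complex.exp (Complex.I * u ω) ∂P) 0 := by
  have hcongr : (fun r : ℝ => ∫ ω, (g ω : ℂ) *
        Complex.exp (Complex.I * (u + r • a : Lp ℝ 2 P) ω) ∂P)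
      = fun r : ℝ => ∫ ω, (g ω : ℂ) * Complex.exp (Complex.I * ((u ω + r * a ω : ℝ) : ℂ)) ∂P := by
    ext r
    refine integral_congr_ae ?_
    filter_upwards [Lp.coeFn_add u (r • a), Lp.coeFn_smul r a] with ω h1 h2
    rw [h1, Pi.add_apply, h2]
    rfl
  rw [hcongr, ← integral_const_mul]
  have hua : ∀ r : ℝ, AEStronglyMeasurable (fun ω => u ω + r * a ω) P := fun r =>
    (Lp.aestronglyMeasurable u).add ((Lp.aestronglyMeasurable a).const_mul r)
  have key := hasDerivAt_integral_of_dominated_loc_of_deriv_le (μ := P) (𝕜 := ℝ)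
    (F := fun (r : ℝ) ω => (g ω : ℂ) * Complex.exp (Complex.I * ((u ω + r * a ω : ℝ) : ℂ)))
    (F' := fun (r : ℝ) ω => Complex.I * (((g ω * a ω : ℝ) : ℂ) *
      Complex.exp (Complex.I * ((u ω + r * a ω : ℝ) : ℂ))))
    (x₀ := 0) (s := Set.univ) (bound := fun ω => |g ω * a ω|) univ_mem
    (Eventually.of_forall fun r => (integrable_mul_exp_I hg (hua r)).aestronglyMeasurable)
    (integrable_mul_exp_I hg (hua 0))
    ((integrable_mul_exp_I hga (hua 0)).aestronglyMeasurable.const_mul _)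
    (Eventually.of_forall fun ω r _ => ?_) hga.abs
    (Eventually.of_forall fun ω r _ => ?_)
  · simpa using key.2
  · rw [norm_mul, norm_mul, Complex.norm_I, mul_comm Complex.I, Complex.norm_exp_ofReal_mul_I]
    simp
  · have h1 : HasDerivAt (fun r : ℝ => ((u ω + r * a ω : ℝ) : ℂ)) (a ω : ℂ) r := by
      have : HasDerivAt (fun r : ℝ => u ω + r * a ω) (a ω) r := by
        simpa using ((hasDerivAt_id r).mul_const (a ω)).const_add (u ω)
      exact this.ofReal_comp
    have h2 := ((h1.const_mul Complex.I).cexp).const_mul (g ω : ℂ)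
    refine h2.congr_deriv ?_
    push_cast
    ring

/-- The factor e^{iu} acts as a generating function. Moving u in the direction ξ b and
differentiating at 0 multiplies the integrands by iξ b, while the derivative of ⟨a, u⟩ creates the
new contraction ⟨a, ξ b⟩. The induction over s needs the identity for all u, although `wick` only
uses u = 0. The base case is the derivative of the Gaussian characteristic function in the direction
a. -/
theorem IsGaussianSubspace.wick_exp {S : Submodule ℝ (Lp ℝ 2 P)} (hS : IsGaussianSubspace S)
    {ι : Type*} [DecidableEq ι] {ξ : ι → Lp ℝ 2 P} (hξ : ∀ i, ξ i ∈ S) (s : Finset ι)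
    {a u : Lp ℝ 2 P} (ha : a ∈ S) (hu : u ∈ S) :
    ∫ ω, ((a ω * ∏ j ∈ s, ξ j ω : ℝ) : ℂ) * Complex.exp (Complex.I * u ω) ∂P
      = Complex.I * (inner ℝ a u : ℝ) *
          ∫ ω, ((∏ j ∈ s, ξ j ω : ℝ) : ℂ) * Complex.exp (Complex.I * u ω) ∂P
        + ∑ b ∈ s, ((inner ℝ a (ξ b) : ℝ) : ℂ) *
          ∫ ω, ((∏ j ∈ s.erase b, ξ j ω : ℝ) : ℂ) * Complex.exp (Complex.I * u ω) ∂P := by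
  have hp : ∀ t : Finset ι, ∀ p : ENNReal, p ≠ ⊤ → MemLp (fun ω => ∏ j ∈ t, ξ j ω) p P :=
    fun t p hp => memLp_prod_of_forall t (fun i _ q hq => hS.memLp (hξ i) hq) hp
  have hint : ∀ t : Finset ι, Integrable (fun ω => ∏ j ∈ t, ξ j ω) P := fun t =>
    memLp_one_iff_integrable.1 (hp t 1 (by norm_num))
  have hint2 : ∀ t : Finset ι, ∀ b ∈ S, Integrable (fun ω => (∏ j ∈ t, ξ j ω) * b ω) P :=
    fun t b hb => memLp_one_iff_integrable.1
      (memLp_mul_of_forall (hp t) (fun p hq => hS.memLp hb hq) (by norm_num))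
  have hint3 : ∀ t : Finset ι, ∀ b ∈ S, Integrable (fun ω => b ω * ∏ j ∈ t, ξ j ω) P :=
    fun t b hb => memLp_one_iff_integrable.1
      (memLp_mul_of_forall (fun p hq => hS.memLp hb hq) (hp t) (by norm_num))
  induction s using Finset.induction_on generalizing a u with
  | empty =>
    have h1 := hasDerivAt_integral_mul_exp_I (P := P) (g := fun _ => 1) (integrable_const _) u a
      (by simpa using hint3 ∅ a ha)
    have h2 : HasDerivAt (fun r : ℝ =>
        Complex.exp (-((‖u + r • a‖ ^ 2 / 2 : ℝ) : ℂ)))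
        (Complex.exp (-((‖u‖ ^ 2 / 2 : ℝ) : ℂ)) * -((inner ℝ a u : ℝ) : ℂ)) 0 := by
      have h3 : HasDerivAt (fun r : ℝ => -(‖u + r • a‖ ^ 2 / 2)) (-(inner ℝ a u)) 0 := by
        have h4 : HasDerivAt (fun r : ℝ => u + r • a) a 0 := by
          simpa using ((hasDerivAt_id (0 : ℝ)).smul_const a).const_add u
        have h5 := (h4.norm_sq.div_const 2).neg
        refine h5.congr_deriv ?_
        simp [real_inner_comm]
      have h6 := h3.ofReal_comp.cexp
      simpa using h6
    have h7 : (fun r : ℝ => ∫ ω, ((1 : ℝ) : ℂ) *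
        Complex.exp (Complex.I * (u + r • a : Lp ℝ 2 P) ω) ∂P)
        = fun r : ℝ => Complex.exp (-((‖u + r • a‖ ^ 2 / 2 : ℝ) : ℂ)) := by
      ext r
      rw [← hS _ (S.add_mem hu (S.smul_mem r ha))]
      simp [charInt]
    rw [h7] at h1
    have h8 := h1.unique h2
    have h9 : ∫ ω, Complex.exp (Complex.I * u ω) ∂P = Complex.exp (-((‖u‖ ^ 2 / 2 : ℝ) : ℂ)) :=
      hS u hu
    simp only [Finset.prod_empty, mul_one, Finset.sum_empty, add_zero, Complex.ofReal_one, one_mul]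
    simp only [one_mul] at h8
    rw [h9]
    have h10 : ∫ ω, (a ω : ℂ) * Complex.exp (Complex.I * u ω) ∂P
        = -Complex.I * (Complex.I * ∫ ω, (a ω : ℂ) * Complex.exp (Complex.I * u ω) ∂P) := by
      rw [← mul_assoc]; simp
    rw [h10, h8]
    ring
  | insert b s hb ih =>
    have hbS := hξ b
    have hderiv := hasDerivAt_integral_mul_exp_I (P := P) (hint3 s a ha) u (ξ b) (by
      refine memLp_one_iff_integrable.1 (memLp_mul_of_forall (f := fun ω => a ω * ∏ j ∈ s, ξ j ω)
        (fun p hq => memLp_mul_of_forall (fun p hq => hS.memLp ha hq) (hp s) hq)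
        (fun p hq => hS.memLp hbS hq) (by norm_num)))
    have hfun := fun r : ℝ => ih ha (S.add_mem hu (S.smul_mem r hbS))
    rw [funext hfun] at hderiv
    have hF : ∀ t : Finset ι, b ∉ t → HasDerivAt (fun r : ℝ =>
        ∫ ω, ((∏ j ∈ t, ξ j ω : ℝ) : ℂ) * Complex.exp (Complex.I * (u + r • ξ b : Lp ℝ 2 P) ω) ∂P)
        (Complex.I * ∫ ω, ((∏ j ∈ insert b t, ξ j ω : ℝ) : ℂ) *
          Complex.exp (Complex.I * u ω) ∂P) 0 := by
      intro t hbt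
      have := hasDerivAt_integral_mul_exp_I (P := P) (hint t) u (ξ b) (hint2 t (ξ b) hbS)
      simp_rw [Finset.prod_insert hbt, mul_comm (ξ b _)]
      exact this
    have hin : HasDerivAt (fun r : ℝ => Complex.I * ((inner ℝ a (u + r • ξ b) : ℝ) : ℂ))
        (Complex.I * ((inner ℝ a (ξ b) : ℝ) : ℂ)) 0 := by
      have h1 : HasDerivAt (fun r : ℝ => inner ℝ a (u + r • ξ b)) (inner ℝ a (ξ b)) 0 := by
        simp_rw [inner_add_right, inner_smul_right]
        simpa using ((hasDerivAt_id (0 : ℝ)).mul_const (inner ℝ a (ξ b))).const_add (inner ℝ a u)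
      exact h1.ofReal_comp.const_mul _
    have hsum : HasDerivAt (fun r : ℝ => ∑ d ∈ s, ((inner ℝ a (ξ d) : ℝ) : ℂ) *
          ∫ ω, ((∏ j ∈ s.erase d, ξ j ω : ℝ) : ℂ) *
            Complex.exp (Complex.I * (u + r • ξ b : Lp ℝ 2 P) ω) ∂P)
        (∑ d ∈ s, ((inner ℝ a (ξ d) : ℝ) : ℂ) * (Complex.I *
          ∫ ω, ((∏ j ∈ insert b (s.erase d), ξ j ω : ℝ) : ℂ) *
            Complex.exp (Complex.I * u ω) ∂P)) 0 := by
      refine HasDerivAt.fun_sum fun d _ => ?_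
      exact (hF (s.erase d) (fun h => hb (Finset.mem_of_mem_erase h))).const_mul _
    have htot := (hin.mul (hF s hb)).add hsum
    -- The same derivative computed twice: under the integral sign, and term by term from the
    -- induction hypothesis. A common factor i remains and is cancelled at the end.
    have heq := hderiv.unique htot
    simp only [zero_smul, add_zero] at heq
    have hlhs : ∀ ω, a ω * ∏ j ∈ insert b s, ξ j ω = (a ω * ∏ j ∈ s, ξ j ω) * ξ b ω := by
      intro ω
      rw [Finset.prod_insert hb]
      ring
    simp_rw [hlhs]
    rw [Finset.sum_insert hb, Finset.erase_insert hb]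
    have hsum2 : ∑ d ∈ s, ((inner ℝ a (ξ d) : ℝ) : ℂ) *
          ∫ ω, ((∏ j ∈ (insert b s).erase d, ξ j ω : ℝ) : ℂ) * Complex.exp (Complex.I * u ω) ∂P
        = ∑ d ∈ s, ((inner ℝ a (ξ d) : ℝ) : ℂ) *
          ∫ ω, ((∏ j ∈ insert b (s.erase d), ξ j ω : ℝ) : ℂ) *
            Complex.exp (Complex.I * u ω) ∂P := by
      refine Finset.sum_congr rfl fun d hd => ?_
      rw [Finset.erase_insert_of_ne (by rintro rfl; exact hb hd)]
    rw [hsum2]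
    have hsum3 : ∑ d ∈ s, ((inner ℝ a (ξ d) : ℝ) : ℂ) * (Complex.I *
          ∫ ω, ((∏ j ∈ insert b (s.erase d), ξ j ω : ℝ) : ℂ) * Complex.exp (Complex.I * u ω) ∂P)
        = Complex.I * ∑ d ∈ s, ((inner ℝ a (ξ d) : ℝ) : ℂ) *
          ∫ ω, ((∏ j ∈ insert b (s.erase d), ξ j ω : ℝ) : ℂ) *
            Complex.exp (Complex.I * u ω) ∂P := by
      rw [Finset.mul_sum]
      exact Finset.sum_congr rfl fun d _ => by ring
    rw [hsum3] at heq
    refine mul_left_cancel₀ Complex.I_ne_zero (heq.trans ?_)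
    ring

/-- Gaussian integration by parts (Isserlis, Wick). -/
theorem IsGaussianSubspace.wick {S : Submodule ℝ (Lp ℝ 2 P)} (hS : IsGaussianSubspace S)
    {ι : Type*} [DecidableEq ι] {ξ : ι → Lp ℝ 2 P} (hξ : ∀ i, ξ i ∈ S) (s : Finset ι)
    {a : Lp ℝ 2 P} (ha : a ∈ S) :
    ∫ ω, a ω * ∏ j ∈ s, ξ j ω ∂P
      = ∑ b ∈ s, inner ℝ a (ξ b) * ∫ ω, ∏ j ∈ s.erase b, ξ j ω ∂P := by
  have h := hS.wick_exp hξ s ha S.zero_mem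
  have h0 : ∀ g : Ω → ℝ, ∫ ω, ((g ω : ℝ) : ℂ) * Complex.exp (Complex.I * (0 : Lp ℝ 2 P) ω) ∂P
      = ((∫ ω, g ω ∂P : ℝ) : ℂ) := by
    intro g
    rw [← integral_complex_ofReal]
    refine integral_congr_ae ?_
    filter_upwards [Lp.coeFn_zero ℝ 2 P] with ω hω
    rw [hω]
    simp
  rw [h0 (fun ω => a ω * ∏ j ∈ s, ξ j ω)] at h
  simp only [h0 (fun ω => ∏ j ∈ Finset.erase s _, ξ j ω), inner_zero_right, Complex.ofReal_zero,
    mul_zero, zero_mul, zero_add] at h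
  exact_mod_cast h

end Wick

/-! ### Centered products of Gaussian variables as a bounded bilinear map -/

section CenteredProduct

variable {Ω : Type*} [MeasurableSpace Ω] {P : Measure Ω} [IsProbabilityMeasure P]
  {S : Submodule ℝ (Lp ℝ 2 P)}

theorem IsGaussianSubspace.memLp_mul (hS : IsGaussianSubspace S) (a b : S) {p : ENNReal}
    (hp : p ≠ ⊤) :
    MemLp (fun ω => (a : Lp ℝ 2 P) ω * (b : Lp ℝ 2 P) ω) p P :=
  memLp_mul_of_forall (fun _ hq => hS.memLp a.2 hq) (fun _ hq => hS.memLp b.2 hq) hp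

theorem IsGaussianSubspace.memLp_centeredMul (hS : IsGaussianSubspace S) (a b : S) :
    MemLp (fun ω => (a : Lp ℝ 2 P) ω * (b : Lp ℝ 2 P) ω - inner ℝ a b) 2 P :=
  (hS.memLp_mul a b (by norm_num)).sub (memLp_const _)

/-- The centered product `a b - E a b`. -/
noncomputable def IsGaussianSubspace.centeredMul (hS : IsGaussianSubspace S) (a b : S) :
    Lp ℝ 2 P :=
  (hS.memLp_centeredMul a b).toLp _

theorem IsGaussianSubspace.coeFn_centeredMul (hS : IsGaussianSubspace S) (a b : S) :
    hS.centeredMul a b =ᵐ[P] fun ω => (a : Lp ℝ 2 P) ω * (b : Lp ℝ 2 P) ω - inner ℝ a b :=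
  MemLp.coeFn_toLp _

theorem IsGaussianSubspace.integral_mul_four (hS : IsGaussianSubspace S) (a b c d : S) :
    ∫ ω, (a : Lp ℝ 2 P) ω * ((b : Lp ℝ 2 P) ω * ((c : Lp ℝ 2 P) ω * (d : Lp ℝ 2 P) ω)) ∂P
      = inner ℝ a b * inner ℝ c d + inner ℝ a c * inner ℝ b d + inner ℝ a d * inner ℝ b c := by
  have h := hS.wick (ξ := ![(b : Lp ℝ 2 P), (c : Lp ℝ 2 P), (d : Lp ℝ 2 P)])
    (fun i => by fin_cases i <;> simp) Finset.univ a.2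
  have e0 : (Finset.univ.erase 0 : Finset (Fin 3)) = {1, 2} := by decide
  have e1 : (Finset.univ.erase 1 : Finset (Fin 3)) = {0, 2} := by decide
  have e2 : (Finset.univ.erase 2 : Finset (Fin 3)) = {0, 1} := by decide
  rw [Fin.sum_univ_three, e0, e1, e2] at h
  simp only [Fin.prod_univ_three, Finset.prod_pair (show (1 : Fin 3) ≠ 2 by decide),
    Finset.prod_pair (show (0 : Fin 3) ≠ 2 by decide),
    Finset.prod_pair (show (0 : Fin 3) ≠ 1 by decide), Matrix.cons_val_zero, Matrix.cons_val_one,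
    Matrix.cons_val, ← inner_eq_integral_mul] at h
  simp only [mul_assoc] at h
  simpa using h

/-- Of the three pairings of four Gaussian factors, centering removes exactly ⟨a,b⟩⟨c,d⟩. -/
theorem IsGaussianSubspace.inner_centeredMul (hS : IsGaussianSubspace S) (a b c d : S) :
    inner ℝ (hS.centeredMul a b) (hS.centeredMul c d)
      = inner ℝ a c * inner ℝ b d + inner ℝ a d * inner ℝ b c := by
  have hab := hS.memLp_mul a b (p := 2) (by norm_num)
  have hcd := hS.memLp_mul c d (p := 2) (by norm_num)
  have i1 := hab.integrable (by norm_num)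
  have i2 := hcd.integrable (by norm_num)
  have i3 : Integrable (fun ω => (a : Lp ℝ 2 P) ω * ((b : Lp ℝ 2 P) ω *
      ((c : Lp ℝ 2 P) ω * (d : Lp ℝ 2 P) ω))) P := by
    have := hab.integrable_mul hcd
    refine this.congr (Eventually.of_forall fun ω => ?_)
    simp only [Pi.mul_apply]
    ring
  have e1 : ∫ ω, (a : Lp ℝ 2 P) ω * (b : Lp ℝ 2 P) ω ∂P = inner ℝ a b := by
    rw [Submodule.coe_inner, inner_eq_integral_mul]
  have e2 : ∫ ω, (c : Lp ℝ 2 P) ω * (d : Lp ℝ 2 P) ω ∂P = inner ℝ c d := by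
    rw [Submodule.coe_inner, inner_eq_integral_mul]
  rw [inner_eq_integral_mul]
  have h : (fun ω => hS.centeredMul a b ω * hS.centeredMul c d ω) =ᵐ[P] fun ω =>
      (((a : Lp ℝ 2 P) ω * ((b : Lp ℝ 2 P) ω * ((c : Lp ℝ 2 P) ω * (d : Lp ℝ 2 P) ω)))
        - inner ℝ c d * ((a : Lp ℝ 2 P) ω * (b : Lp ℝ 2 P) ω))
        - (inner ℝ a b * ((c : Lp ℝ 2 P) ω * (d : Lp ℝ 2 P) ω) - inner ℝ a b * inner ℝ c d) := by
    filter_upwards [hS.coeFn_centeredMul a b, hS.coeFn_centeredMul c d] with ω h1 h2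
    rw [h1, h2]
    ring
  have j1 : Integrable (fun ω => ((a : Lp ℝ 2 P) ω * ((b : Lp ℝ 2 P) ω *
      ((c : Lp ℝ 2 P) ω * (d : Lp ℝ 2 P) ω))) - inner ℝ c d *
      ((a : Lp ℝ 2 P) ω * (b : Lp ℝ 2 P) ω)) P := i3.sub (i1.const_mul _)
  have j2 : Integrable (fun ω => inner ℝ a b * ((c : Lp ℝ 2 P) ω * (d : Lp ℝ 2 P) ω)
      - inner ℝ a b * inner ℝ c d) P := (i2.const_mul _).sub (integrable_const _)
  rw [integral_congr_ae h, integral_sub j1 j2, integral_sub i3 (i1.const_mul _),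
    integral_sub (i2.const_mul _) (integrable_const _), integral_const_mul, integral_const_mul,
    e1, e2, hS.integral_mul_four]
  simp
  ring

/-- The squared norm is ‖a‖²‖b‖² + ⟨a,b⟩² ≤ 2‖a‖²‖b‖² by Cauchy–Schwarz. The constant 2 in place of
√2 is for convenience only. -/
theorem IsGaussianSubspace.norm_centeredMul_le (hS : IsGaussianSubspace S) (a b : S) :
    ‖hS.centeredMul a b‖ ≤ 2 * ‖a‖ * ‖b‖ := by
  refine abs_le_of_sq_le_sq' ?_ (by positivity) |>.2
  rw [← real_inner_self_eq_norm_sq, hS.inner_centeredMul, real_inner_self_eq_norm_sq,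
    real_inner_self_eq_norm_sq, real_inner_comm b a]
  have h1 : inner ℝ b a * inner ℝ b a ≤ ‖b‖ * ‖a‖ * (‖b‖ * ‖a‖) := by
    exact real_inner_mul_inner_self_le b a |>.trans (by
      rw [real_inner_self_eq_norm_sq, real_inner_self_eq_norm_sq]; apply le_of_eq; ring)
  nlinarith [sq_nonneg (‖a‖ * ‖b‖)]

/-- The centered product as a continuous bilinear map. -/
noncomputable def IsGaussianSubspace.centeredMulCLM (hS : IsGaussianSubspace S) :
    S →L[ℝ] S →L[ℝ] Lp ℝ 2 P :=
  LinearMap.mkContinuous₂ (LinearMap.mk₂ ℝ hS.centeredMul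
    (fun a a' b => by
      refine Lp.ext ?_
      filter_upwards [hS.coeFn_centeredMul (a + a') b, hS.coeFn_centeredMul a b,
        hS.coeFn_centeredMul a' b, Lp.coeFn_add (hS.centeredMul a b) (hS.centeredMul a' b),
        Lp.coeFn_add (a : Lp ℝ 2 P) a'] with ω h1 h2 h3 h4 h5
      rw [h4, Pi.add_apply, h1, h2, h3, Submodule.coe_add, h5, inner_add_left, Pi.add_apply]
      ring)
    (fun r a b => by
      refine Lp.ext ?_
      filter_upwards [hS.coeFn_centeredMul (r • a) b, hS.coeFn_centeredMul a b,
        Lp.coeFn_smul r (hS.centeredMul a b), Lp.coeFn_smul r (a : Lp ℝ 2 P)] with ω h1 h2 h3 h4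
      rw [h3, Pi.smul_apply, h1, h2, Submodule.coe_smul, h4, show inner ℝ (r • a) b = r * inner ℝ a b from
        real_inner_smul_left a b r, Pi.smul_apply,
        smul_eq_mul, smul_eq_mul]
      ring)
    (fun a b b' => by
      refine Lp.ext ?_
      filter_upwards [hS.coeFn_centeredMul a (b + b'), hS.coeFn_centeredMul a b,
        hS.coeFn_centeredMul a b', Lp.coeFn_add (hS.centeredMul a b) (hS.centeredMul a b'),
        Lp.coeFn_add (b : Lp ℝ 2 P) b'] with ω h1 h2 h3 h4 h5
      rw [h4, Pi.add_apply, h1, h2, h3, Submodule.coe_add, h5, inner_add_right, Pi.add_apply]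
      ring)
    (fun r a b => by
      refine Lp.ext ?_
      filter_upwards [hS.coeFn_centeredMul a (r • b), hS.coeFn_centeredMul a b,
        Lp.coeFn_smul r (hS.centeredMul a b), Lp.coeFn_smul r (b : Lp ℝ 2 P)] with ω h1 h2 h3 h4
      rw [h3, Pi.smul_apply, h1, h2, Submodule.coe_smul, h4, show inner ℝ a (r • b) = r * inner ℝ a b from
        real_inner_smul_right a b r, Pi.smul_apply,
        smul_eq_mul, smul_eq_mul]
      ring)) 2 (fun a b => hS.norm_centeredMul_le a b)

theorem IsGaussianSubspace.centeredMulCLM_apply (hS : IsGaussianSubspace S) (a b : S) :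
    hS.centeredMulCLM a b = hS.centeredMul a b := rfl

theorem IsGaussianSubspace.centeredMul_comm (hS : IsGaussianSubspace S) (a b : S) :
    hS.centeredMul a b = hS.centeredMul b a := by
  refine Lp.ext ?_
  filter_upwards [hS.coeFn_centeredMul a b, hS.coeFn_centeredMul b a] with ω h1 h2
  rw [h1, h2, mul_comm, real_inner_comm]

end CenteredProduct

/-! ### Estimates for a centered chi-square variable -/

section ChiSquare

/-- For |x| ≤ 1 this is the remainder of the exponential series. For |x| > 1 all terms are bounded
separately by multiples of |x|³, with total 1 + 1 + 1 + 1/2 ≤ 4. -/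
theorem norm_exp_I_taylor_le (x : ℝ) :
    ‖Complex.exp (Complex.I * x) - (1 + Complex.I * x - x ^ 2 / 2)‖ ≤ 4 * |x| ^ 3 := by
  rcases le_or_gt |x| 1 with hx | hx
  · have hn : ‖Complex.I * (x : ℂ)‖ = |x| := by simp
    have h := Complex.exp_bound (x := Complex.I * x) (by rw [hn]; exact hx) (n := 3) (by norm_num)
    rw [hn] at h
    have e : ∑ m ∈ Finset.range 3, (Complex.I * (x : ℂ)) ^ m / (m.factorial : ℂ)
        = 1 + Complex.I * x - x ^ 2 / 2 := by
      simp [Finset.sum_range_succ, mul_pow]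
      ring
    rw [e] at h
    refine h.trans ?_
    rw [mul_comm]
    refine mul_le_mul_of_nonneg_right ?_ (by positivity)
    norm_num [Nat.factorial]
  · have h1 : ‖Complex.exp (Complex.I * x)‖ = 1 := by
      rw [mul_comm, Complex.norm_exp_ofReal_mul_I]
    have h2 : ‖1 + Complex.I * x - (x : ℂ) ^ 2 / 2‖ ≤ 1 + |x| + |x| ^ 2 / 2 := by
      refine (norm_sub_le _ _).trans (add_le_add ((norm_add_le _ _).trans ?_) ?_)
      · simp
      · simp
    refine (norm_sub_le _ _).trans ?_
    rw [h1]
    have h3 : |x| ^ 2 ≤ |x| ^ 3 := pow_le_pow_right₀ hx.le (by norm_num)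
    have h4 : |x| ≤ |x| ^ 3 := by simpa using pow_le_pow_right₀ hx.le (show 1 ≤ 3 by norm_num)
    nlinarith

/-- The integral equals e^{-s}(1-2s)^{-1/2}, whose logarithm -s - log(1-2s)/2 vanishes to first
order at 0. The restriction on s keeps 1 - 2|s| ≥ 1/2, so that the remainder of the logarithm is at
most 8s² before halving. -/
theorem integrable_exp_chiSq {s : ℝ} (hs : |s| ≤ 1 / 4) :
    Integrable (fun x : ℝ => Real.exp (s * (x ^ 2 - 1))) (gaussianReal 0 1) ∧
      ∫ x, Real.exp (s * (x ^ 2 - 1)) ∂(gaussianReal 0 1) ≤ Real.exp (4 * s ^ 2) := by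
  have hs1 := (abs_le.1 hs).1
  have hs2 := (abs_le.1 hs).2
  have hb : 0 < 1 / 2 - s := by linarith
  have hfun : ∀ x : ℝ, gaussianPDFReal 0 1 x * Real.exp (s * (x ^ 2 - 1))
      = ((√(2 * Real.pi))⁻¹ * Real.exp (-s)) * Real.exp (-(1 / 2 - s) * x ^ 2) := by
    intro x
    simp only [gaussianPDFReal, NNReal.coe_one, mul_one, sub_zero]
    rw [mul_assoc, mul_assoc, ← Real.exp_add, ← Real.exp_add]
    congr 2
    ring
  constructor
  · rw [gaussianReal_of_var_ne_zero _ (by norm_num), integrable_withDensity_iff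
      (measurable_gaussianPDF 0 1) (Eventually.of_forall fun x => gaussianPDF_lt_top)]
    simp_rw [toReal_gaussianPDF, mul_comm _ (gaussianPDFReal 0 1 _), hfun]
    exact (integrable_exp_neg_mul_sq hb).const_mul _
  · rw [integral_gaussianReal_eq_integral_smul (by norm_num)]
    simp_rw [smul_eq_mul, hfun]
    rw [integral_const_mul, integral_gaussian]
    have h1 : √(Real.pi / (1 / 2 - s)) = √(2 * Real.pi) * √((1 - 2 * s)⁻¹) := by
      rw [← Real.sqrt_mul (by positivity)]
      congr 1
      field_simp
    have hpi : √(2 * Real.pi) ≠ 0 := by positivity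
    rw [h1]
    have h2 : (√(2 * Real.pi))⁻¹ * Real.exp (-s) * (√(2 * Real.pi) * √((1 - 2 * s)⁻¹))
        = Real.exp (-s) * √((1 - 2 * s)⁻¹) := by
      field_simp
    rw [h2]
    have hpos : 0 < 1 - 2 * s := by linarith
    have h3 : √((1 - 2 * s)⁻¹) = Real.exp (-(Real.log (1 - 2 * s)) / 2) := by
      rw [Real.sqrt_eq_rpow, Real.rpow_def_of_pos (by positivity), Real.log_inv]
      congr 1
      ring
    rw [h3, ← Real.exp_add]
    refine Real.exp_le_exp.2 ?_
    have habs : |2 * s| = 2 * |s| := by rw [abs_mul]; norm_num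
    have h4 := Real.abs_log_sub_add_sum_range_le (x := 2 * s) (by rw [habs]; linarith) 1
    simp only [Finset.range_one, Finset.sum_singleton, zero_add, pow_one, Nat.cast_zero,
      div_one] at h4
    have h5 : |2 * s| ^ (1 + 1) / (1 - |2 * s|) ≤ 8 * s ^ 2 := by
      rw [habs, div_le_iff₀ (by linarith)]
      have : (2 * |s|) ^ (1 + 1) = 4 * s ^ 2 := by
        rw [show 1 + 1 = 2 by norm_num, mul_pow, sq_abs]; ring
      rw [this]
      nlinarith [sq_nonneg s, abs_nonneg s]
    have h6 := (abs_le.1 (h4.trans h5)).1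
    linarith

end ChiSquare

/-! ### Diagonal quadratic forms: closeness to a Gaussian law and exponential moments -/

section Diagonal

variable {Ω : Type*} [MeasurableSpace Ω] {P : Measure Ω} [IsProbabilityMeasure P]
  {S : Submodule ℝ (Lp ℝ 2 P)}

/-- The factors are exchanged one at a time. For independent summands the errors of the
characteristic functions therefore add up. -/
theorem norm_prod_sub_prod_le {ι : Type*} (s : Finset ι) (a b : ι → ℂ) (ha : ∀ i, ‖a i‖ ≤ 1)
    (hb : ∀ i, ‖b i‖ ≤ 1) : ‖∏ i ∈ s, a i - ∏ i ∈ s, b i‖ ≤ ∑ i ∈ s, ‖a i - b i‖ := by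
  classical
  induction s using Finset.induction_on with
  | empty => simp
  | insert i s hi ih =>
    rw [Finset.prod_insert hi, Finset.prod_insert hi, Finset.sum_insert hi]
    have h : a i * ∏ j ∈ s, a j - b i * ∏ j ∈ s, b j
        = (a i - b i) * ∏ j ∈ s, a j + b i * (∏ j ∈ s, a j - ∏ j ∈ s, b j) := by ring
    rw [h]
    refine (norm_add_le _ _).trans (add_le_add ?_ ?_)
    · rw [norm_mul]
      refine mul_le_of_le_one_right (norm_nonneg _) ?_
      rw [norm_prod]
      exact Finset.prod_le_one (fun _ _ => norm_nonneg _) (fun j _ => ha j)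
    · rw [norm_mul]
      exact (mul_le_of_le_one_left (norm_nonneg _) (hb i)).trans ih

/-- The constant of the third order estimate of the characteristic function of `x ^ 2 - 1`. -/
noncomputable def chiSqConst : ℝ := 4 * ∫ x, |x ^ 2 - 1| ^ 3 ∂(gaussianReal 0 1) + 1

theorem chiSqConst_nonneg : 0 ≤ chiSqConst := by
  unfold chiSqConst
  have : 0 ≤ ∫ x, |x ^ 2 - 1| ^ 3 ∂(gaussianReal 0 1) := integral_nonneg fun x => by positivity
  linarith

theorem IsGaussianSubspace.map_eq_std (hS : IsGaussianSubspace S) {g : S} (hg : ‖g‖ = 1) :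
    P.map (g : Lp ℝ 2 P) = gaussianReal 0 1 := by
  rw [hS.map_eq g.2, Submodule.norm_coe, hg]
  simp

theorem integrable_chiSq_cube : Integrable (fun x : ℝ => |x ^ 2 - 1| ^ 3) (gaussianReal 0 1) := by
  have h : ∀ p : ENNReal, p ≠ ⊤ → MemLp (fun x : ℝ => x) p (gaussianReal 0 1) := fun p hp =>
    IsGaussian.memLp_id (gaussianReal 0 1) p hp
  have h2 : ∀ p : ENNReal, p ≠ ⊤ → MemLp (fun x : ℝ => x ^ 2 - 1) p (gaussianReal 0 1) := by
    intro p hp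
    simp_rw [sq]
    exact (memLp_mul_of_forall h h hp).sub (memLp_const _)
  have h3 := (h2 3 (by norm_num)).integrable_norm_pow (p := 3) (by norm_num)
  simpa using h3

/-- Under the standard normal law x² - 1 has mean 0 and variance 2, so both terms agree with 1 - l²
up to third order. The unit vector g only serves to read off these two moments from the inner
products of the Gaussian subspace. -/
theorem IsGaussianSubspace.norm_charFun_chiSq_le (hS : IsGaussianSubspace S) {g : S}
    (hg : ‖g‖ = 1) {l : ℝ} (hl : |l| ≤ 1) :
    ‖∫ x : ℝ, Complex.exp (Complex.I * (l * (x ^ 2 - 1) : ℝ)) ∂(gaussianReal 0 1)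
      - Complex.exp (-((l ^ 2 : ℝ) : ℂ))‖ ≤ chiSqConst * |l| ^ 3 := by
  set γ := gaussianReal 0 1
  have hmap : P.map (g : Lp ℝ 2 P) = γ := hS.map_eq_std hg
  have hm : AEMeasurable (g : Lp ℝ 2 P) P := (Lp.aestronglyMeasurable _).aemeasurable
  have hid : ∀ p : ENNReal, p ≠ ⊤ → MemLp (fun x : ℝ => x) p γ := fun p hp =>
    IsGaussian.memLp_id γ p hp
  have h2 : ∀ p : ENNReal, p ≠ ⊤ → MemLp (fun x : ℝ => x ^ 2 - 1) p γ := by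
    intro p hp
    simp_rw [sq]
    exact (memLp_mul_of_forall hid hid hp).sub (memLp_const _)
  have i1 : Integrable (fun x : ℝ => x ^ 2 - 1) γ := (h2 2 (by norm_num)).integrable (by norm_num)
  have i2 : Integrable (fun x : ℝ => (x ^ 2 - 1) ^ 2) γ := (h2 2 (by norm_num)).integrable_sq
  have hinner : inner ℝ g g = 1 := by rw [real_inner_self_eq_norm_sq, hg]; norm_num
  have m1 : ∫ x, (x ^ 2 - 1) ∂γ = 0 := by
    rw [← hmap, integral_map hm (by fun_prop), integral_sub, integral_const]
    · have := inner_eq_integral_mul (g : Lp ℝ 2 P) g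
      simp_rw [sq]
      rw [← this, ← Submodule.coe_inner, hinner]
      simp
    · exact (hS.memLp g.2 (p := 2) (by norm_num)).integrable_sq
    · exact integrable_const _
  have m2 : ∫ x, (x ^ 2 - 1) ^ 2 ∂γ = 2 := by
    have h := hS.inner_centeredMul g g g g
    rw [hinner, inner_eq_integral_mul] at h
    rw [← hmap, integral_map hm (by fun_prop)]
    rw [show (2 : ℝ) = 1 * 1 + 1 * 1 by norm_num, ← h]
    refine integral_congr_ae ?_
    filter_upwards [hS.coeFn_centeredMul g g] with ω h1
    rw [h1, hinner]
    ring
  have hT : ∫ x : ℝ, (1 + Complex.I * (l * (x ^ 2 - 1) : ℝ) - ((l * (x ^ 2 - 1) : ℝ) : ℂ) ^ 2 / 2 : ℂ) ∂γ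
      = 1 - ((l ^ 2 : ℝ) : ℂ) := by
    have e : ∀ x : ℝ, (1 + Complex.I * (l * (x ^ 2 - 1) : ℝ)
          - ((l * (x ^ 2 - 1) : ℝ) : ℂ) ^ 2 / 2 : ℂ)
        = 1 + (Complex.I * l) * ((x ^ 2 - 1 : ℝ) : ℂ)
          - (l ^ 2 / 2 : ℂ) * (((x ^ 2 - 1) ^ 2 : ℝ) : ℂ) := by
      intro x
      push_cast
      ring
    simp_rw [e]
    have k1 : Integrable (fun x : ℝ => (Complex.I * l) * ((x ^ 2 - 1 : ℝ) : ℂ)) γ :=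
      i1.ofReal.const_mul _
    have k2 : Integrable (fun x : ℝ => (l ^ 2 / 2 : ℂ) * (((x ^ 2 - 1) ^ 2 : ℝ) : ℂ)) γ :=
      i2.ofReal.const_mul _
    have k3 : Integrable (fun x : ℝ => (1 : ℂ) + (Complex.I * l) * ((x ^ 2 - 1 : ℝ) : ℂ)) γ :=
      (integrable_const _).add k1
    rw [integral_sub k3 k2, integral_add (integrable_const _) k1, integral_const_mul,
      integral_const_mul, integral_complex_ofReal, integral_complex_ofReal, m1, m2]
    simp
  have hmeas : AEStronglyMeasurable (fun x : ℝ => l * (x ^ 2 - 1)) γ := by fun_prop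
  have i3 : Integrable (fun x : ℝ => (1 + Complex.I * (l * (x ^ 2 - 1) : ℝ)
      - ((l * (x ^ 2 - 1) : ℝ) : ℂ) ^ 2 / 2)) γ := by
    refine ((integrable_const (1 : ℂ)).add ((i1.const_mul l).ofReal.const_mul Complex.I)).sub ?_
    have := ((i2.const_mul (l ^ 2)).ofReal (𝕜 := ℂ)).div_const 2
    refine this.congr (Eventually.of_forall fun x => ?_)
    simp
    ring
  have h1 : ‖∫ x : ℝ, Complex.exp (Complex.I * (l * (x ^ 2 - 1) : ℝ)) ∂γ - (1 - ((l ^ 2 : ℝ) : ℂ))‖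
      ≤ (4 * ∫ x, |x ^ 2 - 1| ^ 3 ∂γ) * |l| ^ 3 := by
    rw [← hT, ← integral_sub (integrable_exp_I hmeas) i3]
    refine (norm_integral_le_integral_norm _).trans ?_
    rw [← integral_const_mul, ← integral_mul_const]
    refine integral_mono_of_nonneg (Eventually.of_forall fun _ => norm_nonneg _)
      ((integrable_chiSq_cube.const_mul 4).mul_const _) (Eventually.of_forall fun x => ?_)
    refine (norm_exp_I_taylor_le (l * (x ^ 2 - 1))).trans (le_of_eq ?_)
    rw [abs_mul]
    ring
  -- The error on the Gaussian side is of order l⁴ ≤ |l|³; it accounts for the summand 1 in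
  -- `chiSqConst`.
  have h3 : ‖Complex.exp (-((l ^ 2 : ℝ) : ℂ)) - (1 - ((l ^ 2 : ℝ) : ℂ))‖ ≤ |l| ^ 3 := by
    have hl2 : l ^ 2 ≤ 1 := by rw [← sq_abs]; exact pow_le_one₀ (abs_nonneg _) hl
    have := Real.abs_exp_sub_one_sub_id_le (x := -(l ^ 2)) (by
      rw [abs_neg, abs_of_nonneg (sq_nonneg l)]; exact hl2)
    have e : Complex.exp (-((l ^ 2 : ℝ) : ℂ)) - (1 - ((l ^ 2 : ℝ) : ℂ))
        = ((Real.exp (-(l ^ 2)) - 1 - -(l ^ 2) : ℝ) : ℂ) := by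
      push_cast
      ring
    rw [e, Complex.norm_real, Real.norm_eq_abs]
    refine this.trans ?_
    have : (-(l ^ 2)) ^ 2 = |l| ^ 4 := by
      rw [neg_sq, ← pow_mul, ← (show Even (2 * 2) by decide).pow_abs]
    rw [this]
    exact pow_le_pow_of_le_one (abs_nonneg _) hl (by norm_num)
  have h4 := norm_sub_le_norm_sub_add_norm_sub
    (∫ x : ℝ, Complex.exp (Complex.I * (l * (x ^ 2 - 1) : ℝ)) ∂γ) (1 - ((l ^ 2 : ℝ) : ℂ))
    (Complex.exp (-((l ^ 2 : ℝ) : ℂ)))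
  rw [norm_sub_rev (1 - ((l ^ 2 : ℝ) : ℂ))] at h4
  refine h4.trans ((add_le_add h1 h3).trans (le_of_eq ?_))
  unfold chiSqConst
  ring

variable {ι : Type*} [Fintype ι]

/-- The quadratic form `∑ l k (e k ^ 2 - 1)`. -/
noncomputable def IsGaussianSubspace.diag (hS : IsGaussianSubspace S) (e : ι → S) (l : ι → ℝ) :
    Lp ℝ 2 P := ∑ k, l k • hS.centeredMul (e k) (e k)

theorem IsGaussianSubspace.coeFn_diag (hS : IsGaussianSubspace S) {e : ι → S}
    (he : Orthonormal ℝ e) (l : ι → ℝ) :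
    hS.diag e l =ᵐ[P] fun ω => ∑ k, l k * ((e k : Lp ℝ 2 P) ω ^ 2 - 1) := by
  have h : ∀ᵐ ω ∂P, ∀ k, hS.centeredMul (e k) (e k) ω
      = (e k : Lp ℝ 2 P) ω * (e k : Lp ℝ 2 P) ω - inner ℝ (e k) (e k) :=
    ae_all_iff.2 fun k => hS.coeFn_centeredMul (e k) (e k)
  filter_upwards [h, coeFn_sum_smul Finset.univ l (fun k => hS.centeredMul (e k) (e k))]
    with ω h1 h2
  rw [IsGaussianSubspace.diag, h2]
  refine Finset.sum_congr rfl fun k _ => ?_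
  rw [h1, real_inner_self_eq_norm_sq, he.1 k]
  ring

theorem IsGaussianSubspace.norm_diag_sq (hS : IsGaussianSubspace S) {e : ι → S}
    (he : Orthonormal ℝ e) (l : ι → ℝ) : ‖hS.diag e l‖ ^ 2 = 2 * ∑ k, l k ^ 2 := by
  classical
  rw [← real_inner_self_eq_norm_sq, IsGaussianSubspace.diag, sum_inner, Finset.mul_sum]
  refine Finset.sum_congr rfl fun k _ => ?_
  rw [inner_sum, Finset.sum_eq_single k]
  · rw [real_inner_smul_left, real_inner_smul_right, hS.inner_centeredMul,
      real_inner_self_eq_norm_sq, he.1 k]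
    ring
  · intro j _ hj
    rw [real_inner_smul_left, real_inner_smul_right, hS.inner_centeredMul,
      show inner ℝ (e k) (e j) = 0 from he.2 hj.symm]
    ring
  · simp

theorem IsGaussianSubspace.integral_prod_comp (hS : IsGaussianSubspace S) {e : ι → S}
    (he : Orthonormal ℝ e) {𝕜 : Type*} [RCLike 𝕜] (F : ι → ℝ → 𝕜) (hF : ∀ k, Continuous (F k)) :
    ∫ ω, ∏ k, F k ((e k : Lp ℝ 2 P) ω) ∂P = ∏ k, ∫ x, F k x ∂(gaussianReal 0 1) := by
  have hind := hS.iIndepFun (ξ := fun k => (e k : Lp ℝ 2 P)) (fun k => (e k).2)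
    (he.comp_linearIsometry S.subtypeₗᵢ)
  have hm : ∀ k, AEMeasurable (fun ω => (e k : Lp ℝ 2 P) ω) P := fun k =>
    (Lp.aestronglyMeasurable _).aemeasurable
  have h := hind.integral_fun_prod_comp hm (f := F)
    (fun k => (hF k).aestronglyMeasurable)
  rw [h]
  refine Finset.prod_congr rfl fun k _ => ?_
  rw [← hS.map_eq_std (he.1 k), integral_map (hm k) (hF k).aestronglyMeasurable]

/-- By independence both terms are products over k. The k-th factors differ by at most a constant
times |l_k|³ ≤ ρ l_k², and Σ l_k² is half of the squared norm. Smallness of the largest coefficient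
is thus enough, however many terms there are. -/
theorem IsGaussianSubspace.norm_charInt_diag_sub_le (hS : IsGaussianSubspace S) {e : ι → S}
    (he : Orthonormal ℝ e) {l : ι → ℝ} {ρ : ℝ} (hl : ∀ k, |l k| ≤ ρ) (hρ : ρ ≤ 1) :
    ‖charInt P (hS.diag e l) - Complex.exp (-((‖hS.diag e l‖ ^ 2 / 2 : ℝ) : ℂ))‖
      ≤ chiSqConst * ρ * ‖hS.diag e l‖ ^ 2 := by
  have h1 : charInt P (hS.diag e l)
      = ∏ k, ∫ x : ℝ, Complex.exp (Complex.I * (l k * (x ^ 2 - 1) : ℝ)) ∂(gaussianReal 0 1) := by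
    rw [charInt_congr (hS.coeFn_diag he l), ← hS.integral_prod_comp he
      (fun k x => Complex.exp (Complex.I * (l k * (x ^ 2 - 1) : ℝ))) (fun k => by fun_prop)]
    unfold charInt
    congr 1
    ext ω
    rw [← Complex.exp_sum]
    congr 1
    push_cast
    rw [Finset.mul_sum]
  have h2 : Complex.exp (-((‖hS.diag e l‖ ^ 2 / 2 : ℝ) : ℂ))
      = ∏ k, Complex.exp (-((l k ^ 2 : ℝ) : ℂ)) := by
    rw [hS.norm_diag_sq he, ← Complex.exp_sum]
    congr 1
    push_cast
    rw [Finset.sum_neg_distrib]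
    ring
  rw [h1, h2]
  refine (norm_prod_sub_prod_le _ _ _ (fun k => ?_) (fun k => ?_)).trans ?_
  · refine (norm_integral_le_of_norm_le_const (C := 1) (Eventually.of_forall fun x => ?_)).trans ?_
    · rw [mul_comm, Complex.norm_exp_ofReal_mul_I]
    · simp
  · rw [← Complex.ofReal_neg, Complex.norm_exp_ofReal]
    exact Real.exp_le_one_iff.2 (by simpa using sq_nonneg (l k))
  · have h3 : ∀ k ∈ Finset.univ, ‖∫ x : ℝ, Complex.exp (Complex.I * (l k * (x ^ 2 - 1) : ℝ))
          ∂(gaussianReal 0 1) - Complex.exp (-((l k ^ 2 : ℝ) : ℂ))‖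
        ≤ chiSqConst * ρ * (l k ^ 2) := by
      intro k _
      refine (hS.norm_charFun_chiSq_le (he.1 k) ((hl k).trans hρ)).trans ?_
      rw [mul_assoc]
      refine mul_le_mul_of_nonneg_left ?_ chiSqConst_nonneg
      have : |l k| ^ 3 = |l k| * l k ^ 2 := by rw [← sq_abs]; ring
      rw [this]
      exact mul_le_mul_of_nonneg_right (hl k) (sq_nonneg _)
    refine (Finset.sum_le_sum h3).trans ?_
    rw [← Finset.mul_sum, hS.norm_diag_sq he]
    -- With no index ρ may be negative, but then the form is 0.
    rcases isEmpty_or_nonempty ι with hι | ⟨⟨k⟩⟩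
    · simp
    have hρ0 : 0 ≤ ρ := (abs_nonneg (l k)).trans (hl k)
    have hsum : 0 ≤ ∑ k, l k ^ 2 := Finset.sum_nonneg fun k _ => sq_nonneg _
    have := mul_nonneg (mul_nonneg chiSqConst_nonneg hρ0) hsum
    linarith

/-- Since the squared norm is 2 Σ l_k², the bound 1/8 forces |l_k| ≤ 1/4, the range of
`integrable_exp_chiSq`; the exponents 4 l_k² sum to twice the squared norm. The lower integral is
used because the bound is passed to limits by Fatou's lemma. -/
theorem IsGaussianSubspace.integral_exp_diag_le (hS : IsGaussianSubspace S) {e : ι → S}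
    (he : Orthonormal ℝ e) {l : ι → ℝ} (hl : ‖hS.diag e l‖ ^ 2 ≤ 1 / 8) :
    ∫⁻ ω, ENNReal.ofReal (Real.exp (hS.diag e l ω)) ∂P
      ≤ ENNReal.ofReal (Real.exp (2 * ‖hS.diag e l‖ ^ 2)) := by
  have hl' : ∀ k, |l k| ≤ 1 / 4 := by
    intro k
    rw [hS.norm_diag_sq he] at hl
    have h1 : l k ^ 2 ≤ ∑ j, l j ^ 2 :=
      Finset.single_le_sum (f := fun j => l j ^ 2) (fun j _ => sq_nonneg _) (Finset.mem_univ k)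
    refine abs_le_of_sq_le_sq ?_ (by norm_num)
    linarith
  have hint : Integrable (fun ω => ∏ k, Real.exp (l k * ((e k : Lp ℝ 2 P) ω ^ 2 - 1))) P := by
    have hind := hS.iIndepFun (ξ := fun k => (e k : Lp ℝ 2 P)) (fun k => (e k).2)
      (he.comp_linearIsometry S.subtypeₗᵢ)
    have hm : ∀ k, AEMeasurable (fun ω => (e k : Lp ℝ 2 P) ω) P := fun k =>
      (Lp.aestronglyMeasurable _).aemeasurable
    have hmap := hind.map_fun_eq_pi_map hm
    have hpi : Integrable (fun x : ι → ℝ => ∏ k, Real.exp (l k * (x k ^ 2 - 1)))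
        (Measure.pi fun _ : ι => gaussianReal 0 1) :=
      Integrable.fintype_prod (f := fun k x => Real.exp (l k * (x ^ 2 - 1)))
        (fun k => (integrable_exp_chiSq (hl' k)).1)
    have e2 : (fun k => P.map (fun ω => (e k : Lp ℝ 2 P) ω)) = fun _ => gaussianReal 0 1 := by
      ext1 k
      exact hS.map_eq_std (he.1 k)
    rw [e2] at hmap
    rw [← hmap] at hpi
    exact hpi.comp_aemeasurable (aemeasurable_pi_lambda _ hm)
  have h0 : ∫⁻ ω, ENNReal.ofReal (Real.exp (hS.diag e l ω)) ∂P
      = ∫⁻ ω, ENNReal.ofReal (∏ k, Real.exp (l k * ((e k : Lp ℝ 2 P) ω ^ 2 - 1))) ∂P := by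
    refine lintegral_congr_ae ?_
    filter_upwards [hS.coeFn_diag he l] with ω h1
    rw [h1, Real.exp_sum]
  rw [h0, ← ofReal_integral_eq_lintegral_ofReal hint
    (Eventually.of_forall fun ω => Finset.prod_nonneg fun k _ => (Real.exp_pos _).le)]
  refine ENNReal.ofReal_le_ofReal ?_
  rw [hS.integral_prod_comp he (fun k x => Real.exp (l k * (x ^ 2 - 1))) (fun k => by fun_prop)]
  refine (Finset.prod_le_prod (fun k _ => integral_nonneg fun x => (Real.exp_pos _).le)
    (fun k _ => (integrable_exp_chiSq (hl' k)).2)).trans ?_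
  rw [← Real.exp_sum, hS.norm_diag_sq he, ← Finset.mul_sum]
  exact Real.exp_le_exp.2 (by linarith)

end Diagonal

/-! ### Integrals of centered products as limits of diagonal forms -/

section QuadraticForm

/-- Diagonalisation of the symmetrised integral of `y t ⊗ x t`. -/
theorem exists_orthonormalBasis_diagonal {W : Type*} [NormedAddCommGroup W]
    [InnerProductSpace ℝ W] [FiniteDimensional ℝ W] {y x : ℝ → W} (hy : Continuous y)
    (hx : Continuous x) (T : ℝ) :
    ∃ b : OrthonormalBasis (Fin (Module.finrank ℝ W)) ℝ W, ∃ l : Fin (Module.finrank ℝ W) → ℝ,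
      ∀ j k, (∫ t in (0:ℝ)..T, inner ℝ (b j) (y t) * inner ℝ (b k) (x t))
        + (∫ t in (0:ℝ)..T, inner ℝ (b k) (y t) * inner ℝ (b j) (x t))
        = if j = k then 2 * l j else 0 := by
  -- The self-adjoint operator of the symmetrised form; its eigenvectors supply the basis.
  let A : W →L[ℝ] W := ∫ t in (0:ℝ)..T,
    ((innerSL ℝ (y t)).smulRight (x t) + (innerSL ℝ (x t)).smulRight (y t))
  have hAint : IntervalIntegrable (fun t =>
      ((innerSL ℝ (y t)).smulRight (x t) + (innerSL ℝ (x t)).smulRight (y t))) volume 0 T := by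
    refine Continuous.intervalIntegrable ?_ _ _
    have hy' : Continuous fun t => innerSL ℝ (y t) := (innerSL ℝ).continuous.comp hy
    have hx' : Continuous fun t => innerSL ℝ (x t) := (innerSL ℝ).continuous.comp hx
    have h : ∀ {u : ℝ → W →L[ℝ] ℝ} {v : ℝ → W}, Continuous u → Continuous v →
        Continuous fun t => (u t).smulRight (v t) := by
      intro u v hu hv
      exact ((ContinuousLinearMap.smulRightL ℝ W W).continuous.comp hu).clm_apply hv
    exact (h hy' hx).add (h hx' hy)
  have hA : ∀ φ ψ, inner ℝ (A φ) ψ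
      = (∫ t in (0:ℝ)..T, inner ℝ φ (y t) * inner ℝ ψ (x t))
        + (∫ t in (0:ℝ)..T, inner ℝ ψ (y t) * inner ℝ φ (x t)) := by
    intro φ ψ
    rw [ContinuousLinearMap.intervalIntegral_apply hAint]
    have h1 : IntervalIntegrable (fun t => ((innerSL ℝ (y t)).smulRight (x t)
        + (innerSL ℝ (x t)).smulRight (y t)) φ) volume 0 T := by
      refine Continuous.intervalIntegrable ?_ _ _
      simp only [add_apply, ContinuousLinearMap.smulRight_apply,
        innerSL_apply_apply]
      fun_prop
    have h2 := ((innerSL ℝ ψ).intervalIntegral_comp_comm h1)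
    rw [real_inner_comm, ← innerSL_apply_apply ℝ, ← h2, ← intervalIntegral.integral_add]
    · congr 1
      ext t
      simp [inner_add_right, inner_smul_right, real_inner_comm]
      ring
    · exact Continuous.intervalIntegrable (by fun_prop) _ _
    · exact Continuous.intervalIntegrable (by fun_prop) _ _
  have hsymm : (A : W →ₗ[ℝ] W).IsSymmetric := by
    intro φ ψ
    rw [real_inner_comm (_ : W) φ]
    exact (hA φ ψ).trans ((add_comm _ _).trans (hA ψ φ).symm)
  -- Half of the eigenvalues, because A contains both orders of the pair (y, x).
  refine ⟨hsymm.eigenvectorBasis rfl, fun j => hsymm.eigenvalues rfl j / 2, fun j k => ?_⟩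
  rw [← hA]
  have := hsymm.apply_eigenvectorBasis rfl j
  rw [show A (hsymm.eigenvectorBasis rfl j) = hsymm.eigenvalues rfl j • hsymm.eigenvectorBasis rfl j
    from this, real_inner_smul_left, OrthonormalBasis.inner_eq_ite]
  split_ifs <;> ring

variable {Ω : Type*} [MeasurableSpace Ω] {P : Measure Ω} [IsProbabilityMeasure P]
  {S : Submodule ℝ (Lp ℝ 2 P)}

theorem IsGaussianSubspace.continuous_centeredMul (hS : IsGaussianSubspace S) {y x : ℝ → S}
    (hy : Continuous y) (hx : Continuous x) :
    Continuous fun t => hS.centeredMul (y t) (x t) := by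
  have : Continuous fun t => hS.centeredMulCLM (y t) (x t) :=
    (hS.centeredMulCLM.continuous.comp hy).clm_apply hx
  exact this

/-- The integral of a product of two curves in a finite dimensional subspace is a diagonal
quadratic form. -/
theorem IsGaussianSubspace.exists_integral_eq_diag (hS : IsGaussianSubspace S)
    {W : Submodule ℝ (Lp ℝ 2 P)} (hW : W ≤ S) [FiniteDimensional ℝ W] {y x : ℝ → W}
    (hy : Continuous y) (hx : Continuous x) (T : ℝ) :
    ∃ (e : Fin (Module.finrank ℝ W) → S) (l : Fin (Module.finrank ℝ W) → ℝ),
      (∀ k, (e k : Lp ℝ 2 P) ∈ W) ∧ Orthonormal ℝ e ∧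
      (∀ k, l k = ∫ t in (0:ℝ)..T,
        inner ℝ (y t : Lp ℝ 2 P) (e k) * inner ℝ (x t : Lp ℝ 2 P) (e k)) ∧
      ∫ t in (0:ℝ)..T, hS.centeredMul (Submodule.inclusion hW (y t)) (Submodule.inclusion hW (x t))
        = hS.diag e l := by
  obtain ⟨b, l, hbl⟩ := exists_orthonormalBasis_diagonal (W := W) hy hx T
  set i := Submodule.inclusion hW with hi
  refine ⟨fun k => i (b k), l, fun k => (b k).2, ?_, fun k => ?_, ?_⟩
  · refine ⟨fun k => b.orthonormal.1 k, fun j k hjk => ?_⟩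
    exact b.orthonormal.2 hjk
  · have := hbl k k
    simp only [if_true] at this
    have h2 : l k = ∫ t in (0:ℝ)..T, inner ℝ (b k) (y t) * inner ℝ (b k) (x t) := by linarith
    rw [h2]
    congr 1
    ext t
    rw [real_inner_comm, real_inner_comm (x t)]
    rfl
  · set c : Fin (Module.finrank ℝ W) → Fin (Module.finrank ℝ W) → Lp ℝ 2 P :=
      fun j k => hS.centeredMul (i (b j)) (i (b k)) with hc
    set m : Fin (Module.finrank ℝ W) → Fin (Module.finrank ℝ W) → ℝ :=
      fun j k => ∫ t in (0:ℝ)..T, inner ℝ (b j) (y t) * inner ℝ (b k) (x t) with hm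
    have h1 : ∀ t, hS.centeredMul (i (y t)) (i (x t))
        = ∑ j, ∑ k, (inner ℝ (b j) (y t) * inner ℝ (b k) (x t)) • c j k := by
      intro t
      have ey : i (y t) = ∑ j, inner ℝ (b j) (y t) • i (b j) := by
        conv_lhs => rw [← b.sum_repr' (y t)]
        rw [map_sum]
        exact Finset.sum_congr rfl fun j _ => map_smul i _ _
      have ex : i (x t) = ∑ k, inner ℝ (b k) (x t) • i (b k) := by
        conv_lhs => rw [← b.sum_repr' (x t)]
        rw [map_sum]
        exact Finset.sum_congr rfl fun j _ => map_smul i _ _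
      rw [← hS.centeredMulCLM_apply]
      conv_lhs => rw [ey, ex]
      rw [map_sum, Finset.sum_comm]
      refine Finset.sum_congr rfl fun k _ => ?_
      rw [map_sum, sum_apply]
      refine Finset.sum_congr rfl fun j _ => ?_
      rw [map_smul, map_smul, smul_apply, smul_smul, mul_comm]
      rfl
    have h2 : ∫ t in (0:ℝ)..T, hS.centeredMul (i (y t)) (i (x t)) = ∑ j, ∑ k, m j k • c j k := by
      simp_rw [h1]
      rw [intervalIntegral.integral_finsetSum]
      · refine Finset.sum_congr rfl fun j _ => ?_
        rw [intervalIntegral.integral_finsetSum]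
        · refine Finset.sum_congr rfl fun k _ => ?_
          rw [intervalIntegral.integral_smul_const]
        · intro k _
          exact Continuous.intervalIntegrable (by fun_prop) _ _
      · intro j _
        exact Continuous.intervalIntegrable (by fun_prop) _ _
    -- The centered product is symmetric, so only the symmetrised coefficient matrix matters, and
    -- this one is diagonal in the basis b.
    have hsym : ∀ j k, c j k = c k j := fun j k => hS.centeredMul_comm _ _
    have h3 : (2 : ℝ) • ∑ j, ∑ k, m j k • c j k = ∑ j, ∑ k, (m j k + m k j) • c j k := by
      rw [two_smul]
      conv_lhs =>
        rhs
        rw [Finset.sum_comm]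
      rw [← Finset.sum_add_distrib]
      refine Finset.sum_congr rfl fun j _ => ?_
      rw [← Finset.sum_add_distrib]
      refine Finset.sum_congr rfl fun k _ => ?_
      rw [add_smul, hsym k j]
    have h4 : (2 : ℝ) • ∑ j, ∑ k, m j k • c j k = (2 : ℝ) • hS.diag (fun k => i (b k)) l := by
      rw [h3, IsGaussianSubspace.diag, Finset.smul_sum]
      refine Finset.sum_congr rfl fun j _ => ?_
      rw [Finset.sum_eq_single j]
      · have := hbl j j
        simp only [if_true] at this
        rw [show m j j + m j j = 2 * l j from this, mul_smul]
      · intro k _ hk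
        have := hbl j k
        rw [if_neg hk.symm] at this
        rw [show m j k + m k j = 0 from this, zero_smul]
      · simp
    rw [h2]
    exact smul_right_injective _ (two_ne_zero (α := ℝ)) h4

/-- Finite dimensional approximation of a quadratic form. -/
theorem IsGaussianSubspace.exists_diag_approx (hS : IsGaussianSubspace S) {y x : ℝ → S}
    (hy : Continuous y) (hx : Continuous x) {T : ℝ} (hT : 0 ≤ T) {ρ : ℝ}
    (hρ : ∀ φ : S, |∫ t in (0:ℝ)..T, inner ℝ (y t) φ * inner ℝ (x t) φ| ≤ ρ * ‖φ‖ ^ 2)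
    {δ : ℝ} (hδ : 0 < δ) :
    ∃ (n : ℕ) (e : Fin n → S) (l : Fin n → ℝ), Orthonormal ℝ e ∧ (∀ k, |l k| ≤ ρ) ∧
      ‖(∫ t in (0:ℝ)..T, hS.centeredMul (y t) (x t)) - hS.diag e l‖ ≤ δ := by
  obtain ⟨My, hMy⟩ := isCompact_Icc.exists_bound_of_continuousOn (hy.continuousOn (s := Set.Icc 0 T))
  obtain ⟨Mx, hMx⟩ := isCompact_Icc.exists_bound_of_continuousOn (hx.continuousOn (s := Set.Icc 0 T))
  have h0 : (0:ℝ) ∈ Set.Icc 0 T := ⟨le_rfl, hT⟩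
  have hMy0 : 0 ≤ My := (norm_nonneg _).trans (hMy 0 h0)
  have hMx0 : 0 ≤ Mx := (norm_nonneg _).trans (hMx 0 h0)
  -- Chosen so that the final error 2ε(Mx + My)T is at most δ; the summands 1 keep the denominator
  -- positive.
  set ε : ℝ := δ / (2 * (Mx + My + 1) * (T + 1)) with hε
  have hεpos : 0 < ε := by positivity
  have hy' : Continuous fun t => (y t : Lp ℝ 2 P) := continuous_subtype_val.comp hy
  have hx' : Continuous fun t => (x t : Lp ℝ 2 P) := continuous_subtype_val.comp hx
  set K : Set (Lp ℝ 2 P) := (fun t => (y t : Lp ℝ 2 P)) '' Set.Icc 0 T ∪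
    (fun t => (x t : Lp ℝ 2 P)) '' Set.Icc 0 T with hKdef
  have hK : IsCompact K := (isCompact_Icc.image hy').union (isCompact_Icc.image hx')
  obtain ⟨s, hsK, hsfin, hs⟩ := hK.finite_cover_balls hεpos
  -- The span of a finite ε-net of the compact set traced by both curves on [0,T]. Projection onto W
  -- then moves no point of the curves by more than ε.
  set W : Submodule ℝ (Lp ℝ 2 P) := Submodule.span ℝ s with hWdef
  have hW : W ≤ S := by
    refine Submodule.span_le.2 fun v hv => ?_
    rcases hsK hv with ⟨t, -, rfl⟩ | ⟨t, -, rfl⟩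
    · exact (y t).2
    · exact (x t).2
  have : FiniteDimensional ℝ W := FiniteDimensional.span_of_finite ℝ hsfin
  have happrox : ∀ v ∈ K, ‖v - W.starProjection v‖ ≤ ε := by
    intro v hv
    obtain ⟨w, hw, hvw⟩ := Set.mem_iUnion₂.1 (hs hv)
    rw [Metric.mem_ball, dist_eq_norm] at hvw
    rw [Submodule.starProjection_minimal]
    refine (ciInf_le ⟨0, ?_⟩ (⟨w, Submodule.subset_span hw⟩ : W)).trans hvw.le
    rintro _ ⟨z, rfl⟩
    exact norm_nonneg _
  set p : S → S := fun v => Submodule.inclusion hW (W.orthogonalProjectionOnto (v : Lp ℝ 2 P)) with hp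
  have hpc : Continuous p := by
    refine Continuous.subtype_mk ?_ _
    exact continuous_subtype_val.comp
      (W.orthogonalProjectionOnto.continuous.comp continuous_subtype_val)
  obtain ⟨e, l, heW, heo, hl, hint⟩ := hS.exists_integral_eq_diag hW
    (y := fun t => W.orthogonalProjectionOnto (y t : Lp ℝ 2 P))
    (x := fun t => W.orthogonalProjectionOnto (x t : Lp ℝ 2 P))
    (W.orthogonalProjectionOnto.continuous.comp hy')
    (W.orthogonalProjectionOnto.continuous.comp hx') T
  -- Since the projection is self-adjoint and e k lies in W, the coefficients of the projected form
  -- are values of the original form at the unit vectors e k. This is why the bound ρ survives the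
  -- projection.
  have hproj : ∀ (v : S) k, inner ℝ (W.orthogonalProjectionOnto (v : Lp ℝ 2 P) : Lp ℝ 2 P) (e k)
      = inner ℝ v (e k) := by
    intro v k
    rw [← Submodule.starProjection_apply, Submodule.inner_starProjection_left_eq_right,
      Submodule.starProjection_eq_self_iff.2 (heW k)]
    rfl
  refine ⟨_, e, l, heo, fun k => ?_, ?_⟩
  · have := hρ (e k)
    rw [heo.1 k, one_pow, mul_one] at this
    rw [hl k]
    simp_rw [hproj]
    exact this
  · rw [← hint]
    have c1 := hS.continuous_centeredMul hy hx
    have c2 : Continuous fun t => hS.centeredMul (p (y t)) (p (x t)) :=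
      hS.continuous_centeredMul (hpc.comp hy) (hpc.comp hx)
    change ‖(∫ t in (0:ℝ)..T, hS.centeredMul (y t) (x t))
      - ∫ t in (0:ℝ)..T, hS.centeredMul (p (y t)) (p (x t))‖ ≤ δ
    rw [← intervalIntegral.integral_sub (c1.intervalIntegrable _ _) (c2.intervalIntegrable _ _)]
    have hb : ∀ t ∈ Set.uIoc 0 T, ‖hS.centeredMul (y t) (x t)
        - hS.centeredMul (p (y t)) (p (x t))‖ ≤ 2 * ε * (Mx + My) := by
      intro t ht
      rw [Set.uIoc_of_le hT] at ht
      have ht' : t ∈ Set.Icc 0 T := ⟨ht.1.le, ht.2⟩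
      have e1 : hS.centeredMul (y t) (x t) - hS.centeredMul (p (y t)) (p (x t))
          = hS.centeredMul (y t - p (y t)) (x t) + hS.centeredMul (p (y t)) (x t - p (x t)) := by
        simp only [← hS.centeredMulCLM_apply, map_sub, sub_apply]
        abel
      rw [e1]
      have n1 := hS.norm_centeredMul_le (y t - p (y t)) (x t)
      have n2 := hS.norm_centeredMul_le (p (y t)) (x t - p (x t))
      have n3 : ‖y t - p (y t)‖ ≤ ε := happrox (y t) (Or.inl ⟨t, ht', rfl⟩)
      have n4 : ‖x t - p (x t)‖ ≤ ε := happrox (x t) (Or.inr ⟨t, ht', rfl⟩)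
      have n5 : ‖p (y t)‖ ≤ My := by
        refine le_trans ?_ (hMy t ht')
        have h5 : ‖W.starProjection (y t : Lp ℝ 2 P)‖ ≤ ‖(y t : Lp ℝ 2 P)‖ :=
          (W.starProjection.le_opNorm _).trans
            (mul_le_of_le_one_left (norm_nonneg _) W.starProjection_norm_le)
        exact h5
      have n6 := hMx t ht'
      refine (norm_add_le _ _).trans ((add_le_add n1 n2).trans ?_)
      have := mul_le_mul n3 n6 (norm_nonneg _) hεpos.le
      have := mul_le_mul n5 n4 (norm_nonneg _) hMy0
      nlinarith
    refine (intervalIntegral.norm_integral_le_of_norm_le_const hb).trans ?_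
    rw [sub_zero, abs_of_nonneg hT, hε]
    have hpos : 0 < 2 * (Mx + My + 1) * (T + 1) := by positivity
    rw [mul_div_assoc', div_mul_eq_mul_div, div_mul_eq_mul_div, div_le_iff₀ hpos]
    have h7 : (Mx + My) * T ≤ (Mx + My + 1) * (T + 1) := by nlinarith
    nlinarith

/-- The estimate for diagonal forms does not depend on the dimension, and both of its sides are
continuous on L², so it passes to the limit of the approximations. -/
theorem IsGaussianSubspace.norm_charInt_integral_sub_le (hS : IsGaussianSubspace S) {y x : ℝ → S}
    (hy : Continuous y) (hx : Continuous x) {T : ℝ} (hT : 0 ≤ T) {ρ : ℝ} (hρ1 : ρ ≤ 1)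
    (hρ : ∀ φ : S, |∫ t in (0:ℝ)..T, inner ℝ (y t) φ * inner ℝ (x t) φ| ≤ ρ * ‖φ‖ ^ 2)
    {Q : Lp ℝ 2 P} (hQ : Q = ∫ t in (0:ℝ)..T, hS.centeredMul (y t) (x t)) :
    ‖charInt P Q - Complex.exp (-((‖Q‖ ^ 2 / 2 : ℝ) : ℂ))‖ ≤ chiSqConst * ρ * ‖Q‖ ^ 2 := by
  have h := fun k : ℕ => hS.exists_diag_approx hy hx hT hρ (δ := 1 / ((k : ℝ) + 1)) (by positivity)
  choose n e l heo hl happ using h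
  have hlim : Tendsto (fun k => hS.diag (e k) (l k)) atTop (𝓝 Q) := by
    rw [tendsto_iff_norm_sub_tendsto_zero]
    refine squeeze_zero (fun _ => norm_nonneg _) (fun k => ?_) tendsto_one_div_add_atTop_nhds_zero_nat
    rw [norm_sub_rev, hQ]
    exact happ k
  have h1 : Tendsto (fun k => ‖charInt P (hS.diag (e k) (l k))
      - Complex.exp (-((‖hS.diag (e k) (l k)‖ ^ 2 / 2 : ℝ) : ℂ))‖) atTop
      (𝓝 ‖charInt P Q - Complex.exp (-((‖Q‖ ^ 2 / 2 : ℝ) : ℂ))‖) := by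
    have hc : Continuous fun Q : Lp ℝ 2 P =>
        ‖charInt P Q - Complex.exp (-((‖Q‖ ^ 2 / 2 : ℝ) : ℂ))‖ :=
      (continuous_charInt.sub (by fun_prop)).norm
    exact (hc.tendsto Q).comp hlim
  have h2 : Tendsto (fun k => chiSqConst * ρ * ‖hS.diag (e k) (l k)‖ ^ 2) atTop
      (𝓝 (chiSqConst * ρ * ‖Q‖ ^ 2)) := (hlim.norm.pow 2).const_mul _
  exact le_of_tendsto_of_tendsto' h1 h2 fun k => hS.norm_charInt_diag_sub_le (heo k) (hl k) hρ1

/-- The exponential is not continuous on L²; an almost surely convergent subsequence of diagonal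
approximations and Fatou's lemma replace continuity. The strict inequality makes the approximations
satisfy the bound 1/8 eventually. -/
theorem IsGaussianSubspace.lintegral_exp_integral_le (hS : IsGaussianSubspace S) {y x : ℝ → S}
    (hy : Continuous y) (hx : Continuous x) {T : ℝ} (hT : 0 ≤ T)
    {Q : Lp ℝ 2 P} (hQ : Q = ∫ t in (0:ℝ)..T, hS.centeredMul (y t) (x t))
    (hQ2 : ‖Q‖ ^ 2 < 1 / 8) :
    ∫⁻ ω, ENNReal.ofReal (Real.exp (Q ω)) ∂P ≤ ENNReal.ofReal (Real.exp (2 * ‖Q‖ ^ 2)) := by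
  -- Any finite ρ will do, as it does not enter the conclusion; the curves are bounded on the
  -- compact interval.
  obtain ⟨ρ, hρ⟩ : ∃ ρ : ℝ, ∀ φ : S,
      |∫ t in (0:ℝ)..T, inner ℝ (y t) φ * inner ℝ (x t) φ| ≤ ρ * ‖φ‖ ^ 2 := by
    obtain ⟨My, hMy⟩ := isCompact_Icc.exists_bound_of_continuousOn
      (hy.continuousOn (s := Set.Icc 0 T))
    obtain ⟨Mx, hMx⟩ := isCompact_Icc.exists_bound_of_continuousOn
      (hx.continuousOn (s := Set.Icc 0 T))
    refine ⟨My * Mx * T, fun φ => ?_⟩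
    have h := intervalIntegral.norm_integral_le_of_norm_le_const (a := 0) (b := T)
      (C := My * Mx * ‖φ‖ ^ 2) (f := fun t => inner ℝ (y t) φ * inner ℝ (x t) φ) (by
      intro t ht
      rw [Set.uIoc_of_le hT] at ht
      have ht' : t ∈ Set.Icc 0 T := ⟨ht.1.le, ht.2⟩
      rw [norm_mul]
      have a1 := (norm_inner_le_norm (𝕜 := ℝ) (y t) φ).trans
        (mul_le_mul_of_nonneg_right (hMy t ht') (norm_nonneg φ))
      have a2 := (norm_inner_le_norm (𝕜 := ℝ) (x t) φ).trans
        (mul_le_mul_of_nonneg_right (hMx t ht') (norm_nonneg φ))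
      refine (mul_le_mul a1 a2 (norm_nonneg _) ((norm_nonneg _).trans a1)).trans (le_of_eq ?_)
      ring)
    rw [sub_zero, abs_of_nonneg hT, Real.norm_eq_abs] at h
    linarith
  have h := fun k : ℕ => hS.exists_diag_approx hy hx hT hρ (δ := 1 / ((k : ℝ) + 1)) (by positivity)
  choose n e l heo hl happ using h
  have hlim : Tendsto (fun k => hS.diag (e k) (l k)) atTop (𝓝 Q) := by
    rw [tendsto_iff_norm_sub_tendsto_zero]
    refine squeeze_zero (fun _ => norm_nonneg _) (fun k => ?_) tendsto_one_div_add_atTop_nhds_zero_nat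
    rw [norm_sub_rev, hQ]
    exact happ k
  have hmeas : TendstoInMeasure P (fun k => ⇑(hS.diag (e k) (l k))) atTop Q := by
    refine tendstoInMeasure_of_tendsto_eLpNorm (p := 2) (by norm_num)
      (fun k => Lp.aestronglyMeasurable _) (Lp.aestronglyMeasurable _) ?_
    exact (Lp.tendsto_Lp_iff_tendsto_eLpNorm' _ _).1 hlim
  obtain ⟨ns, hns, hae⟩ := hmeas.exists_seq_tendsto_ae
  have hlim2 := hlim.comp hns.tendsto_atTop
  have hnorm : Tendsto (fun k => ‖hS.diag (e (ns k)) (l (ns k))‖ ^ 2) atTop (𝓝 (‖Q‖ ^ 2)) :=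
    hlim2.norm.pow 2
  calc ∫⁻ ω, ENNReal.ofReal (Real.exp (Q ω)) ∂P
      = ∫⁻ ω, liminf (fun k => ENNReal.ofReal (Real.exp (hS.diag (e (ns k)) (l (ns k)) ω)))
          atTop ∂P := by
        refine lintegral_congr_ae ?_
        filter_upwards [hae] with ω hω
        refine (Tendsto.liminf_eq ?_).symm
        exact (ENNReal.continuous_ofReal.tendsto _).comp ((Real.continuous_exp.tendsto _).comp hω)
    _ ≤ liminf (fun k => ∫⁻ ω, ENNReal.ofReal (Real.exp (hS.diag (e (ns k)) (l (ns k)) ω)) ∂P)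
          atTop := by
        refine lintegral_liminf_le' fun k => ?_
        exact (Real.measurable_exp.comp_aemeasurable
          (Lp.aestronglyMeasurable _).aemeasurable).ennreal_ofReal
    _ ≤ liminf (fun k => ENNReal.ofReal
          (Real.exp (2 * ‖hS.diag (e (ns k)) (l (ns k))‖ ^ 2))) atTop := by
        refine liminf_le_liminf ?_
        filter_upwards [hnorm.eventually_lt_const hQ2] with k hk
        exact hS.integral_exp_diag_le (heo _) hk.le
    _ = ENNReal.ofReal (Real.exp (2 * ‖Q‖ ^ 2)) := by
        refine Tendsto.liminf_eq ?_
        exact (ENNReal.continuous_ofReal.tendsto _).comp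
          ((Real.continuous_exp.tendsto _).comp (hnorm.const_mul 2))

end QuadraticForm

/-! ### Fourier integrals and Plancherel's theorem on L¹ ∩ L² -/

noncomputable section

/-- The Plancherel transform of an integrable function is its Fourier integral. -/
theorem coeFn_fourier_toLp {h : ℝ → ℂ} (h1 : Integrable h) (h2 : MemLp h 2 volume) :
    ((𝓕 (h2.toLp h) : Lp (α := ℝ) ℂ 2 volume) : ℝ → ℂ) =ᵐ[volume] 𝓕 h := by
  have hcont : Continuous (𝓕 h) :=
    VectorFourier.fourierIntegral_continuous Real.continuous_fourierChar
      continuous_inner h1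
  -- Both functions are tested against compactly supported smooth functions. On either side the
  -- transform can be moved onto the test function, once by the definition for tempered
  -- distributions and once by Fubini.
  refine ae_eq_of_integral_contDiff_smul_eq
    ((Lp.memLp _).locallyIntegrable (by norm_num)) hcont.locallyIntegrable fun g hg hgs => ?_
  have hgs' : HasCompactSupport (fun x => (g x : ℂ)) :=
    hgs.comp_left (g := fun y : ℝ => (y : ℂ)) (by simp)
  have hg' : ContDiff ℝ (⊤ : ℕ∞) (fun x => (g x : ℂ)) :=
    Complex.ofRealCLM.contDiff.comp hg
  set G := hgs'.toSchwartzMap hg' with hG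
  have e1 : (𝓕 (Lp.toTemperedDistribution (h2.toLp h))) G
      = Lp.toTemperedDistribution (𝓕 (h2.toLp h) : Lp (α := ℝ) ℂ 2 volume) G := by
    rw [Lp.fourier_toTemperedDistribution_eq]
  rw [TemperedDistribution.fourier_apply, Lp.toTemperedDistribution_apply,
    Lp.toTemperedDistribution_apply] at e1
  have e2 : ∫ x, (g x) • (𝓕 (h2.toLp h) : Lp (α := ℝ) ℂ 2 volume) x
      = ∫ x, G x • (𝓕 (h2.toLp h) : Lp (α := ℝ) ℂ 2 volume) x := by
    refine integral_congr_ae (ae_of_all _ fun x => ?_)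
    simp [hG]
  have e3 : ∫ x, (g x) • 𝓕 h x = ∫ x, (G x) • 𝓕 h x := by
    refine integral_congr_ae (ae_of_all _ fun x => ?_)
    simp [hG]
  rw [e2, e3, ← e1]
  have e4 := VectorFourier.integral_fourierIntegral_smul_eq_flip (μ := volume) (ν := volume)
    (L := innerₗ ℝ) (f := G) (g := h) Real.continuous_fourierChar
    (by fun_prop) G.integrable h1
  have e5 : ∫ x, (𝓕 G : SchwartzMap ℝ ℂ) x • h x = ∫ x, G x • 𝓕 h x := by
    rw [SchwartzMap.fourier_coe]
    refine e4.trans ?_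
    rw [flip_innerₗ]
    rfl
  rw [← e5]
  refine integral_congr_ae ?_
  filter_upwards [h2.coeFn_toLp] with x hx
  rw [hx]

/-- The Fourier integral `∫ e^{-i lam x} h(x) dx` of a real function. -/
def fourierInt (h : ℝ → ℝ) (lam : ℝ) : ℂ :=
  ∫ x : ℝ, Complex.exp (Complex.I * ((-(lam * x) : ℝ) : ℂ)) * (h x : ℂ)

theorem norm_exp_I_mul (x : ℝ) : ‖Complex.exp (Complex.I * (x : ℂ))‖ = 1 := by
  rw [mul_comm]; exact Complex.norm_exp_ofReal_mul_I x

theorem fourierInt_eq (h : ℝ → ℝ) (lam : ℝ) :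
    fourierInt h lam = 𝓕 (fun x => (h x : ℂ)) (lam / (2 * Real.pi)) := by
  rw [Real.fourier_real_eq_integral_exp_smul, fourierInt]
  refine integral_congr_ae (ae_of_all _ fun x => ?_)
  have : (-2 * Real.pi * x * (lam / (2 * Real.pi))) = -(lam * x) := by
    field_simp
  simp only [smul_eq_mul, this]
  rw [mul_comm Complex.I]

theorem continuous_fourierInt {h : ℝ → ℝ} (h1 : Integrable h) : Continuous (fourierInt h) := by
  unfold fourierInt
  refine continuous_of_dominated (bound := fun x => ‖h x‖) (fun lam => ?_) (fun lam => ?_)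
    h1.norm (ae_of_all _ fun x => by fun_prop)
  · exact (by fun_prop : Continuous fun x : ℝ =>
      Complex.exp (Complex.I * ((-(lam * x) : ℝ) : ℂ))).aestronglyMeasurable.mul
      (Complex.continuous_ofReal.comp_aestronglyMeasurable h1.1)
  · refine ae_of_all _ fun x => ?_
    rw [norm_mul, norm_exp_I_mul, one_mul, Complex.norm_real]

theorem norm_fourierInt_le (h : ℝ → ℝ) (lam : ℝ) : ‖fourierInt h lam‖ ≤ ∫ x, ‖h x‖ := by
  refine (norm_integral_le_integral_norm _).trans (le_of_eq ?_)
  refine integral_congr_ae (ae_of_all _ fun x => ?_)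
  simp only [norm_mul, norm_exp_I_mul, one_mul, Complex.norm_real]

theorem fourierInt_neg (h : ℝ → ℝ) (lam : ℝ) :
    fourierInt h (-lam) = (starRingEnd ℂ) (fourierInt h lam) := by
  rw [fourierInt, fourierInt, ← integral_conj]
  refine integral_congr_ae (ae_of_all _ fun x => ?_)
  simp only [map_mul, Complex.conj_ofReal, ← Complex.exp_conj, Complex.conj_I]
  congr 2
  push_cast
  ring

theorem integral_norm_sq_eq_norm_sq {E : Type*} [NormedAddCommGroup E] [InnerProductSpace ℂ E]
    (g : Lp (α := ℝ) E 2 volume) : ∫ x, ‖g x‖ ^ 2 = ‖g‖ ^ 2 := by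
  have h := L2.inner_def (𝕜 := ℂ) g g
  rw [inner_self_eq_norm_sq_to_K] at h
  have h2 : (∫ x, inner ℂ (g x) (g x)) = ((∫ x, ‖g x‖ ^ 2 : ℝ) : ℂ) := by
    rw [← integral_complex_ofReal]
    refine integral_congr_ae (ae_of_all _ fun x => ?_)
    simp [inner_self_eq_norm_sq_to_K]
  rw [h2] at h
  refine Complex.ofReal_injective (h.symm.trans ?_)
  push_cast
  rfl

/-- Plancherel's theorem on `L¹ ∩ L²`. -/
theorem plancherel {h : ℝ → ℝ} (h1 : Integrable h) (h2 : MemLp h 2 volume) :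
    Integrable (fun lam => ‖fourierInt h lam‖ ^ 2) ∧
      ∫ lam, ‖fourierInt h lam‖ ^ 2 = 2 * Real.pi * ∫ x, h x ^ 2 := by
  have hpi : (0:ℝ) < 2 * Real.pi := by positivity
  have h1' : Integrable (fun x => (h x : ℂ)) := h1.ofReal
  have h2' : MemLp (fun x => (h x : ℂ)) 2 volume := MemLp.ofReal (K := ℂ) h2
  have hae := coeFn_fourier_toLp h1' h2'
  have hint : Integrable (fun ξ => ‖𝓕 (fun x => (h x : ℂ)) ξ‖ ^ 2) := by
    refine ((Lp.memLp (𝓕 (h2'.toLp _) : Lp (α := ℝ) ℂ 2 volume)).integrable_norm_pow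
      (by norm_num)).congr ?_
    filter_upwards [hae] with x hx
    simp [hx]
  have hval : ∫ ξ, ‖𝓕 (fun x => (h x : ℂ)) ξ‖ ^ 2 = ∫ x, h x ^ 2 := by
    calc ∫ ξ, ‖𝓕 (fun x => (h x : ℂ)) ξ‖ ^ 2
        = ∫ ξ, ‖(𝓕 (h2'.toLp _) : Lp (α := ℝ) ℂ 2 volume) ξ‖ ^ 2 := by
          refine integral_congr_ae ?_
          filter_upwards [hae] with x hx
          simp [hx]
      _ = ‖h2'.toLp _‖ ^ 2 := by
          rw [integral_norm_sq_eq_norm_sq, Lp.norm_fourier_eq]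
      _ = ∫ x, h x ^ 2 := by
          rw [← integral_norm_sq_eq_norm_sq]
          refine integral_congr_ae ?_
          filter_upwards [h2'.coeFn_toLp] with x hx
          simp [hx]
  constructor
  · have := hint.comp_div hpi.ne'
    refine this.congr (ae_of_all _ fun lam => ?_)
    simp only [fourierInt_eq]
  · simp only [fourierInt_eq]
    rw [Measure.integral_comp_div (fun ξ => ‖𝓕 (fun x => (h x : ℂ)) ξ‖ ^ 2), hval,
      abs_of_pos hpi, smul_eq_mul]

/-- Integrability of the transform is what the limit of the cross-covariance term requires; Schwartz
functions are therefore the dense class on which the limit variance is computed. -/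
theorem fourierInt_schwartz_integrable (h : SchwartzMap ℝ ℝ) : Integrable (fourierInt h) := by
  have hpi : (0:ℝ) < 2 * Real.pi := by positivity
  set G : SchwartzMap ℝ ℂ := SchwartzMap.postcompCLM (𝕜 := ℝ) Complex.ofRealCLM h with hG
  have := ((𝓕 G : SchwartzMap ℝ ℂ).integrable (μ := volume)).comp_div hpi.ne'
  refine this.congr (ae_of_all _ fun lam => ?_)
  rw [fourierInt_eq, SchwartzMap.fourier_coe]
  rfl

end

/-! ### Averages of covariances over squares and the Fejér kernel -/

noncomputable section

/-- The integral `∫ e^{i lam r} a(lam) dlam`. -/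
def spectralInt (a : ℝ → ℂ) (r : ℝ) : ℂ :=
  ∫ lam : ℝ, Complex.exp (Complex.I * ((lam * r : ℝ) : ℂ)) * a lam

theorem spectralCov_eq_spectralInt (f : ℝ → ℝ) (r : ℝ) :
    spectralCov f r = spectralInt (fun lam => (f lam : ℂ)) r := rfl

theorem integrable_exp_mul {α : Type*} [MeasurableSpace α] {μ : Measure α} {a : α → ℂ}
    (ha : Integrable a μ) {φ : α → ℝ} (hφ : AEMeasurable φ μ) :
    Integrable (fun x => Complex.exp (Complex.I * ((φ x : ℝ) : ℂ)) * a x) μ := by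
  refine ha.bdd_mul (c := 1) ?_ (ae_of_all _ fun x => (norm_exp_I_mul _).le)
  exact (Complex.measurable_exp.comp_aemeasurable
    ((Complex.measurable_ofReal.comp_aemeasurable hφ).const_mul _)).aestronglyMeasurable

theorem continuous_spectralInt {a : ℝ → ℂ} (ha : Integrable a) : Continuous (spectralInt a) := by
  unfold spectralInt
  refine continuous_of_dominated (bound := fun x => ‖a x‖) (fun r => ?_) (fun r => ?_)
    ha.norm (ae_of_all _ fun x => by fun_prop)
  · exact (integrable_exp_mul ha (by fun_prop)).1
  · refine ae_of_all _ fun x => ?_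
    rw [norm_mul, norm_exp_I_mul, one_mul]

/-- The Fejér kernel `|∫_0^1 e^{-ixt} dt|²`. -/
def fejer (x : ℝ) : ℝ := ‖fourierInt ((Set.Ioc (0:ℝ) 1).indicator 1) x‖ ^ 2

theorem integrable_unit : Integrable ((Set.Ioc (0:ℝ) 1).indicator (1 : ℝ → ℝ)) :=
  (integrable_indicator_iff measurableSet_Ioc).2
    (integrableOn_const (by simp) (by simp) : IntegrableOn (fun _ => (1:ℝ)) _ _)

theorem memLp_unit : MemLp ((Set.Ioc (0:ℝ) 1).indicator (1 : ℝ → ℝ)) 2 volume :=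
  memLp_indicator_const 2 measurableSet_Ioc (1:ℝ) (Or.inr (by simp))

theorem fejer_nonneg (x : ℝ) : 0 ≤ fejer x := by unfold fejer; positivity

theorem integrable_fejer : Integrable fejer := (plancherel integrable_unit memLp_unit).1

theorem integral_fejer : ∫ x, fejer x = 2 * Real.pi := by
  refine (plancherel integrable_unit memLp_unit).2.trans ?_
  have : ∀ x, ((Set.Ioc (0:ℝ) 1).indicator (1 : ℝ → ℝ)) x ^ 2
      = (Set.Ioc (0:ℝ) 1).indicator (1 : ℝ → ℝ) x := by
    intro x
    by_cases hx : x ∈ Set.Ioc (0:ℝ) 1 <;> simp [hx]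
  simp_rw [this]
  rw [integral_indicator measurableSet_Ioc]
  simp

/-- The two integrals are complex conjugates, and rescaling [0,T] to the unit interval produces the
factor T². -/
theorem integral_exp_mul_conj (T x : ℝ) (hT : 0 < T) :
    (∫ t in (0:ℝ)..T, Complex.exp (Complex.I * ((x * t : ℝ) : ℂ)))
      * (∫ t in (0:ℝ)..T, Complex.exp (Complex.I * ((-(x * t) : ℝ) : ℂ)))
      = ((T ^ 2 * fejer (T * x) : ℝ) : ℂ) := by
  have h1 : ∫ t in (0:ℝ)..T, Complex.exp (Complex.I * ((-(x * t) : ℝ) : ℂ))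
      = T * fourierInt ((Set.Ioc (0:ℝ) 1).indicator 1) (T * x) := by
    have e : fourierInt ((Set.Ioc (0:ℝ) 1).indicator 1) (T * x)
        = ∫ t in (0:ℝ)..1, Complex.exp (Complex.I * ((-(x * (T * t)) : ℝ) : ℂ)) := by
      rw [intervalIntegral.integral_of_le zero_le_one, ← integral_indicator measurableSet_Ioc,
        fourierInt]
      refine integral_congr_ae (ae_of_all _ fun t => ?_)
      by_cases ht : t ∈ Set.Ioc (0:ℝ) 1
      · simp only [ht, Set.indicator_of_mem, Pi.one_apply, Complex.ofReal_one, mul_one]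
        congr 3; ring
      · simp [ht]
    rw [e, intervalIntegral.integral_comp_mul_left
      (fun t => Complex.exp (Complex.I * ((-(x * t) : ℝ) : ℂ))) hT.ne']
    simp [hT.ne']
  have h2 : ∫ t in (0:ℝ)..T, Complex.exp (Complex.I * ((x * t : ℝ) : ℂ))
      = (starRingEnd ℂ) (∫ t in (0:ℝ)..T, Complex.exp (Complex.I * ((-(x * t) : ℝ) : ℂ))) := by
    rw [intervalIntegral.integral_of_le hT.le, intervalIntegral.integral_of_le hT.le,
      ← integral_conj]
    refine integral_congr_ae (ae_of_all _ fun t => ?_)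
    simp only [← Complex.exp_conj, map_mul, Complex.conj_I, Complex.conj_ofReal]
    congr 1; push_cast; ring
  rw [h2, mul_comm, Complex.mul_conj, h1, Complex.normSq_eq_norm_sq, norm_mul, fejer,
    Complex.norm_real, Real.norm_of_nonneg hT.le]
  congr 1; ring

/-- By Fubini the frequencies λ, μ are integrated last. The oscillating factor e^{i(λ-μ)(t-s)}
splits into a function of t times one of s, whose integrals over [0,T] are conjugate. -/
theorem integral_integral_spectralInt_mul {a b : ℝ → ℂ} (ha : Integrable a) (hb : Integrable b)
    {T : ℝ} (hT : 0 < T) :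
    ∫ t in (0:ℝ)..T, ∫ s in (0:ℝ)..T, spectralInt a (t - s) * spectralInt b (s - t)
      = ∫ p : ℝ × ℝ, a p.1 * b p.2 * ((T ^ 2 * fejer (T * (p.1 - p.2)) : ℝ) : ℂ) := by
  simp_rw [intervalIntegral.integral_of_le hT.le]
  set ν : Measure ℝ := volume.restrict (Set.Ioc 0 T) with hν
  have hab : Integrable (fun p : ℝ × ℝ => a p.1 * b p.2) (volume.prod volume) := ha.mul_prod hb
  have h1 : ∀ t s : ℝ, spectralInt a (t - s) * spectralInt b (s - t)
      = ∫ p : ℝ × ℝ, Complex.exp (Complex.I * (((p.1 - p.2) * t - (p.1 - p.2) * s : ℝ) : ℂ))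
          * (a p.1 * b p.2) := by
    intro t s
    rw [spectralInt, spectralInt, ← integral_prod_mul, Measure.volume_eq_prod]
    refine integral_congr_ae (ae_of_all _ fun p => ?_)
    simp only
    rw [mul_mul_mul_comm, ← Complex.exp_add]
    congr 2
    push_cast; ring
  simp_rw [h1]
  rw [← integral_prod (μ := ν) (ν := ν) (fun q : ℝ × ℝ => ∫ p : ℝ × ℝ, Complex.exp (Complex.I *
    (((p.1 - p.2) * q.1 - (p.1 - p.2) * q.2 : ℝ) : ℂ)) * (a p.1 * b p.2))]
  swap
  · have : Integrable (fun z : (ℝ × ℝ) × (ℝ × ℝ) => Complex.exp (Complex.I *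
      (((z.2.1 - z.2.2) * z.1.1 - (z.2.1 - z.2.2) * z.1.2 : ℝ) : ℂ)) * (a z.2.1 * b z.2.2))
      ((ν.prod ν).prod (volume.prod volume)) :=
      integrable_exp_mul (hab.comp_snd (ν.prod ν)) (by fun_prop)
    exact this.integral_prod_left
  rw [integral_integral_swap]
  swap
  · exact integrable_exp_mul (hab.comp_snd (ν.prod ν)) (by fun_prop)
  refine integral_congr_ae (ae_of_all _ fun p => ?_)
  simp only
  rw [integral_mul_const, mul_comm]
  congr 1
  rw [← integral_exp_mul_conj T _ hT, intervalIntegral.integral_of_le hT.le,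
    intervalIntegral.integral_of_le hT.le, ← integral_prod_mul]
  refine integral_congr_ae (ae_of_all _ fun q => ?_)
  simp only
  rw [← Complex.exp_add]
  congr 1; push_cast; ring

theorem continuous_fejer : Continuous fejer :=
  (continuous_fourierInt integrable_unit).norm.pow 2

/-- Averages over the square `[0,T]²` as integrals against the Fejér kernel. -/
theorem average_spectralInt_mul {a b : ℝ → ℂ} (ha : Integrable a) (hb : Integrable b)
    (hbc : Continuous b) {B : ℝ} (hB : ∀ x, ‖b x‖ ≤ B) {T : ℝ} (hT : 0 < T) :
    (1 / T : ℝ) * ∫ t in (0:ℝ)..T, ∫ s in (0:ℝ)..T,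
        spectralInt a (t - s) * spectralInt b (s - t)
      = ∫ p : ℝ × ℝ, a p.1 * b (p.1 - p.2 / T) * (fejer p.2 : ℂ) := by
  have hab : Integrable (fun p : ℝ × ℝ => a p.1 * b p.2) (volume.prod volume) := ha.mul_prod hb
  have hF : ∀ x, ‖((fejer x : ℝ) : ℂ)‖ = fejer x := fun x => by
    rw [Complex.norm_real, Real.norm_of_nonneg (fejer_nonneg x)]
  obtain ⟨C, hC⟩ : ∃ C, ∀ x, fejer x ≤ C := by
    refine ⟨(∫ x, ‖(Set.Ioc (0:ℝ) 1).indicator (1 : ℝ → ℝ) x‖) ^ 2, fun x => ?_⟩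
    exact pow_le_pow_left₀ (norm_nonneg _) (norm_fourierInt_le _ _) 2
  have hI1 : Integrable (fun p : ℝ × ℝ =>
      a p.1 * b p.2 * ((T ^ 2 * fejer (T * (p.1 - p.2)) : ℝ) : ℂ)) (volume.prod volume) := by
    refine hab.mul_bdd (c := T ^ 2 * C) ?_ (ae_of_all _ fun p => ?_)
    · have := continuous_fejer
      exact Continuous.aestronglyMeasurable (by fun_prop)
    · rw [Complex.norm_real, Real.norm_of_nonneg (mul_nonneg (sq_nonneg _) (fejer_nonneg _))]
      exact mul_le_mul_of_nonneg_left (hC _) (sq_nonneg _)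
  have hmeas : AEStronglyMeasurable (fun p : ℝ × ℝ => b (p.1 - p.2 / T))
      (volume.prod volume) :=
    Continuous.aestronglyMeasurable (by fun_prop)
  have hI2 : Integrable (fun p : ℝ × ℝ => a p.1 * b (p.1 - p.2 / T) * (fejer p.2 : ℂ))
      (volume.prod volume) := by
    have := ((ha.mul_prod (integrable_fejer.ofReal (𝕜 := ℂ))).bdd_mul (c := B) hmeas
      (ae_of_all _ fun p => hB _))
    refine this.congr (ae_of_all _ fun p => ?_)
    simp only
    rw [RCLike.ofReal_eq_complex_ofReal]
    ring
  rw [integral_integral_spectralInt_mul ha hb hT, Measure.volume_eq_prod,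
    integral_prod _ hI1, integral_prod _ hI2, ← integral_const_mul]
  refine integral_congr_ae (ae_of_all _ fun lam => ?_)
  simp only
  -- The substitution μ = λ - u/T: of the factor T², one T is cancelled by the prefactor 1/T and one
  -- by the Jacobian.
  have e := Measure.integral_comp_div (fun v => a lam * b (lam - v) * (fejer (T * v) : ℂ)) T
  have e2 := integral_sub_left_eq_self
    (fun μ => a lam * b μ * (fejer (T * (lam - μ)) : ℂ)) volume lam
  simp only [sub_sub_cancel] at e2
  rw [e2, abs_of_pos hT] at e
  simp_rw [mul_div_cancel₀ _ hT.ne'] at e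
  rw [e, ← integral_const_mul, ← integral_smul]
  refine integral_congr_ae (ae_of_all _ fun μ => ?_)
  simp only [Complex.real_smul]
  push_cast
  have : (T : ℂ) ≠ 0 := by exact_mod_cast hT.ne'
  field_simp

theorem integral_prod_fejer (g : ℝ → ℂ) :
    ∫ p : ℝ × ℝ, g p.1 * (fejer p.2 : ℂ) = 2 * Real.pi * ∫ x, g x := by
  rw [Measure.volume_eq_prod, integral_prod_mul g (fun x => (fejer x : ℂ)),
    integral_complex_ofReal, integral_fejer]
  push_cast; ring

/-- The L¹–L^∞ bound, with total Fejér mass 2π. It serves for the product of the response and input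
covariances, where b is the bounded density. -/
theorem norm_average_spectralInt_mul_le {a b : ℝ → ℂ} (ha : Integrable a) (hb : Integrable b)
    (hbc : Continuous b) {B : ℝ} (hB : ∀ x, ‖b x‖ ≤ B) {T : ℝ} (hT : 0 < T) :
    ‖(1 / T : ℝ) * ∫ t in (0:ℝ)..T, ∫ s in (0:ℝ)..T,
        spectralInt a (t - s) * spectralInt b (s - t)‖ ≤ 2 * Real.pi * B * ∫ x, ‖a x‖ := by
  rw [average_spectralInt_mul ha hb hbc hB hT]
  have hI : Integrable (fun p : ℝ × ℝ => B * (‖a p.1‖ * fejer p.2)) (volume.prod volume) :=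
    (ha.norm.mul_prod integrable_fejer).const_mul B
  refine (norm_integral_le_of_norm_le hI (ae_of_all _ fun p => ?_)).trans (le_of_eq ?_)
  · rw [norm_mul, norm_mul, Complex.norm_real, Real.norm_of_nonneg (fejer_nonneg _)]
    have := mul_le_mul_of_nonneg_left (hB (p.1 - p.2 / T))
      (mul_nonneg (norm_nonneg (a p.1)) (fejer_nonneg p.2))
    linarith
  · rw [integral_const_mul, integral_prod_mul (fun x => ‖a x‖) fejer, integral_fejer]
    ring

/-- The L²–L² bound, from 2|ab| ≤ |a|² + |b|² and translation invariance. It serves for the product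
of the two cross-covariances, which must be controlled by ‖h‖² alone and not by the L¹ norm of h. -/
theorem norm_average_spectralInt_mul_le' {a b : ℝ → ℂ} (ha : Integrable a) (hb : Integrable b)
    (hbc : Continuous b) {B : ℝ} (hB : ∀ x, ‖b x‖ ≤ B)
    (ha2 : Integrable (fun x => ‖a x‖ ^ 2)) (hb2 : Integrable (fun x => ‖b x‖ ^ 2))
    {T : ℝ} (hT : 0 < T) :
    ‖(1 / T : ℝ) * ∫ t in (0:ℝ)..T, ∫ s in (0:ℝ)..T,
        spectralInt a (t - s) * spectralInt b (s - t)‖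
      ≤ Real.pi * ((∫ x, ‖a x‖ ^ 2) + ∫ x, ‖b x‖ ^ 2) := by
  rw [average_spectralInt_mul ha hb hbc hB hT]
  have hI1 : Integrable (fun p : ℝ × ℝ => ‖a p.1‖ ^ 2 * fejer p.2) (volume.prod volume) :=
    ha2.mul_prod integrable_fejer
  have hval : ∀ u, ∫ x, ‖b (x - u / T)‖ ^ 2 * fejer u = (∫ x, ‖b x‖ ^ 2) * fejer u := by
    intro u
    rw [integral_mul_const, integral_sub_right_eq_self (fun x => ‖b x‖ ^ 2)]
  have hI2 : Integrable (fun p : ℝ × ℝ => ‖b (p.1 - p.2 / T)‖ ^ 2 * fejer p.2)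
      (volume.prod volume) := by
    have hF := continuous_fejer
    rw [integrable_prod_iff' (Continuous.aestronglyMeasurable (by fun_prop))]
    refine ⟨ae_of_all _ fun u => (hb2.comp_sub_right (u / T)).mul_const (fejer u), ?_⟩
    refine (integrable_fejer.const_mul (∫ x, ‖b x‖ ^ 2)).congr (ae_of_all _ fun u => ?_)
    simp only
    rw [← hval]
    refine integral_congr_ae (ae_of_all _ fun x => ?_)
    simp only
    rw [Real.norm_of_nonneg (mul_nonneg (sq_nonneg _) (fejer_nonneg _))]
  refine (norm_integral_le_of_norm_le ((hI1.add hI2).const_mul (1 / 2))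
    (ae_of_all _ fun p => ?_)).trans (le_of_eq ?_)
  · simp only [Pi.add_apply]
    rw [norm_mul, norm_mul, Complex.norm_real, Real.norm_of_nonneg (fejer_nonneg _), ← add_mul,
      ← mul_assoc]
    refine mul_le_mul_of_nonneg_right ?_ (fejer_nonneg _)
    nlinarith [sq_nonneg (‖a p.1‖ - ‖b (p.1 - p.2 / T)‖)]
  · rw [integral_const_mul]
    simp only [Pi.add_apply]
    rw [integral_add hI1 hI2, integral_prod_mul (fun x => ‖a x‖ ^ 2) fejer, integral_fejer,
      integral_prod_symm _ hI2]
    simp only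
    simp_rw [hval]
    rw [integral_const_mul, integral_fejer]
    ring

/-- Convergence of the averages as the length of the square and the index of the spectral density
tend to infinity. -/
theorem tendsto_average_spectralInt_mul {f : ℝ → ℝ → ℝ} {M γ : ℝ} {a b : ℝ → ℂ}
    (hf0 : ∀ Δ, 0 < Δ → ∀ x, 0 ≤ f Δ x) (hfM : ∀ Δ, 0 < Δ → ∀ x, f Δ x ≤ M)
    (hfc : ∀ Δ, 0 < Δ → Continuous (f Δ)) (hfi : ∀ Δ, 0 < Δ → Integrable (f Δ))
    (hft : ∀ r : ℝ, 0 < r → TendstoUniformlyOn f (fun _ => γ) atTop (Set.Icc (-r) r))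
    (ha : Integrable a) {A : ℝ} (hA : ∀ x, ‖a x‖ ≤ A) (hbc : Continuous b)
    {B : ℝ} (hB : ∀ x, ‖b x‖ ≤ B) :
    Tendsto (fun p : ℝ × ℝ => ((1 / p.1 : ℝ) : ℂ) * ∫ t in (0:ℝ)..p.1, ∫ s in (0:ℝ)..p.1,
        spectralInt (fun x => a x * (f p.2 x : ℂ)) (t - s)
          * spectralInt (fun x => b x * (f p.2 x : ℂ)) (s - t))
      (atTop ×ˢ atTop) (𝓝 (2 * Real.pi * γ ^ 2 * ∫ x, a x * b x)) := by
  have hpos : ∀ᶠ p : ℝ × ℝ in atTop ×ˢ atTop, 1 ≤ p.1 ∧ 0 < p.2 :=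
    (eventually_ge_atTop 1).prod_mk (eventually_gt_atTop 0)
  have hfn : ∀ Δ, 0 < Δ → ∀ x, ‖(f Δ x : ℂ)‖ ≤ M := fun Δ hΔ x => by
    rw [Complex.norm_real, Real.norm_of_nonneg (hf0 Δ hΔ x)]; exact hfM Δ hΔ x
  have hM : 0 ≤ M := (hf0 1 one_pos 0).trans (hfM 1 one_pos 0)
  have hBn : 0 ≤ B := (norm_nonneg _).trans (hB 0)
  have hA0 : ∀ Δ, 0 < Δ → Integrable (fun x => a x * (f Δ x : ℂ)) := fun Δ hΔ =>
    ((hfi Δ hΔ).ofReal (𝕜 := ℂ)).bdd_mul (c := A) ha.1 (ae_of_all _ hA)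
  have hB0 : ∀ Δ, 0 < Δ → Integrable (fun x => b x * (f Δ x : ℂ)) := fun Δ hΔ =>
    ((hfi Δ hΔ).ofReal (𝕜 := ℂ)).bdd_mul (c := B) hbc.aestronglyMeasurable (ae_of_all _ hB)
  have hlim : 2 * Real.pi * (γ : ℂ) ^ 2 * ∫ x, a x * b x
      = ∫ p : ℝ × ℝ, (a p.1 * γ) * (b p.1 * γ) * (fejer p.2 : ℂ) := by
    rw [integral_prod_fejer (fun x => (a x * γ) * (b x * γ)), mul_assoc, ← integral_const_mul]
    congr 1
    refine integral_congr_ae (ae_of_all _ fun x => ?_)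
    simp only; ring
  rw [hlim]
  have hev : (fun p : ℝ × ℝ => ∫ q : ℝ × ℝ, (a q.1 * (f p.2 q.1 : ℂ))
      * (b (q.1 - q.2 / p.1) * (f p.2 (q.1 - q.2 / p.1) : ℂ)) * (fejer q.2 : ℂ))
      =ᶠ[atTop ×ˢ atTop] (fun p : ℝ × ℝ => ((1 / p.1 : ℝ) : ℂ) * ∫ t in (0:ℝ)..p.1,
        ∫ s in (0:ℝ)..p.1, spectralInt (fun x => a x * (f p.2 x : ℂ)) (t - s)
          * spectralInt (fun x => b x * (f p.2 x : ℂ)) (s - t)) := by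
    filter_upwards [hpos] with p hp
    have hc := hfc p.2 hp.2
    exact (average_spectralInt_mul (hA0 _ hp.2) (hB0 _ hp.2) (by fun_prop) (B := B * M)
      (fun x => by
        rw [norm_mul]
        exact mul_le_mul (hB x) (hfn _ hp.2 x) (norm_nonneg _) hBn) (by linarith [hp.1])).symm
  refine Tendsto.congr' hev ?_
  -- For a fixed frequency λ and Fejér variable u the argument λ - u/T stays in a fixed compact
  -- interval once T ≥ 1, so locally uniform convergence of the densities handles the moving point.
  -- The bound M, uniform in Δ, provides the dominating function; no relation between T and Δ is
  -- needed.
  refine tendsto_integral_filter_of_dominated_convergence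
    (fun q => B * M * M * (‖a q.1‖ * fejer q.2)) ?_ ?_ ?_ ?_
  · filter_upwards [hpos] with p hp
    have hc := hfc p.2 hp.2
    have hF := continuous_fejer
    have h1 : AEStronglyMeasurable (fun q : ℝ × ℝ => a q.1) (volume.prod volume) := ha.1.comp_fst
    exact ((h1.mul (Continuous.aestronglyMeasurable (by fun_prop))).mul
      (Continuous.aestronglyMeasurable (by fun_prop))).mul
      (Continuous.aestronglyMeasurable (by fun_prop))
  · filter_upwards [hpos] with p hp
    refine ae_of_all _ fun q => ?_
    simp only [norm_mul]
    rw [Complex.norm_real (fejer _), Real.norm_of_nonneg (fejer_nonneg _)]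
    have h1 := mul_le_mul_of_nonneg_left (hfn _ hp.2 q.1) (norm_nonneg (a q.1))
    have h2 : ‖b (q.1 - q.2 / p.1)‖ * ‖(f p.2 (q.1 - q.2 / p.1) : ℂ)‖ ≤ B * M :=
      mul_le_mul (hB _) (hfn _ hp.2 _) (norm_nonneg _) hBn
    have h3 := mul_le_mul h1 h2 (by positivity) (by positivity)
    have h4 := mul_le_mul_of_nonneg_right h3 (fejer_nonneg q.2)
    linarith
  · exact (ha.norm.mul_prod integrable_fejer).const_mul _
  · refine ae_of_all _ fun q => ?_
    have hshift : Tendsto (fun p : ℝ × ℝ => q.1 - q.2 / p.1) (atTop ×ˢ atTop) (𝓝 q.1) := by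
      have : Tendsto (fun p : ℝ × ℝ => q.2 / p.1) (atTop ×ˢ atTop) (𝓝 0) :=
        (tendsto_const_nhds.div_atTop tendsto_id).comp tendsto_fst
      simpa using tendsto_const_nhds.sub this
    have hr : (0:ℝ) < |q.1| + |q.2| + 1 := by positivity
    have hu := hft _ hr
    have hf1 : Tendsto (fun p : ℝ × ℝ => f p.2 q.1) (atTop ×ˢ atTop) (𝓝 γ) := by
      refine (hu.tendsto_at ?_).comp tendsto_snd
      rw [Set.mem_Icc, ← abs_le]; linarith [abs_nonneg q.2]
    have hf2 : Tendsto (fun p : ℝ × ℝ => f p.2 (q.1 - q.2 / p.1)) (atTop ×ˢ atTop) (𝓝 γ) := by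
      rw [Metric.tendsto_nhds]
      intro ε hε
      have h1 := (tendsto_snd (f := (atTop : Filter ℝ)) (g := (atTop : Filter ℝ))).eventually
        (Metric.tendstoUniformlyOn_iff.1 hu ε hε)
      filter_upwards [h1, hpos] with p hp hp1
      rw [dist_comm]
      refine hp _ ?_
      rw [Set.mem_Icc, ← abs_le]
      have h5 : |q.2 / p.1| ≤ |q.2| := by
        rw [abs_div, abs_of_pos (by linarith [hp1.1] : (0:ℝ) < p.1)]
        exact div_le_self (abs_nonneg _) hp1.1
      have := abs_sub q.1 (q.2 / p.1)
      linarith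
    have hc1 := (Complex.continuous_ofReal.tendsto γ).comp hf1
    have hc2 := (Complex.continuous_ofReal.tendsto γ).comp hf2
    have hb1 := (hbc.tendsto q.1).comp hshift
    exact ((tendsto_const_nhds.mul hc1).mul (hb1.mul hc2)).mul tendsto_const_nhds

end

/-! ### Stationary curves in a Hilbert space: Bessel inequality, stochastic integral, filters -/

noncomputable section

section SpectralCurve

variable {E : Type*} [NormedAddCommGroup E] [InnerProductSpace ℝ E] [CompleteSpace E]

/-- The curve `x` in a Hilbert space is stationary with the integrable spectral density `f`. -/
structure HasSpectralDensity (x : ℝ → E) (f : ℝ → ℝ) : Prop where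
  inner_eq : ∀ s t, ((inner ℝ (x s) (x t) : ℝ) : ℂ) = spectralCov f (s - t)
  nonneg : ∀ lam, 0 ≤ f lam
  integrable : Integrable f

variable {x : ℝ → E} {f : ℝ → ℝ}

namespace HasSpectralDensity

theorem norm_sq (hx : HasSpectralDensity x f) (t : ℝ) : ‖x t‖ ^ 2 = ∫ lam, f lam := by
  have h := hx.inner_eq t t
  rw [real_inner_self_eq_norm_sq, sub_self, spectralCov] at h
  simp only [mul_zero, Complex.ofReal_zero, Complex.exp_zero, one_mul] at h
  rw [integral_complex_ofReal] at h
  exact_mod_cast h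

theorem norm_le (hx : HasSpectralDensity x f) (t : ℝ) : ‖x t‖ ≤ √(∫ lam, f lam) := by
  rw [← hx.norm_sq t, Real.sqrt_sq (norm_nonneg _)]

/-- The increment satisfies ‖x s - x t‖² = 2 Re(K(0) - K(s-t)), and K is continuous as the transform
of an integrable density. -/
theorem continuous (hx : HasSpectralDensity x f) : Continuous x := by
  have hc : Continuous (spectralCov f) :=
    continuous_spectralInt (hx.integrable.ofReal (𝕜 := ℂ))
  have hin : ∀ s t, inner ℝ (x s) (x t) = (spectralCov f (s - t)).re := fun s t => by
    rw [← hx.inner_eq, Complex.ofReal_re]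
  rw [continuous_iff_continuousAt]
  intro t
  rw [ContinuousAt, tendsto_iff_norm_sub_tendsto_zero]
  have h2 : ∀ s, ‖x s - x t‖ ^ 2
      = (spectralCov f 0).re - 2 * (spectralCov f (s - t)).re + (spectralCov f 0).re := by
    intro s
    rw [norm_sub_sq_real, ← real_inner_self_eq_norm_sq, ← real_inner_self_eq_norm_sq, hin, hin,
      hin, sub_self, sub_self]
  have h3 : Tendsto (fun s => ‖x s - x t‖ ^ 2) (𝓝 t) (𝓝 0) := by
    simp_rw [h2]
    have : Continuous fun s => (spectralCov f 0).re - 2 * (spectralCov f (s - t)).re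
      + (spectralCov f 0).re := by fun_prop
    have h4 := this.tendsto t
    simp only [sub_self] at h4
    refine h4.trans (le_of_eq ?_)
    congr 1; ring
  have h5 := h3.sqrt
  simpa [Real.sqrt_sq] using h5

theorem integrable_smul (hx : HasSpectralDensity x f) {b : ℝ → ℝ} (hb : Integrable b) :
    Integrable (fun s => b s • x s) := by
  exact hb.smul_bdd (C := √(∫ lam, f lam)) hx.continuous.aestronglyMeasurable
    (ae_of_all _ hx.norm_le)

theorem inner_integral_left (hx : HasSpectralDensity x f) {b : ℝ → ℝ} (hb : Integrable b)
    (t : ℝ) : ((inner ℝ (∫ s, b s • x s) (x t) : ℝ) : ℂ)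
      = ∫ lam, Complex.exp (Complex.I * ((-(lam * t) : ℝ) : ℂ)) * fourierInt b (-lam) * f lam := by
  have h1 : inner ℝ (∫ s, b s • x s) (x t) = ∫ s, b s * inner ℝ (x s) (x t) := by
    rw [real_inner_comm, ← integral_inner (hx.integrable_smul hb)]
    refine integral_congr_ae (ae_of_all _ fun s => ?_)
    simp only [real_inner_smul_right, real_inner_comm]
  rw [h1, ← integral_complex_ofReal]
  simp only [Complex.ofReal_mul, hx.inner_eq, spectralCov]
  have h2 : ∀ s, (b s : ℂ) * ∫ lam, Complex.exp (Complex.I * ((lam * (s - t) : ℝ) : ℂ)) * f lam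
      = ∫ lam, Complex.exp (Complex.I * ((lam * (s - t) : ℝ) : ℂ)) * (b s * f lam) := by
    intro s
    rw [← integral_const_mul]
    refine integral_congr_ae (ae_of_all _ fun lam => ?_)
    simp only; ring
  simp only [← Complex.ofReal_mul] at h2 ⊢
  simp_rw [h2]
  rw [integral_integral_swap]
  · refine integral_congr_ae (ae_of_all _ fun lam => ?_)
    simp only [fourierInt]
    rw [mul_assoc, mul_comm _ (f lam : ℂ), ← integral_const_mul, ← integral_const_mul]
    refine integral_congr_ae (ae_of_all _ fun s => ?_)
    simp only
    have : Complex.exp (Complex.I * ((lam * (s - t) : ℝ) : ℂ))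
        = Complex.exp (Complex.I * ((-(lam * t) : ℝ) : ℂ))
          * Complex.exp (Complex.I * ((-(-lam * s) : ℝ) : ℂ)) := by
      rw [← Complex.exp_add]; congr 1; push_cast; ring
    rw [this]; push_cast; ring
  · have := (hb.mul_prod hx.integrable).ofReal (𝕜 := ℂ)
    exact integrable_exp_mul this (by fun_prop)

theorem inner_integral_integral (hx : HasSpectralDensity x f) {b b' : ℝ → ℝ} (hb : Integrable b)
    (hb' : Integrable b') : ((inner ℝ (∫ s, b s • x s) (∫ s, b' s • x s) : ℝ) : ℂ)
      = ∫ lam, fourierInt b (-lam) * fourierInt b' lam * f lam := by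
  have h1 : inner ℝ (∫ s, b s • x s) (∫ s, b' s • x s)
      = ∫ t, b' t * inner ℝ (∫ s, b s • x s) (x t) := by
    rw [← integral_inner (hx.integrable_smul hb')]
    refine integral_congr_ae (ae_of_all _ fun s => ?_)
    simp only [real_inner_smul_right]
  rw [h1, ← integral_complex_ofReal]
  simp only [Complex.ofReal_mul, hx.inner_integral_left hb]
  have h2 : ∀ t, (b' t : ℂ) * ∫ lam, Complex.exp (Complex.I * ((-(lam * t) : ℝ) : ℂ))
        * fourierInt b (-lam) * f lam
      = ∫ lam, Complex.exp (Complex.I * ((-(lam * t) : ℝ) : ℂ))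
        * (b' t * (fourierInt b (-lam) * f lam)) := by
    intro s
    rw [← integral_const_mul]
    refine integral_congr_ae (ae_of_all _ fun lam => ?_)
    simp only; ring
  simp_rw [h2]
  rw [integral_integral_swap]
  · refine integral_congr_ae (ae_of_all _ fun lam => ?_)
    simp only
    rw [mul_assoc, mul_comm (fourierInt b' lam), ← mul_assoc, fourierInt, fourierInt,
      ← integral_const_mul]
    refine integral_congr_ae (ae_of_all _ fun s => ?_)
    simp only; ring
  · have hm : AEStronglyMeasurable (fun lam => fourierInt b (-lam)) volume :=
      ((continuous_fourierInt hb).comp continuous_neg).aestronglyMeasurable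
    have hg : Integrable (fun lam => fourierInt b (-lam) * (f lam : ℂ)) :=
      (hx.integrable.ofReal (𝕜 := ℂ)).bdd_mul hm (ae_of_all _ fun lam => norm_fourierInt_le b _)
    have := (hb'.ofReal (𝕜 := ℂ)).mul_prod hg
    exact integrable_exp_mul this (by fun_prop)

/-- The squared norm is the integral of |b̂|² f, at most M times the integral of |b̂|², to which
Plancherel applies. Only the L² norm of b appears, which allows the integral to be extended to all
of L²(ℝ). -/
theorem norm_sq_integral_le (hx : HasSpectralDensity x f) {M : ℝ} (hM : ∀ lam, f lam ≤ M)
    {b : ℝ → ℝ} (hb : Integrable b) (hb2 : MemLp b 2 volume) :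
    ‖∫ s, b s • x s‖ ^ 2 ≤ 2 * Real.pi * M * ∫ s, b s ^ 2 := by
  have h := hx.inner_integral_integral hb hb
  rw [real_inner_self_eq_norm_sq] at h
  have h2 : (∫ lam, fourierInt b (-lam) * fourierInt b lam * (f lam : ℂ))
      = ((∫ lam, ‖fourierInt b lam‖ ^ 2 * f lam : ℝ) : ℂ) := by
    rw [← integral_complex_ofReal]
    refine integral_congr_ae (ae_of_all _ fun lam => ?_)
    simp only
    rw [fourierInt_neg, mul_comm ((starRingEnd ℂ) _), Complex.mul_conj, Complex.normSq_eq_norm_sq]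
    push_cast; ring
  rw [h2] at h
  have h3 : ‖∫ s, b s • x s‖ ^ 2 = ∫ lam, ‖fourierInt b lam‖ ^ 2 * f lam := by exact_mod_cast h
  obtain ⟨hi, hv⟩ := plancherel hb hb2
  rw [h3]
  calc ∫ lam, ‖fourierInt b lam‖ ^ 2 * f lam ≤ ∫ lam, ‖fourierInt b lam‖ ^ 2 * M := by
        refine integral_mono_of_nonneg (ae_of_all _ fun lam => ?_) (hi.mul_const M)
          (ae_of_all _ fun lam => ?_)
        · exact mul_nonneg (sq_nonneg _) (hx.nonneg lam)
        · exact mul_le_mul_of_nonneg_left (hM lam) (sq_nonneg _)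
    _ = 2 * Real.pi * M * ∫ s, b s ^ 2 := by rw [integral_mul_const, hv]; ring

/-- The Bessel inequality for a stationary curve with bounded spectral density. -/
theorem integral_inner_sq_le (hx : HasSpectralDensity x f) {M : ℝ} (hM : ∀ lam, f lam ≤ M)
    {T : ℝ} (hT : 0 ≤ T) (φ : E) :
    ∫ t in (0:ℝ)..T, inner ℝ (x t) φ ^ 2 ≤ 2 * Real.pi * M * ‖φ‖ ^ 2 := by
  have hM0 : 0 ≤ M := (hx.nonneg 0).trans (hM 0)
  have hxc := hx.continuous
  have hg : Continuous fun t => inner ℝ (x t) φ := by fun_prop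
  -- Duality: with this b the quantity q = ∫ b² equals ⟨φ, ∫ b x⟩. Cauchy–Schwarz and
  -- `norm_sq_integral_le` give q² ≤ ‖φ‖² · 2πM q, and one q cancels.
  set b : ℝ → ℝ := (Set.Ioc 0 T).indicator fun t => inner ℝ (x t) φ with hbdef
  have hb : Integrable b := (integrable_indicator_iff measurableSet_Ioc).2
    (hg.integrableOn_Ioc)
  have hb2 : Integrable (fun s => b s ^ 2) := by
    have : (fun s => b s ^ 2) = (Set.Ioc 0 T).indicator fun t => inner ℝ (x t) φ ^ 2 := by
      ext s
      by_cases hs : s ∈ Set.Ioc 0 T <;> simp [hbdef, hs]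
    rw [this]
    exact (integrable_indicator_iff measurableSet_Ioc).2 ((hg.pow 2).integrableOn_Ioc)
  have hbm : MemLp b 2 volume := (memLp_two_iff_integrable_sq hb.1).2 hb2
  have hval : ∫ t in (0:ℝ)..T, inner ℝ (x t) φ ^ 2 = ∫ s, b s ^ 2 := by
    rw [intervalIntegral.integral_of_le hT, ← integral_indicator measurableSet_Ioc]
    refine integral_congr_ae (ae_of_all _ fun s => ?_)
    by_cases hs : s ∈ Set.Ioc 0 T <;> simp [hbdef, hs]
  have hin : inner ℝ φ (∫ s, b s • x s) = ∫ s, b s ^ 2 := by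
    rw [← integral_inner (hx.integrable_smul hb)]
    refine integral_congr_ae (ae_of_all _ fun s => ?_)
    simp only [real_inner_smul_right]
    by_cases hs : s ∈ Set.Ioc 0 T
    · simp [hbdef, hs, real_inner_comm, sq]
    · simp [hbdef, hs]
  rw [hval]
  set q := ∫ s, b s ^ 2 with hq
  have hq0 : 0 ≤ q := integral_nonneg fun s => sq_nonneg _
  have h1 := hx.norm_sq_integral_le hM hb hbm
  have h2 := real_inner_le_norm φ (∫ s, b s • x s)
  rw [hin] at h2
  have h3 : q ^ 2 ≤ ‖φ‖ ^ 2 * (2 * Real.pi * M * q) := by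
    calc q ^ 2 ≤ (‖φ‖ * ‖∫ s, b s • x s‖) ^ 2 := pow_le_pow_left₀ hq0 h2 2
      _ = ‖φ‖ ^ 2 * ‖∫ s, b s • x s‖ ^ 2 := by ring
      _ ≤ _ := mul_le_mul_of_nonneg_left h1 (sq_nonneg _)
  rcases hq0.eq_or_lt with h0 | h0
  · rw [← h0]; positivity
  · have : q * q ≤ (2 * Real.pi * M * ‖φ‖ ^ 2) * q := by nlinarith
    exact le_of_mul_le_mul_right this h0

end HasSpectralDensity

/-- Translation on `L²(ℝ)`. -/
def shift (τ : ℝ) : Lp ℝ 2 (volume : Measure ℝ) →ₗᵢ[ℝ] Lp ℝ 2 (volume : Measure ℝ) :=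
  Lp.compMeasurePreservingₗᵢ ℝ (fun s => s + τ) (measurePreserving_add_right volume τ)

/-- Reflection of `L²(ℝ)` at `t / 2`. -/
def reflectAt (t : ℝ) : Lp ℝ 2 (volume : Measure ℝ) →ₗᵢ[ℝ] Lp ℝ 2 (volume : Measure ℝ) :=
  Lp.compMeasurePreservingₗᵢ ℝ (fun s => t - s) (Measure.measurePreserving_sub_left volume t)

theorem coeFn_shift (τ : ℝ) (h : Lp ℝ 2 (volume : Measure ℝ)) :
    shift τ h =ᵐ[volume] fun s => h (s + τ) := Lp.coeFn_compMeasurePreserving h _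

theorem coeFn_reflectAt (t : ℝ) (h : Lp ℝ 2 (volume : Measure ℝ)) :
    reflectAt t h =ᵐ[volume] fun s => h (t - s) := Lp.coeFn_compMeasurePreserving h _

theorem reflectAt_shift (t τ : ℝ) (h : Lp ℝ 2 (volume : Measure ℝ)) :
    reflectAt t (shift τ h) = reflectAt (t + τ) h := by
  refine Lp.ext ?_
  have h1 := (Measure.measurePreserving_sub_left volume t).quasiMeasurePreserving.ae_eq_comp
    (coeFn_shift τ h)
  filter_upwards [coeFn_reflectAt t (shift τ h), coeFn_reflectAt (t + τ) h, h1] with s hs1 hs2 hs3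
  rw [hs1, hs2]
  simp only [Function.comp_apply] at hs3
  rw [hs3]
  congr 1; ring

theorem continuous_reflectAt (h : Lp ℝ 2 (volume : Measure ℝ)) :
    Continuous fun t => reflectAt t h := by
  refine Continuous.compMeasurePreservingLp (f := fun _ => h)
    (g := fun t => (⟨fun s => t - s, by fun_prop⟩ : C(ℝ, ℝ))) continuous_const ?_
    (fun t => Measure.measurePreserving_sub_left volume t) (by simp)
  exact ContinuousMap.continuous_of_continuous_uncurry _
    (continuous_fst.sub continuous_snd)

/-- The subspace of the integrable elements of `L²(ℝ)`. -/
def integrableSubmodule : Submodule ℝ (Lp ℝ 2 (volume : Measure ℝ)) where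
  carrier := {b | Integrable b volume}
  add_mem' {a b} ha hb := (Integrable.add ha hb : Integrable _ volume).congr (Lp.coeFn_add a b).symm
  zero_mem' := (integrable_zero ℝ ℝ volume).congr (Lp.coeFn_zero ℝ 2 volume).symm
  smul_mem' c a ha := (Integrable.smul c ha).congr (Lp.coeFn_smul c a).symm

theorem denseRange_schwartz :
    DenseRange fun h : SchwartzMap ℝ ℝ => (h.toLp 2 volume : Lp ℝ 2 (volume : Measure ℝ)) :=
  SchwartzMap.denseRange_toLpCLM (F := ℝ) (p := 2) (by simp)

theorem denseRange_integrableSubmodule : DenseRange integrableSubmodule.subtype := by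
  refine denseRange_schwartz.mono ?_
  rintro _ ⟨h, rfl⟩
  refine ⟨⟨h.toLp 2 volume, ?_⟩, rfl⟩
  exact h.integrable.congr (h.coeFn_toLp 2 volume).symm

theorem integral_sq_eq_norm_sq {α : Type*} [MeasurableSpace α] {μ : Measure α} (b : Lp ℝ 2 μ) :
    ∫ s, b s ^ 2 ∂μ = ‖b‖ ^ 2 := by
  rw [← real_inner_self_eq_norm_sq, L2.inner_def]
  refine integral_congr_ae (ae_of_all _ fun s => ?_)
  simp [sq]

namespace HasSpectralDensity

/-- The stochastic integral `∫ b(s) x(s) ds` of an integrable function. -/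
def integralLinear (hx : HasSpectralDensity x f) : integrableSubmodule →ₗ[ℝ] E where
  toFun b := ∫ s, (b : Lp ℝ 2 (volume : Measure ℝ)) s • x s
  map_add' a b := by
    rw [← integral_add (hx.integrable_smul a.2) (hx.integrable_smul b.2)]
    refine integral_congr_ae ?_
    filter_upwards [Lp.coeFn_add (a : Lp ℝ 2 (volume : Measure ℝ)) b] with s hs
    simp only [Submodule.coe_add, hs, Pi.add_apply, add_smul]
  map_smul' c a := by
    rw [RingHom.id_apply, ← integral_smul]
    refine integral_congr_ae ?_
    filter_upwards [Lp.coeFn_smul c (a : Lp ℝ 2 (volume : Measure ℝ))] with s hs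
    simp only [Submodule.coe_smul, hs, Pi.smul_apply, smul_eq_mul, mul_smul]

/-- The stochastic integral `∫ b(s) x(s) ds` for `b ∈ L²(ℝ)`, by continuous extension. -/
def stochInt (hx : HasSpectralDensity x f) : Lp ℝ 2 (volume : Measure ℝ) →L[ℝ] E :=
  hx.integralLinear.extendOfNorm integrableSubmodule.subtype

variable {M : ℝ}

theorem norm_integralLinear_le (hx : HasSpectralDensity x f) (hM : ∀ lam, f lam ≤ M)
    (b : integrableSubmodule) :
    ‖hx.integralLinear b‖ ≤ √(2 * Real.pi * M) * ‖integrableSubmodule.subtype b‖ := by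
  have hM0 : 0 ≤ M := (hx.nonneg 0).trans (hM 0)
  have h := hx.norm_sq_integral_le hM b.2 (Lp.memLp _)
  rw [integral_sq_eq_norm_sq] at h
  have h2 := Real.sqrt_le_sqrt h
  rwa [Real.sqrt_sq (norm_nonneg _), Real.sqrt_mul (by positivity),
    Real.sqrt_sq (norm_nonneg _)] at h2

theorem norm_stochInt_le (hx : HasSpectralDensity x f) (hM : ∀ lam, f lam ≤ M)
    (b : Lp ℝ 2 (volume : Measure ℝ)) : ‖hx.stochInt b‖ ≤ √(2 * Real.pi * M) * ‖b‖ :=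
  LinearMap.norm_extendOfNorm_apply_le denseRange_integrableSubmodule _
    (hx.norm_integralLinear_le hM) b

theorem stochInt_eq (hx : HasSpectralDensity x f) (hM : ∀ lam, f lam ≤ M)
    {b : Lp ℝ 2 (volume : Measure ℝ)} (hb : Integrable b) :
    hx.stochInt b = ∫ s, b s • x s :=
  LinearMap.extendOfNorm_eq denseRange_integrableSubmodule ⟨_, hx.norm_integralLinear_le hM⟩
    (⟨b, hb⟩ : integrableSubmodule)

/-- For integrable b the Bochner integral is orthogonal to everything orthogonal to S, hence lies in
the closed subspace S; density does the rest. It keeps the response inside the Gaussian space of the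
input. -/
theorem stochInt_mem (hx : HasSpectralDensity x f) (hM : ∀ lam, f lam ≤ M) {S : Submodule ℝ E}
    (hS : IsClosed (S : Set E)) (hxS : ∀ t, x t ∈ S) (b : Lp ℝ 2 (volume : Measure ℝ)) :
    hx.stochInt b ∈ S := by
  refine denseRange_integrableSubmodule.induction_on (p := fun b => hx.stochInt b ∈ S) b
    (hS.preimage hx.stochInt.continuous) fun b => ?_
  simp only [Submodule.subtype_apply]
  rw [hx.stochInt_eq hM b.2]
  rw [← SetLike.mem_coe, ← hS.submodule_topologicalClosure_eq]
  have h1 : ∀ φ ∈ Sᗮ, inner ℝ φ (∫ s, (b : Lp ℝ 2 (volume : Measure ℝ)) s • x s) = 0 := by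
    intro φ hφ
    rw [← integral_inner (hx.integrable_smul b.2)]
    refine integral_eq_zero_of_ae (ae_of_all _ fun s => ?_)
    simp only [real_inner_smul_right, Pi.zero_apply]
    rw [Submodule.inner_left_of_mem_orthogonal (hxS s) hφ, mul_zero]
  rw [← Submodule.orthogonal_orthogonal_eq_closure]
  exact (Submodule.mem_orthogonal _ _).2 h1

/-- The response at time `t` of the filter with impulse response `h`. -/
def filtered (hx : HasSpectralDensity x f) (h : Lp ℝ 2 (volume : Measure ℝ)) (t : ℝ) : E :=
  hx.stochInt (reflectAt t h)

theorem continuous_filtered (hx : HasSpectralDensity x f) (h : Lp ℝ 2 (volume : Measure ℝ)) :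
    Continuous (hx.filtered h) := hx.stochInt.continuous.comp (continuous_reflectAt h)

/-- A lag in time is a translation of the impulse response; this removes τ from the analysis. -/
theorem filtered_shift (hx : HasSpectralDensity x f) (h : Lp ℝ 2 (volume : Measure ℝ))
    (τ t : ℝ) : hx.filtered (shift τ h) t = hx.filtered h (t + τ) := by
  rw [filtered, reflectAt_shift, filtered]

theorem norm_filtered_le (hx : HasSpectralDensity x f) (hM : ∀ lam, f lam ≤ M)
    (h : Lp ℝ 2 (volume : Measure ℝ)) (t : ℝ) :
    ‖hx.filtered h t‖ ≤ √(2 * Real.pi * M) * ‖h‖ := by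
  refine (hx.norm_stochInt_le hM _).trans (le_of_eq ?_)
  rw [LinearIsometry.norm_map]

theorem integrable_reflectAt {h : Lp ℝ 2 (volume : Measure ℝ)} (hi : Integrable h) (t : ℝ) :
    Integrable (reflectAt t h) :=
  (hi.comp_sub_left t).congr (coeFn_reflectAt t h).symm

theorem fourierInt_reflectAt (h : Lp ℝ 2 (volume : Measure ℝ)) (t lam : ℝ) :
    fourierInt (reflectAt t h) lam
      = Complex.exp (Complex.I * ((-(lam * t) : ℝ) : ℂ)) * fourierInt h (-lam) := by
  have h1 : fourierInt (reflectAt t h) lam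
      = ∫ s, Complex.exp (Complex.I * ((-(lam * s) : ℝ) : ℂ)) * (h (t - s) : ℂ) := by
    refine integral_congr_ae ?_
    filter_upwards [coeFn_reflectAt t h] with s hs
    rw [hs]
  rw [h1, ← integral_sub_left_eq_self _ volume t, fourierInt, ← integral_const_mul]
  refine integral_congr_ae (ae_of_all _ fun s => ?_)
  simp only [sub_sub_cancel]
  rw [← mul_assoc, ← Complex.exp_add]
  congr 2; push_cast; ring

theorem inner_filtered_left (hx : HasSpectralDensity x f) (hM : ∀ lam, f lam ≤ M)
    {h : Lp ℝ 2 (volume : Measure ℝ)} (hi : Integrable h) (s t : ℝ) :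
    ((inner ℝ (hx.filtered h t) (x s) : ℝ) : ℂ)
      = spectralInt (fun lam => fourierInt h lam * (f lam : ℂ)) (t - s) := by
  rw [filtered, hx.stochInt_eq hM (integrable_reflectAt hi t),
    hx.inner_integral_left (integrable_reflectAt hi t), spectralInt]
  refine integral_congr_ae (ae_of_all _ fun lam => ?_)
  simp only [fourierInt_reflectAt, neg_neg]
  rw [← mul_assoc, ← mul_assoc, ← Complex.exp_add]
  congr 3; push_cast; ring

theorem inner_filtered_filtered (hx : HasSpectralDensity x f) (hM : ∀ lam, f lam ≤ M)
    {h : Lp ℝ 2 (volume : Measure ℝ)} (hi : Integrable h) (s t : ℝ) :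
    ((inner ℝ (hx.filtered h t) (hx.filtered h s) : ℝ) : ℂ)
      = spectralInt (fun lam => ((‖fourierInt h lam‖ ^ 2 : ℝ) : ℂ) * (f lam : ℂ)) (t - s) := by
  rw [filtered, filtered, hx.stochInt_eq hM (integrable_reflectAt hi t),
    hx.stochInt_eq hM (integrable_reflectAt hi s),
    hx.inner_integral_integral (integrable_reflectAt hi t) (integrable_reflectAt hi s),
    spectralInt]
  refine integral_congr_ae (ae_of_all _ fun lam => ?_)
  simp only [fourierInt_reflectAt, neg_neg]
  rw [← Complex.normSq_eq_norm_sq, ← Complex.mul_conj, ← fourierInt_neg]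
  have : Complex.exp (Complex.I * ((lam * (t - s) : ℝ) : ℂ))
      = Complex.exp (Complex.I * ((-(-lam * t) : ℝ) : ℂ))
        * Complex.exp (Complex.I * ((-(lam * s) : ℝ) : ℂ)) := by
    rw [← Complex.exp_add]; congr 1; push_cast; ring
  rw [this]; ring

/-- For integrable h the transform is bounded, so the response is itself a stationary curve with
bounded density and the Bessel inequality applies to it too. -/
theorem filtered_hasSpectralDensity (hx : HasSpectralDensity x f) (hM : ∀ lam, f lam ≤ M)
    {h : Lp ℝ 2 (volume : Measure ℝ)} (hi : Integrable h) :
    HasSpectralDensity (hx.filtered h) (fun lam => ‖fourierInt h lam‖ ^ 2 * f lam) where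
  inner_eq s t := by
    rw [hx.inner_filtered_filtered hM hi t s, spectralCov_eq_spectralInt]
    simp only [Complex.ofReal_mul]
  nonneg lam := mul_nonneg (sq_nonneg _) (hx.nonneg lam)
  integrable := hx.integrable.bdd_mul (c := (∫ s, ‖h s‖) ^ 2)
    ((continuous_fourierInt hi).norm.pow 2).aestronglyMeasurable (ae_of_all _ fun lam => by
      rw [Real.norm_of_nonneg (sq_nonneg _)]
      exact pow_le_pow_left₀ (norm_nonneg _) (norm_fourierInt_le _ _) 2)

end HasSpectralDensity

end SpectralCurve

end

/-! ### Mean-square limits and their identification with limits in L²(P) -/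

noncomputable section

section MeanSquare

variable {Ω : Type*} [MeasurableSpace Ω] {P : Measure Ω} [IsProbabilityMeasure P]

/-- The Bochner integral of an `L²`-valued function is the pathwise integral of a jointly
measurable version. -/
theorem coeFn_integral_Lp {α : Type*} [MeasurableSpace α] {ν : Measure α} [SFinite ν]
    {g : α → Lp ℝ 2 P} (hg : Integrable g ν) {G : α → Ω → ℝ}
    (hG : AEStronglyMeasurable (fun p : α × Ω => G p.1 p.2) (ν.prod P))
    (h : ∀ᵐ s ∂ν, g s =ᵐ[P] G s) :
    ((∫ s, g s ∂ν : Lp ℝ 2 P) : Ω → ℝ) =ᵐ[P] fun ω => ∫ s, G s ω ∂ν := by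
  have hGi : Integrable (fun p : α × Ω => G p.1 p.2) (ν.prod P) := by
    rw [integrable_prod_iff hG]
    constructor
    · filter_upwards [h] with s hs
      exact ((Lp.memLp (g s)).integrable (by norm_num)).congr hs
    · refine hg.norm.mono' hG.norm.integral_prod_right' ?_
      filter_upwards [h] with s hs
      rw [Real.norm_of_nonneg (integral_nonneg fun ω => norm_nonneg _)]
      refine (le_of_eq (integral_congr_ae ?_)).trans (integral_abs_le_norm (g s))
      filter_upwards [hs] with ω hω
      rw [hω, Real.norm_eq_abs]
  -- The integrals over every event A are compared: pairing with the indicator of A commutes with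
  -- the Bochner integral, and Fubini treats the pathwise integral.
  refine Integrable.ae_eq_of_forall_setIntegral_eq _ _
    ((Lp.memLp _).integrable (by norm_num)) hGi.integral_prod_right fun A hA _ => ?_
  have e1 : ∀ u : Lp ℝ 2 P, ∫ ω in A, u ω ∂P
      = inner ℝ (indicatorConstLp 2 hA (measure_ne_top P A) (1:ℝ)) u := fun u =>
    (L2.inner_indicatorConstLp_one hA (measure_ne_top P A) u).symm
  rw [e1, ← integral_inner hg]
  simp_rw [← e1]
  have hGA : Integrable (fun p : α × Ω => G p.1 p.2) (ν.prod (P.restrict A)) := by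
    refine hGi.mono_measure ?_
    rw [← Measure.restrict_univ (μ := ν), Measure.prod_restrict, Measure.restrict_univ]
    exact Measure.restrict_le_self
  rw [← integral_integral_swap hGA]
  refine integral_congr_ae ?_
  filter_upwards [h] with s hs
  exact integral_congr_ae (ae_restrict_of_ae hs)

theorem isMSLim_of_tendsto {ι : Type*} {l : Filter ι} {s : ι → Ω → ℝ} {F : ι → Lp ℝ 2 P}
    {G : Lp ℝ 2 P} (hF : Tendsto F l (𝓝 G)) (hs : ∀ᶠ i in l, F i =ᵐ[P] s i) :
    IsMSLim P l s G := by
  refine ⟨Lp.memLp G, ?_⟩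
  refine ((Lp.tendsto_Lp_iff_tendsto_eLpNorm' F G).1 hF).congr' ?_
  filter_upwards [hs] with i hi
  refine eLpNorm_congr_ae ?_
  filter_upwards [hi] with ω hω
  simp only [Pi.sub_apply, hω]

theorem IsMSLim.msLim {ι : Type*} {l : Filter ι} {s : ι → Ω → ℝ} {ξ : Ω → ℝ}
    (h : IsMSLim P l s ξ) : IsMSLim P l s (msLim P l s) := by
  have h' : ∃ ξ, IsMSLim P l s ξ := ⟨ξ, h⟩
  rw [Correlogram.msLim, dif_pos h']
  exact h'.choose_spec

theorem memLp_msLim {ι : Type*} (l : Filter ι) (s : ι → Ω → ℝ) : MemLp (msLim P l s) 2 P := by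
  by_cases h : ∃ ξ, IsMSLim P l s ξ
  · exact h.choose_spec.msLim.1
  · rw [msLim, dif_neg h]
    exact MemLp.zero

theorem IsMSLim.ae_eq {ι : Type*} {l : Filter ι} [l.NeBot] {s : ι → Ω → ℝ} {ξ η : Ω → ℝ}
    (hξ : IsMSLim P l s ξ) (hη : IsMSLim P l s η)
    (hs : ∀ᶠ i in l, AEStronglyMeasurable (s i) P) : ξ =ᵐ[P] η := by
  have h0 : eLpNorm (ξ - η) 2 P ≤ 0 := by
    have hlim : Tendsto (fun i => eLpNorm (s i - ξ) 2 P + eLpNorm (s i - η) 2 P) l (𝓝 (0 + 0)) :=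
      hξ.2.add hη.2
    rw [add_zero] at hlim
    refine ge_of_tendsto hlim ?_
    filter_upwards [hs] with i hi
    have : ξ - η = (s i - η) - (s i - ξ) := by abel
    rw [this, add_comm]
    exact eLpNorm_sub_le (hi.sub hη.1.1) (hi.sub hξ.1.1) (by norm_num)
  have h1 := (eLpNorm_eq_zero_iff (hξ.1.1.sub hη.1.1) (by norm_num)).1 (le_antisymm h0 bot_le)
  filter_upwards [h1] with ω hω
  simpa [sub_eq_zero] using hω

/-- The choice made in `msLim` is harmless: along a proper filter mean-square limits are unique
almost surely. -/
theorem msLim_ae_eq {ι : Type*} {l : Filter ι} [l.NeBot] {s : ι → Ω → ℝ} {F : ι → Lp ℝ 2 P}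
    {G : Lp ℝ 2 P} (hF : Tendsto F l (𝓝 G)) (hs : ∀ᶠ i in l, F i =ᵐ[P] s i) :
    msLim P l s =ᵐ[P] G := by
  have h := isMSLim_of_tendsto hF hs
  refine h.msLim.ae_eq h ?_
  filter_upwards [hs] with i hi
  exact (Lp.aestronglyMeasurable (F i)).congr hi

end MeanSquare

/-! ### Riemann sums over tagged partitions -/

section Riemann

variable {a b : ℝ}

namespace TaggedPartition

theorem sub_le_mesh (π : TaggedPartition a b) (i : Fin π.n) :
    π.point i.succ - π.point i.castSucc ≤ π.mesh :=
  le_ciSup (f := fun i : Fin π.n => π.point i.succ - π.point i.castSucc)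
    (Set.finite_range _).bddAbove i

theorem sum_integral {E : Type*} [NormedAddCommGroup E] [NormedSpace ℝ E] {g : ℝ → E}
    (hg : Continuous g) (π : TaggedPartition a b) :
    ∑ i : Fin π.n, ∫ t in (π.point i.castSucc)..(π.point i.succ), g t = ∫ t in a..b, g t := by
  -- The partition points reindexed by ℕ to telescope the integrals; the default value b beyond the
  -- last index is never used.
  set q : ℕ → ℝ := fun k => if h : k < π.n + 1 then π.point ⟨k, h⟩ else b with hq
  have h1 : ∀ i : Fin π.n, ∫ t in (π.point i.castSucc)..(π.point i.succ), g t
      = (fun k : ℕ => ∫ t in (q k)..(q (k + 1)), g t) i := by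
    intro i
    have e1 : q i = π.point i.castSucc := by
      rw [hq]; simp only [dif_pos (Nat.lt_succ_of_lt i.2)]; rfl
    have e2 : q (i + 1) = π.point i.succ := by
      rw [hq]; simp only [dif_pos (Nat.succ_lt_succ i.2)]; rfl
    simp only [e1, e2]
  rw [Finset.sum_congr rfl fun i _ => h1 i, Fin.sum_univ_eq_sum_range
      (fun k : ℕ => ∫ t in (q k)..(q (k + 1)), g t),
    intervalIntegral.sum_integral_adjacent_intervals fun k _ => hg.intervalIntegrable _ _]
  have e0 : q 0 = a := by
    rw [hq]; simp only [dif_pos (Nat.succ_pos _)]; exact π.first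
  have en : q π.n = b := by
    rw [hq]; simp only [dif_pos (Nat.lt_succ_self _)]; exact π.last
  rw [e0, en]

theorem sum_length (π : TaggedPartition a b) :
    ∑ i : Fin π.n, (π.point i.succ - π.point i.castSucc) = b - a := by
  have := π.sum_integral (g := fun _ => (1:ℝ)) continuous_const
  simpa using this

/-- The partition of `[a, b]` into `n + 1` intervals of equal length. -/
def uniform (hab : a ≤ b) (n : ℕ) : TaggedPartition a b where
  n := n + 1
  point i := a + (b - a) / (n + 1) * (i : ℕ)
  tag i := a + (b - a) / (n + 1) * (i : ℕ)
  monotone i j hij := by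
    have h : (0:ℝ) ≤ (b - a) / (n + 1) := div_nonneg (sub_nonneg.2 hab) (by positivity)
    have h2 : ((i : ℕ) : ℝ) ≤ ((j : ℕ) : ℝ) := by exact_mod_cast hij
    simpa using mul_le_mul_of_nonneg_left h2 h
  first := by simp
  last := by
    have : ((n : ℝ) + 1) ≠ 0 := by positivity
    simp only [Fin.val_last]
    push_cast
    field_simp
    ring
  tag_mem i := by
    have h : (0:ℝ) ≤ (b - a) / (n + 1) := div_nonneg (sub_nonneg.2 hab) (by positivity)
    refine ⟨le_of_eq rfl, ?_⟩
    simp only [Fin.val_succ]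
    push_cast
    linarith

theorem mesh_uniform (hab : a ≤ b) (n : ℕ) : (uniform hab n).mesh = (b - a) / (n + 1) := by
  have : ∀ i : Fin (uniform hab n).n,
      (uniform hab n).point i.succ - (uniform hab n).point i.castSucc = (b - a) / (n + 1) := by
    intro i
    change a + (b - a) / (n + 1) * ((((i : ℕ) + 1 : ℕ)) : ℝ) - (a + (b - a) / (n + 1) * ((i : ℕ) : ℝ))
      = _
    push_cast
    ring
  rw [mesh]
  simp_rw [this]
  have : Nonempty (Fin (uniform hab n).n) := ⟨⟨0, Nat.succ_pos n⟩⟩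
  exact ciSup_const

end TaggedPartition

/-- Uniform partitions have arbitrarily small mesh. Properness of the filter is what makes the
mean-square Riemann integral unique. -/
theorem meshFilter_neBot (hab : a ≤ b) : (meshFilter a b).NeBot := by
  have h : Tendsto (fun n : ℕ => TaggedPartition.uniform hab n) atTop (meshFilter a b) := by
    rw [meshFilter, tendsto_comap_iff]
    have : (TaggedPartition.mesh ∘ fun n : ℕ => TaggedPartition.uniform hab n)
        = fun n : ℕ => (b - a) / ((n : ℝ) + 1) := by
      ext n; exact TaggedPartition.mesh_uniform hab n
    rw [this]
    exact tendsto_const_nhds.div_atTop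
      (tendsto_atTop_add_const_right _ _ tendsto_natCast_atTop_atTop)
  exact h.neBot

/-- Riemann sums of a continuous function converge to its Bochner integral. -/
theorem tendsto_riemannSum {E : Type*} [NormedAddCommGroup E] [NormedSpace ℝ E] [CompleteSpace E]
    (hab : a ≤ b) {g : ℝ → E} (hg : Continuous g) :
    Tendsto (fun π : TaggedPartition a b =>
        ∑ i : Fin π.n, (π.point i.succ - π.point i.castSucc) • g (π.tag i))
      (meshFilter a b) (𝓝 (∫ t in a..b, g t)) := by
  rw [Metric.tendsto_nhds]
  intro ε hε
  -- The summand 1 covers a = b and makes the final inequality strict.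
  set η := ε / (b - a + 1) with hη
  have hba : 0 < b - a + 1 := by linarith
  have hη0 : 0 < η := by positivity
  obtain ⟨δ, hδ, hu⟩ := Metric.uniformContinuousOn_iff.1
    (isCompact_Icc.uniformContinuousOn_of_continuous (hg.continuousOn (s := Set.Icc a b))) η hη0
  have hmesh : ∀ᶠ π : TaggedPartition a b in meshFilter a b, π.mesh < δ :=
    tendsto_comap.eventually (eventually_lt_nhds hδ)
  filter_upwards [hmesh] with π hπ
  rw [dist_eq_norm, ← π.sum_integral hg, ← Finset.sum_sub_distrib]
  have hpt : ∀ i, π.point i ∈ Set.Icc a b := fun i =>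
    ⟨π.first.symm.le.trans (π.monotone (Fin.zero_le i)),
      (π.monotone (Fin.le_last i)).trans π.last.le⟩
  have hterm : ∀ i : Fin π.n, ‖(π.point i.succ - π.point i.castSucc) • g (π.tag i)
      - ∫ t in (π.point i.castSucc)..(π.point i.succ), g t‖
      ≤ η * (π.point i.succ - π.point i.castSucc) := by
    intro i
    have hle : π.point i.castSucc ≤ π.point i.succ := π.monotone i.castSucc_lt_succ.le
    rw [← intervalIntegral.integral_const, ← intervalIntegral.integral_sub
      intervalIntegrable_const (hg.intervalIntegrable _ _)]
    refine (intervalIntegral.norm_integral_le_of_norm_le_const (C := η) fun t ht => ?_).trans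
      (le_of_eq ?_)
    · rw [Set.uIoc_of_le hle] at ht
      have htag := π.tag_mem i
      have h1 := π.sub_le_mesh i
      rw [← dist_eq_norm]
      refine (hu _ ⟨(hpt _).1.trans htag.1, htag.2.trans (hpt _).2⟩ _
        ⟨(hpt _).1.trans ht.1.le, ht.2.trans (hpt _).2⟩ ?_).le
      rw [Real.dist_eq, abs_lt]
      constructor <;> linarith [htag.1, htag.2, ht.1, ht.2]
    · rw [abs_of_nonneg (sub_nonneg.2 hle)]
  refine (norm_sum_le _ _).trans_lt ?_
  refine (Finset.sum_le_sum fun i _ => hterm i).trans_lt ?_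
  rw [← Finset.mul_sum, π.sum_length, hη, div_mul_eq_mul_div, div_lt_iff₀ hba]
  nlinarith

end Riemann

end

/-! ### The input process, its response and the correlogram as elements of L²(P) -/

noncomputable section

section Truncation

theorem integrable_indicator_Ioc {H : ℝ → ℝ} (hH : MemLp H 2 volume) (a b : ℝ) :
    Integrable ((Set.Ioc a b).indicator H) := by
  rw [integrable_indicator_iff measurableSet_Ioc]
  exact MemLp.integrable (q := 2) (by norm_num) (hH.restrict _)

/-- Truncations of a square integrable function converge to it. -/
theorem tendsto_toLp_indicator_Ioc {H : ℝ → ℝ} (hH : MemLp H 2 volume) :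
    Tendsto (fun p : ℝ × ℝ =>
        ((hH.indicator measurableSet_Ioc).toLp ((Set.Ioc (-p.1) p.2).indicator H) :
          Lp ℝ 2 (volume : Measure ℝ)))
      (atTop ×ˢ atTop) (𝓝 (hH.toLp H)) := by
  rw [tendsto_iff_norm_sub_tendsto_zero]
  have h1 : ∀ p : ℝ × ℝ, ‖((hH.indicator measurableSet_Ioc).toLp ((Set.Ioc (-p.1) p.2).indicator H)
      : Lp ℝ 2 (volume : Measure ℝ)) - hH.toLp H‖
      = √(∫ s, ((Set.Ioc (-p.1) p.2).indicator H s - H s) ^ 2) := by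
    intro p
    rw [← Real.sqrt_sq (norm_nonneg (_ - _)), ← integral_sq_eq_norm_sq]
    congr 1
    refine integral_congr_ae ?_
    filter_upwards [Lp.coeFn_sub ((hH.indicator measurableSet_Ioc).toLp
      ((Set.Ioc (-p.1) p.2).indicator H)) (hH.toLp H), hH.coeFn_toLp,
      (hH.indicator (measurableSet_Ioc (a := -p.1) (b := p.2))).coeFn_toLp] with s a b c
    rw [a, Pi.sub_apply, b, c]
  simp_rw [h1]
  rw [← Real.sqrt_zero]
  refine Tendsto.sqrt ?_
  rw [show (0:ℝ) = ∫ _ : ℝ, (0:ℝ) by simp]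
  refine tendsto_integral_filter_of_dominated_convergence (fun s => H s ^ 2)
    (Eventually.of_forall fun p => ?_) (Eventually.of_forall fun p => ae_of_all _ fun s => ?_)
    hH.integrable_sq (ae_of_all _ fun s => ?_)
  · exact ((hH.1.indicator measurableSet_Ioc).sub hH.1).pow 2
  · by_cases hs : s ∈ Set.Ioc (-p.1) p.2 <;> simp [hs, sq_nonneg]
  · refine tendsto_const_nhds.congr' ?_
    filter_upwards [(eventually_gt_atTop (-s)).prod_mk (eventually_ge_atTop s)] with p hp
    have : s ∈ Set.Ioc (-p.1) p.2 := ⟨by linarith [hp.1], hp.2⟩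
    simp [this]

end Truncation

variable {Ω : Type*} [MeasurableSpace Ω] {P : Measure Ω}

/-- A measurable stationary centered Gaussian process whose spectral density `f` is
continuous, integrable and bounded by `M`. -/
structure IsInput (P : Measure Ω) (X : ℝ → Ω → ℝ) (f : ℝ → ℝ) (M : ℝ) : Prop where
  measurable : Measurable (fun p : ℝ × Ω => X p.1 p.2)
  gaussian : IsCenteredGaussian P X (fun s t => spectralCov f (s - t))
  nonneg : ∀ lam, 0 ≤ f lam
  continuous : Continuous f
  integrable : Integrable f
  le : ∀ lam, f lam ≤ M

namespace IsInput

variable {X : ℝ → Ω → ℝ} {f : ℝ → ℝ} {M : ℝ} [IsProbabilityMeasure P]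

theorem memLp (hX : IsInput P X f M) (t : ℝ) : MemLp (X t) 2 P :=
  (hX.gaussian.gaussian.hasGaussianLaw_eval t).memLp_two

/-- The process as a curve in `L²(P)`. -/
def vec (hX : IsInput P X f M) (t : ℝ) : Lp ℝ 2 P := (hX.memLp t).toLp (X t)

theorem coeFn_vec (hX : IsInput P X f M) (t : ℝ) : hX.vec t =ᵐ[P] X t := MemLp.coeFn_toLp _

theorem hasSpectralDensity (hX : IsInput P X f M) : HasSpectralDensity hX.vec f where
  inner_eq s t := by
    rw [← hX.gaussian.cov s t, inner_eq_integral_mul]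
    congr 1
    refine integral_congr_ae ?_
    filter_upwards [hX.coeFn_vec s, hX.coeFn_vec t] with ω h1 h2
    rw [h1, h2]
  nonneg := hX.nonneg
  integrable := hX.integrable

/-- The Gaussian Hilbert space of the process. -/
def space (hX : IsInput P X f M) : Submodule ℝ (Lp ℝ 2 P) :=
  (Submodule.span ℝ (Set.range hX.vec)).topologicalClosure

theorem isGaussianSubspace (hX : IsInput P X f M) : IsGaussianSubspace hX.space :=
  (isGaussianSubspace_span hX.gaussian.gaussian hX.gaussian.centered hX.vec
    hX.coeFn_vec).topologicalClosure

theorem vec_mem (hX : IsInput P X f M) (t : ℝ) : hX.vec t ∈ hX.space :=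
  Submodule.le_topologicalClosure _ (Submodule.subset_span ⟨t, rfl⟩)

theorem filtered_mem (hX : IsInput P X f M) (h : Lp ℝ 2 (volume : Measure ℝ)) (t : ℝ) :
    hX.hasSpectralDensity.filtered h t ∈ hX.space :=
  hX.hasSpectralDensity.stochInt_mem hX.le (Submodule.isClosed_topologicalClosure _) hX.vec_mem _

/-- The input at time `t`, in the Gaussian Hilbert space. -/
def input (hX : IsInput P X f M) (t : ℝ) : hX.space := ⟨hX.vec t, hX.vec_mem t⟩

/-- The response at time `t`, in the Gaussian Hilbert space. -/
def output (hX : IsInput P X f M) (h : Lp ℝ 2 (volume : Measure ℝ)) (t : ℝ) : hX.space :=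
  ⟨hX.hasSpectralDensity.filtered h t, hX.filtered_mem h t⟩

theorem continuous_input (hX : IsInput P X f M) : Continuous hX.input :=
  hX.hasSpectralDensity.continuous.subtype_mk _

theorem continuous_output (hX : IsInput P X f M) (h : Lp ℝ 2 (volume : Measure ℝ)) :
    Continuous (hX.output h) :=
  (hX.hasSpectralDensity.continuous_filtered h).subtype_mk _

theorem output_shift (hX : IsInput P X f M) (h : Lp ℝ 2 (volume : Measure ℝ)) (τ t : ℝ) :
    hX.output (shift τ h) t = hX.output h (t + τ) :=
  Subtype.ext (hX.hasSpectralDensity.filtered_shift h τ t)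

/-- The truncated response function is integrable, so its stochastic integral is a Bochner integral
over a bounded interval. After the substitution s ↦ t - s, joint measurability of X identifies it
with the pathwise integral. -/
theorem filtered_toLp_indicator_ae_eq (hX : IsInput P X f M) {H : ℝ → ℝ} (hH : MemLp H 2 volume)
    (t : ℝ) {p : ℝ × ℝ} (hp : -p.1 ≤ p.2) :
    hX.hasSpectralDensity.filtered
        ((hH.indicator measurableSet_Ioc).toLp ((Set.Ioc (-p.1) p.2).indicator H)) t
      =ᵐ[P] truncatedResponse H X t p := by
  have hx := hX.hasSpectralDensity
  have hind := hH.indicator (measurableSet_Ioc (a := -p.1) (b := p.2))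
  have hi := integrable_indicator_Ioc hH (-p.1) p.2
  have hi' : Integrable (hind.toLp _) := hi.congr hind.coeFn_toLp.symm
  have hres : Integrable (fun s => H s • hX.vec (t - s)) (volume.restrict (Set.Ioc (-p.1) p.2)) := by
    have := (hi.smul_bdd (C := √(∫ lam, f lam))
      (hx.continuous.comp (continuous_const.sub continuous_id)).aestronglyMeasurable
      (ae_of_all _ fun s => hx.norm_le (t - s)))
    rw [← IntegrableOn, ← integrable_indicator_iff measurableSet_Ioc]
    refine this.congr (ae_of_all _ fun s => ?_)
    by_cases hs : s ∈ Set.Ioc (-p.1) p.2 <;> simp [hs]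
  have e1 : hx.filtered (hind.toLp _) t
      = ∫ s in Set.Ioc (-p.1) p.2, H s • hX.vec (t - s) := by
    rw [HasSpectralDensity.filtered, hx.stochInt_eq hX.le
      (HasSpectralDensity.integrable_reflectAt hi' t), ← integral_indicator measurableSet_Ioc,
      ← integral_sub_left_eq_self _ volume t]
    refine integral_congr_ae ?_
    have h2 := (Measure.measurePreserving_sub_left volume t).quasiMeasurePreserving.ae_eq_comp
      (coeFn_reflectAt t (hind.toLp _))
    filter_upwards [h2, hind.coeFn_toLp] with s hs hs2
    simp only [Function.comp_apply, sub_sub_cancel] at hs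
    rw [hs, hs2]
    by_cases hs : s ∈ Set.Ioc (-p.1) p.2 <;> simp [hs]
  rw [e1]
  have hm : AEStronglyMeasurable (fun q : ℝ × Ω => H q.1 * X (t - q.1) q.2)
      ((volume.restrict (Set.Ioc (-p.1) p.2)).prod P) := by
    have h1 : AEStronglyMeasurable (fun q : ℝ × Ω => H q.1)
        ((volume.restrict (Set.Ioc (-p.1) p.2)).prod P) := hH.1.restrict.comp_fst
    exact h1.mul (hX.measurable.comp
      ((measurable_const.sub measurable_fst).prodMk measurable_snd)).aestronglyMeasurable
  refine (coeFn_integral_Lp hres (G := fun s ω => H s * X (t - s) ω) hm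
    (ae_of_all _ fun s => ?_)).trans (ae_of_all _ fun ω => ?_)
  · filter_upwards [Lp.coeFn_smul (H s) (hX.vec (t - s)), hX.coeFn_vec (t - s)] with ω h1 h2
    rw [h1, Pi.smul_apply, h2, smul_eq_mul]
  · simp only [truncatedResponse]
    rw [intervalIntegral.integral_of_le hp]

theorem tendsto_filtered_indicator (hX : IsInput P X f M) {H : ℝ → ℝ} (hH : MemLp H 2 volume)
    (t : ℝ) : Tendsto (fun p : ℝ × ℝ => hX.hasSpectralDensity.filtered
        ((hH.indicator measurableSet_Ioc).toLp ((Set.Ioc (-p.1) p.2).indicator H)) t)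
      (atTop ×ˢ atTop) (𝓝 (hX.hasSpectralDensity.filtered (hH.toLp H) t)) :=
  ((hX.hasSpectralDensity.stochInt.continuous.comp (reflectAt t).continuous).tendsto _).comp
    (tendsto_toLp_indicator_Ioc hH)

theorem eventually_truncatedResponse (hX : IsInput P X f M) {H : ℝ → ℝ} (hH : MemLp H 2 volume)
    (t : ℝ) : ∀ᶠ p : ℝ × ℝ in atTop ×ˢ atTop, hX.hasSpectralDensity.filtered
        ((hH.indicator measurableSet_Ioc).toLp ((Set.Ioc (-p.1) p.2).indicator H)) t
      =ᵐ[P] truncatedResponse H X t p := by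
  filter_upwards [(eventually_ge_atTop 0).prod_mk (eventually_ge_atTop 0)] with p hp
  exact hX.filtered_toLp_indicator_ae_eq hH t (by linarith [hp.1, hp.2])

theorem isMSLim_response (hX : IsInput P X f M) {H : ℝ → ℝ} (hH : MemLp H 2 volume) (t : ℝ) :
    IsMSLim P (atTop ×ˢ atTop) (truncatedResponse H X t) (response P H X t) :=
  (isMSLim_of_tendsto (hX.tendsto_filtered_indicator hH t)
    (hX.eventually_truncatedResponse hH t)).msLim

theorem response_ae_eq (hX : IsInput P X f M) {H : ℝ → ℝ} (hH : MemLp H 2 volume) (t : ℝ) :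
    response P H X t =ᵐ[P] (hX.output (hH.toLp H) t : Lp ℝ 2 P) :=
  msLim_ae_eq (hX.tendsto_filtered_indicator hH t) (hX.eventually_truncatedResponse hH t)

/-- The centered integral `∫_0^T (Y(t) X(t) - E Y(t) X(t)) dt`. -/
def quad (hX : IsInput P X f M) (T : ℝ) (h : Lp ℝ 2 (volume : Measure ℝ)) : Lp ℝ 2 P :=
  ∫ t in (0:ℝ)..T, hX.isGaussianSubspace.centeredMul (hX.output h t) (hX.input t)

theorem continuous_quad_integrand (hX : IsInput P X f M) (h : Lp ℝ 2 (volume : Measure ℝ)) :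
    Continuous fun t => hX.isGaussianSubspace.centeredMul (hX.output h t) (hX.input t) :=
  hX.isGaussianSubspace.continuous_centeredMul (hX.continuous_output h) hX.continuous_input

/-- The product `Y(t + τ) X(t)` as a curve in `L²(P)`. -/
def prodCurve (hX : IsInput P X f M) (h : Lp ℝ 2 (volume : Measure ℝ)) (t : ℝ) : Lp ℝ 2 P :=
  hX.isGaussianSubspace.centeredMul (hX.output h t) (hX.input t)
    + Lp.constL 2 P ℝ (inner ℝ (hX.output h t) (hX.input t))

theorem continuous_inner_output_input (hX : IsInput P X f M) (h : Lp ℝ 2 (volume : Measure ℝ)) :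
    Continuous fun t => (inner ℝ (hX.output h t) (hX.input t) : ℝ) :=
  (hX.continuous_output h).inner hX.continuous_input

theorem continuous_prodCurve (hX : IsInput P X f M) (h : Lp ℝ 2 (volume : Measure ℝ)) :
    Continuous (hX.prodCurve h) :=
  (hX.continuous_quad_integrand h).add
    ((Lp.constL 2 P ℝ).continuous.comp (hX.continuous_inner_output_input h))

theorem prodCurve_ae_eq (hX : IsInput P X f M) {H : ℝ → ℝ} (hH : MemLp H 2 volume) (τ t : ℝ) :
    hX.prodCurve (shift τ (hH.toLp H)) t =ᵐ[P] corrIntegrand P H X τ t := by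
  set a := hX.output (shift τ (hH.toLp H)) t with ha
  have h3 := hX.response_ae_eq hH (t + τ)
  rw [← hX.output_shift, ← ha] at h3
  filter_upwards [Lp.coeFn_add (hX.isGaussianSubspace.centeredMul a (hX.input t))
    (Lp.constL 2 P ℝ (inner ℝ a (hX.input t))), hX.isGaussianSubspace.coeFn_centeredMul a (hX.input t),
    h3, hX.coeFn_vec t, Lp.coeFn_const (p := 2) (μ := P) (inner ℝ a (hX.input t) : ℝ)]
    with ω h1 h2 h3 h4 h5
  have h6 : (Lp.constL 2 P ℝ (inner ℝ a (hX.input t)) : Lp ℝ 2 P) ω = inner ℝ a (hX.input t) := h5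
  change (hX.isGaussianSubspace.centeredMul a (hX.input t)
    + Lp.constL 2 P ℝ (inner ℝ a (hX.input t)) : Lp ℝ 2 P) ω = _
  rw [h1, Pi.add_apply, h2, h6, corrIntegrand, h3]
  change _ * hX.vec t ω - _ + _ = _
  rw [h4]
  ring

theorem riemannSum_ae_eq (hX : IsInput P X f M) {H : ℝ → ℝ} (hH : MemLp H 2 volume) (τ : ℝ)
    {T : ℝ} (π : TaggedPartition 0 T) :
    ((∑ i : Fin π.n, (π.point i.succ - π.point i.castSucc)
        • hX.prodCurve (shift τ (hH.toLp H)) (π.tag i) : Lp ℝ 2 P) : Ω → ℝ)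
      =ᵐ[P] riemannSum (corrIntegrand P H X τ) π := by
  have h := coeFn_sum_smul (P := P) Finset.univ
    (fun i : Fin π.n => π.point i.succ - π.point i.castSucc)
    (fun i => hX.prodCurve (shift τ (hH.toLp H)) (π.tag i))
  have h2 : ∀ᵐ ω ∂P, ∀ i : Fin π.n, hX.prodCurve (shift τ (hH.toLp H)) (π.tag i) ω
      = corrIntegrand P H X τ (π.tag i) ω :=
    ae_all_iff.2 fun i => hX.prodCurve_ae_eq hH τ (π.tag i)
  filter_upwards [h, h2] with ω h1 h2
  rw [h1, riemannSum]
  exact Finset.sum_congr rfl fun i _ => by rw [h2]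

theorem isMSLim_msIntegral (hX : IsInput P X f M) {H : ℝ → ℝ} (hH : MemLp H 2 volume) (τ : ℝ)
    {T : ℝ} (hT : 0 ≤ T) :
    IsMSLim P (meshFilter 0 T) (riemannSum (corrIntegrand P H X τ))
      (msIntegral P (corrIntegrand P H X τ) 0 T) :=
  (isMSLim_of_tendsto (tendsto_riemannSum hT (hX.continuous_prodCurve (shift τ (hH.toLp H))))
    (Eventually.of_forall fun π => hX.riemannSum_ae_eq hH τ π)).msLim

theorem integral_centeredMul {S : Submodule ℝ (Lp ℝ 2 P)} (hS : IsGaussianSubspace S) (a b : S) :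
    ∫ ω, hS.centeredMul a b ω ∂P = 0 := by
  rw [integral_congr_ae (hS.coeFn_centeredMul a b), integral_sub
    ((hS.memLp_mul a b (p := 2) (by norm_num)).integrable (by norm_num)) (integrable_const _)]
  have : (inner ℝ a b : ℝ) = inner ℝ (a : Lp ℝ 2 P) (b : Lp ℝ 2 P) := rfl
  rw [this, inner_eq_integral_mul]
  simp

theorem integral_coeFn_quad (hX : IsInput P X f M) (T : ℝ) (h : Lp ℝ 2 (volume : Measure ℝ)) :
    ∫ ω, hX.quad T h ω ∂P = 0 := by
  have e1 : ∀ u : Lp ℝ 2 P, ∫ ω, u ω ∂P = inner ℝ (Lp.const 2 P (1:ℝ)) u := fun u => by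
    rw [inner_eq_integral_mul]
    refine integral_congr_ae ?_
    filter_upwards [Lp.coeFn_const (p := 2) (μ := P) (1:ℝ)] with ω hω
    rw [hω]; simp
  rw [e1, quad]
  have e2 := (innerSL ℝ (Lp.const 2 P (1:ℝ))).intervalIntegral_comp_comm
    ((hX.continuous_quad_integrand h).intervalIntegrable (μ := volume) 0 T)
  simp only [innerSL_apply_apply] at e2
  rw [← e2]
  simp only [← e1, integral_centeredMul, intervalIntegral.integral_zero]

/-- The constant m is the integrated mean of the product. Subtracting the expectation in
`normalized` removes it, so its value plays no role. -/
theorem msIntegral_ae_eq (hX : IsInput P X f M) {H : ℝ → ℝ} (hH : MemLp H 2 volume) (τ : ℝ)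
    {T : ℝ} (hT : 0 ≤ T) :
    ∃ m : ℝ, msIntegral P (corrIntegrand P H X τ) 0 T
      =ᵐ[P] fun ω => hX.quad T (shift τ (hH.toLp H)) ω + m := by
  have := meshFilter_neBot hT
  set h := shift τ (hH.toLp H) with hh
  refine ⟨∫ t in (0:ℝ)..T, inner ℝ (hX.output h t) (hX.input t), ?_⟩
  have h1 : msIntegral P (corrIntegrand P H X τ) 0 T
      =ᵐ[P] (∫ t in (0:ℝ)..T, hX.prodCurve h t : Lp ℝ 2 P) :=
    msLim_ae_eq (tendsto_riemannSum hT (hX.continuous_prodCurve h))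
      (Eventually.of_forall fun π => hX.riemannSum_ae_eq hH τ π)
  have h2 : ∫ t in (0:ℝ)..T, hX.prodCurve h t = hX.quad T h
      + Lp.constL 2 P ℝ (∫ t in (0:ℝ)..T, inner ℝ (hX.output h t) (hX.input t)) := by
    rw [← (Lp.constL 2 P ℝ).intervalIntegral_comp_comm
      ((hX.continuous_inner_output_input h).intervalIntegrable 0 T), quad]
    exact intervalIntegral.integral_add ((hX.continuous_quad_integrand h).intervalIntegrable 0 T)
      (((Lp.constL 2 P ℝ).continuous.comp
        (hX.continuous_inner_output_input h)).intervalIntegrable 0 T)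
  refine h1.trans ?_
  rw [h2]
  filter_upwards [Lp.coeFn_add (hX.quad T h)
    (Lp.constL 2 P ℝ (∫ t in (0:ℝ)..T, inner ℝ (hX.output h t) (hX.input t))),
    Lp.coeFn_const (p := 2) (μ := P)
      (∫ t in (0:ℝ)..T, inner ℝ (hX.output h t) (hX.input t))] with ω h3 h4
  rw [h3, Pi.add_apply]
  congr 1

/-- The normalized fluctuation of the correlogram for the impulse response `h`. -/
def fluct (hX : IsInput P X f M) (c T : ℝ) (h : Lp ℝ 2 (volume : Measure ℝ)) : Lp ℝ 2 P :=
  (√T * (1 / (c * T))) • hX.quad T h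

end IsInput

/-- The passage from the estimator to the Hilbert space: the lag survives only as a translation of
the impulse response. -/
theorem normalized_ae_eq [IsProbabilityMeasure P] {X : ℝ → ℝ → Ω → ℝ} {f : ℝ → ℝ} {M Δ : ℝ}
    (hX : IsInput P (X Δ) f M) {H : ℝ → ℝ} (hH : MemLp H 2 volume) (c τ : ℝ) {T : ℝ}
    (hT : 0 ≤ T) :
    normalized P H X c T Δ τ =ᵐ[P] hX.fluct c T (shift τ (hH.toLp H)) := by
  obtain ⟨m, hm⟩ := hX.msIntegral_ae_eq hH τ hT
  set h := shift τ (hH.toLp H) with hh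
  have hE : ∫ ω, estimator P H (X Δ) c T τ ω ∂P = 1 / (c * T) * m := by
    simp only [estimator]
    rw [integral_const_mul, integral_congr_ae hm, integral_add
      ((Lp.memLp _).integrable (by norm_num)) (integrable_const _), hX.integral_coeFn_quad]
    simp
  filter_upwards [hm, Lp.coeFn_smul (√T * (1 / (c * T))) (hX.quad T h)] with ω h1 h2
  rw [normalized, hE, estimator, h1, IsInput.fluct, h2, Pi.smul_apply, smul_eq_mul]
  ring

/-- `msLim` is square integrable in every case, being 0 when there is no limit. Measurability thus
holds for all T and Δ, as convergence in distribution demands of every member of the family. -/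
theorem aestronglyMeasurable_normalized [IsProbabilityMeasure P] {X : ℝ → ℝ → Ω → ℝ}
    (H : ℝ → ℝ) (c T Δ τ : ℝ) : AEStronglyMeasurable (normalized P H X c T Δ τ) P := by
  have h : AEStronglyMeasurable (msIntegral P (corrIntegrand P H (X Δ) τ) 0 T) P :=
    (memLp_msLim _ _).1
  exact ((h.const_mul _).sub aestronglyMeasurable_const).const_mul _

end

/-! ### The limit covariance as an inner product in L²(ℝ) -/

noncomputable section

/-- A real square integrable function as a complex one. -/
def toComplexLp : Lp ℝ 2 (volume : Measure ℝ) →L[ℝ] Lp ℂ 2 (volume : Measure ℝ) :=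
  Complex.ofRealCLM.compLpL 2 volume

theorem coeFn_toComplexLp (h : Lp ℝ 2 (volume : Measure ℝ)) :
    toComplexLp h =ᵐ[volume] fun s => (h s : ℂ) := Complex.ofRealCLM.coeFn_compLp h

theorem norm_toComplexLp (h : Lp ℝ 2 (volume : Measure ℝ)) : ‖toComplexLp h‖ = ‖h‖ := by
  have h1 : ‖toComplexLp h‖ ^ 2 = ‖h‖ ^ 2 := by
    rw [← integral_norm_sq_eq_norm_sq, ← integral_sq_eq_norm_sq]
    refine integral_congr_ae ?_
    filter_upwards [coeFn_toComplexLp h] with s hs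
    simp [hs]
  exact (sq_eq_sq₀ (norm_nonneg _) (norm_nonneg _)).1 h1

/-- The Plancherel transform of a real square integrable function. -/
def realFourier (h : Lp ℝ 2 (volume : Measure ℝ)) : Lp ℂ 2 (volume : Measure ℝ) :=
  𝓕 (toComplexLp h)

theorem realFourier_sub (g h : Lp ℝ 2 (volume : Measure ℝ)) :
    realFourier (g - h) = realFourier g - realFourier h := by
  rw [realFourier, map_sub]
  exact (Lp.fourierTransformₗᵢ ℝ ℂ).map_sub _ _

theorem norm_realFourier (h : Lp ℝ 2 (volume : Measure ℝ)) : ‖realFourier h‖ = ‖h‖ := by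
  rw [realFourier, Lp.norm_fourier_eq, norm_toComplexLp]

theorem integral_realFourier_mul_conj (g h : Lp ℝ 2 (volume : Measure ℝ)) :
    ∫ ξ, realFourier g ξ * (starRingEnd ℂ) (realFourier h ξ) = ((inner ℝ g h : ℝ) : ℂ) := by
  have h1 : inner ℂ (realFourier h) (realFourier g) = inner ℂ (toComplexLp h) (toComplexLp g) :=
    Lp.inner_fourier_eq _ _
  rw [L2.inner_def, L2.inner_def] at h1
  simp only [RCLike.inner_apply] at h1
  rw [h1, L2.inner_def, ← integral_complex_ofReal]
  refine integral_congr_ae ?_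
  filter_upwards [coeFn_toComplexLp g, coeFn_toComplexLp h] with s hg hh
  rw [hg, hh]
  simp [mul_comm]

theorem coeFn_realFourier {h : Lp ℝ 2 (volume : Measure ℝ)} (hi : Integrable h) :
    realFourier h =ᵐ[volume] 𝓕 (fun s => (h s : ℂ)) := by
  have h2 : MemLp (fun s => (h s : ℂ)) 2 volume := MemLp.ofReal (K := ℂ) (Lp.memLp h)
  have e : toComplexLp h = h2.toLp _ := by
    refine Lp.ext ((coeFn_toComplexLp h).trans h2.coeFn_toLp.symm)
  rw [realFourier, e]
  exact coeFn_fourier_toLp hi.ofReal h2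

theorem realFourier_apply {h : Lp ℝ 2 (volume : Measure ℝ)} (hi : Integrable h) :
    realFourier h =ᵐ[volume] fun ξ => fourierInt h (2 * Real.pi * ξ) := by
  filter_upwards [coeFn_realFourier hi] with ξ hξ
  rw [hξ, fourierInt_eq]
  field_simp

/-- An almost everywhere identity between Plancherel transforms extends from integrable to square
integrable functions. -/
theorem realFourier_ae_eq_of_integrable
    (A : Lp ℝ 2 (volume : Measure ℝ) →ₗᵢ[ℝ] Lp ℝ 2 (volume : Measure ℝ)) {Φ : ℝ → ℂ → ℂ}
    (hΦm : Measurable (Function.uncurry Φ)) (hΦ : ∀ ξ a b, ‖Φ ξ a - Φ ξ b‖ = ‖a - b‖)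
    (hA : ∀ h : Lp ℝ 2 (volume : Measure ℝ), Integrable h →
      realFourier (A h) =ᵐ[volume] fun ξ => Φ ξ (realFourier h ξ))
    (h : Lp ℝ 2 (volume : Measure ℝ)) :
    realFourier (A h) =ᵐ[volume] fun ξ => Φ ξ (realFourier h ξ) := by
  have hm : ∀ g : Lp ℝ 2 (volume : Measure ℝ),
      AEStronglyMeasurable (fun ξ => Φ ξ (realFourier g ξ)) volume := fun g =>
    (hΦm.comp_aemeasurable (aemeasurable_id.prodMk
      (Lp.aestronglyMeasurable (realFourier g)).aemeasurable)).aestronglyMeasurable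
  -- The discrepancy vanishes at g, and both sides of the identity depend isometrically on the
  -- argument, so its norm at h is at most twice the distance.
  have key : ∀ g : Lp ℝ 2 (volume : Measure ℝ), Integrable g →
      eLpNorm (fun ξ => realFourier (A h) ξ - Φ ξ (realFourier h ξ)) 2 volume
        ≤ ENNReal.ofReal (2 * ‖h - g‖) := by
    intro g hg
    have e1 : eLpNorm (fun ξ => realFourier (A h) ξ - realFourier (A g) ξ) 2 volume
        = ENNReal.ofReal ‖h - g‖ := by
      rw [← A.norm_map, map_sub, ← norm_realFourier, realFourier_sub, Lp.norm_def,
        ENNReal.ofReal_toReal (Lp.eLpNorm_ne_top _)]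
      exact eLpNorm_congr_ae (Lp.coeFn_sub _ _).symm
    have e2 : eLpNorm (fun ξ => Φ ξ (realFourier g ξ) - Φ ξ (realFourier h ξ)) 2 volume
        = ENNReal.ofReal ‖h - g‖ := by
      rw [norm_sub_rev, ← norm_realFourier, realFourier_sub, Lp.norm_def,
        ENNReal.ofReal_toReal (Lp.eLpNorm_ne_top _)]
      refine eLpNorm_congr_norm_ae ?_
      filter_upwards [Lp.coeFn_sub (realFourier g) (realFourier h)] with ξ hξ
      rw [hξ, Pi.sub_apply, hΦ]
    have e3 : (fun ξ => realFourier (A h) ξ - Φ ξ (realFourier h ξ)) =ᵐ[volume]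
        (fun ξ => realFourier (A h) ξ - realFourier (A g) ξ)
          + (fun ξ => Φ ξ (realFourier g ξ) - Φ ξ (realFourier h ξ)) := by
      filter_upwards [hA g hg] with ξ hξ
      simp only [Pi.add_apply, hξ]
      ring
    rw [eLpNorm_congr_ae e3]
    refine (eLpNorm_add_le ((Lp.aestronglyMeasurable _).sub (Lp.aestronglyMeasurable _))
      ((hm g).sub (hm h)) (by norm_num)).trans (le_of_eq ?_)
    refine (congrArg₂ (· + ·) e1 e2).trans ?_
    rw [← ENNReal.ofReal_add (norm_nonneg _) (norm_nonneg _)]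
    congr 1; ring
  have h0 : eLpNorm (fun ξ => realFourier (A h) ξ - Φ ξ (realFourier h ξ)) 2 volume = 0 := by
    refine le_antisymm ?_ bot_le
    refine ENNReal.le_of_forall_pos_le_add fun ε hε _ => ?_
    obtain ⟨g, hg⟩ := denseRange_integrableSubmodule.exists_dist_lt h
      (half_pos (NNReal.coe_pos.2 hε))
    refine (key g g.2).trans ?_
    rw [zero_add, ← ENNReal.ofReal_coe_nnreal]
    refine ENNReal.ofReal_le_ofReal ?_
    rw [dist_eq_norm] at hg
    have hg' : ‖h - (g : Lp ℝ 2 (volume : Measure ℝ))‖ < ε / 2 := hg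
    linarith
  have h1 := (eLpNorm_eq_zero_iff ((Lp.aestronglyMeasurable _).sub (hm h)) (by norm_num)).1 h0
  filter_upwards [h1] with ξ hξ
  simpa [sub_eq_zero] using hξ

theorem fourierInt_congr {g h : ℝ → ℝ} (e : g =ᵐ[volume] h) (lam : ℝ) :
    fourierInt g lam = fourierInt h lam := by
  refine integral_congr_ae ?_
  filter_upwards [e] with s hs
  rw [hs]

theorem realFourier_shift (τ : ℝ) (h : Lp ℝ 2 (volume : Measure ℝ)) :
    realFourier (shift τ h) =ᵐ[volume]
      fun ξ => Complex.exp (Complex.I * ((2 * Real.pi * τ * ξ : ℝ) : ℂ)) * realFourier h ξ := by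
  refine realFourier_ae_eq_of_integrable (shift τ)
    (Φ := fun ξ z => Complex.exp (Complex.I * ((2 * Real.pi * τ * ξ : ℝ) : ℂ)) * z)
    ?_ (fun ξ a b => ?_) (fun h hi => ?_) h
  · exact Continuous.measurable (by unfold Function.uncurry; fun_prop)
  · rw [← mul_sub, norm_mul, norm_exp_I_mul, one_mul]
  · have hi' : Integrable (shift τ h) := (hi.comp_add_right τ).congr (coeFn_shift τ h).symm
    filter_upwards [realFourier_apply hi, realFourier_apply hi'] with ξ h1 h2
    rw [h1, h2, fourierInt_congr (coeFn_shift τ h), fourierInt, fourierInt,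
      ← integral_sub_right_eq_self _ τ, ← integral_const_mul]
    refine integral_congr_ae (ae_of_all _ fun s => ?_)
    simp only [sub_add_cancel]
    rw [← mul_assoc, ← Complex.exp_add]
    congr 2; push_cast; ring

/-- For real h, reflection conjugates the transform. This turns the integral of the unconjugated
square in the limit covariance into an inner product with the reflected function. -/
theorem realFourier_reflect (h : Lp ℝ 2 (volume : Measure ℝ)) :
    realFourier (reflectAt 0 h) =ᵐ[volume] fun ξ => (starRingEnd ℂ) (realFourier h ξ) := by
  refine realFourier_ae_eq_of_integrable (reflectAt 0)
    (Φ := fun _ z => (starRingEnd ℂ) z) ?_ (fun ξ a b => ?_) (fun h hi => ?_) h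
  · exact Complex.continuous_conj.measurable.comp measurable_snd
  · rw [← map_sub, Complex.norm_conj]
  · filter_upwards [realFourier_apply hi,
      realFourier_apply (HasSpectralDensity.integrable_reflectAt hi 0)] with ξ h1 h2
    rw [h1, h2, HasSpectralDensity.fourierInt_reflectAt, fourierInt_neg]
    simp

theorem fourierPlancherel_eq {H : ℝ → ℝ} (hH : MemLp H 2 volume) (lam : ℝ) :
    fourierPlancherel H hH lam = realFourier (hH.toLp H) (lam / (2 * Real.pi)) := by
  rw [fourierPlancherel, realFourier]
  have e : (MemLp.ofReal (K := ℂ) hH).toLp (fun x : ℝ => (H x : ℂ)) = toComplexLp (hH.toLp H) := by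
    refine Lp.ext ?_
    filter_upwards [(MemLp.ofReal (K := ℂ) hH).coeFn_toLp, hH.coeFn_toLp,
      coeFn_toComplexLp (hH.toLp H)] with s h1 h2 h3
    rw [h3, h2]
    exact h1
  rw [e]

theorem integrable_realFourier_mul (g h : Lp ℝ 2 (volume : Measure ℝ)) :
    Integrable (fun ξ => realFourier g ξ * realFourier h ξ) :=
  (Lp.memLp _).integrable_mul (Lp.memLp _)

/-- The limit covariance in terms of the inner product of `L²(ℝ)`. -/
theorem limitCov_eq {H : ℝ → ℝ} (hH : MemLp H 2 volume) (s t : ℝ) :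
    limitCov H hH s t = ((inner ℝ (shift s (hH.toLp H)) (shift t (hH.toLp H))
      + inner ℝ (shift s (hH.toLp H)) (reflectAt 0 (shift t (hH.toLp H))) : ℝ) : ℂ) := by
  set h := hH.toLp H with hh
  have hpi : (0:ℝ) < 2 * Real.pi := by positivity
  have e0 : limitCov H hH s t = ∫ ξ,
      (Complex.exp (Complex.I * (((s - t) * (2 * Real.pi * ξ) : ℝ) : ℂ))
          * ((‖realFourier h ξ‖ ^ 2 : ℝ) : ℂ)
        + Complex.exp (Complex.I * (((s + t) * (2 * Real.pi * ξ) : ℝ) : ℂ))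
          * realFourier h ξ ^ 2) := by
    have := Measure.integral_comp_div (fun ξ : ℝ =>
      (Complex.exp (Complex.I * (((s - t) * (2 * Real.pi * ξ) : ℝ) : ℂ))
          * ((‖realFourier h ξ‖ ^ 2 : ℝ) : ℂ)
        + Complex.exp (Complex.I * (((s + t) * (2 * Real.pi * ξ) : ℝ) : ℂ))
          * realFourier h ξ ^ 2)) (2 * Real.pi)
    rw [abs_of_pos hpi] at this
    simp only [mul_div_cancel₀ _ hpi.ne'] at this
    rw [limitCov]
    simp only [fourierPlancherel_eq]
    rw [this, Complex.real_smul, ← mul_assoc]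
    have h2 : ((2 * Real.pi : ℝ) : ℂ) ≠ 0 := by exact_mod_cast hpi.ne'
    rw [one_div, inv_mul_cancel₀ h2, one_mul]
  have m1 : AEStronglyMeasurable (fun ξ : ℝ => realFourier h ξ) volume := Lp.aestronglyMeasurable _
  have i1 : Integrable (fun ξ => Complex.exp (Complex.I * (((s - t) * (2 * Real.pi * ξ) : ℝ) : ℂ))
      * ((‖realFourier h ξ‖ ^ 2 : ℝ) : ℂ)) :=
    integrable_exp_mul (((Lp.memLp (realFourier h)).integrable_norm_pow (by norm_num)).ofReal)
      (by fun_prop)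
  have i2 : Integrable (fun ξ => Complex.exp (Complex.I * (((s + t) * (2 * Real.pi * ξ) : ℝ) : ℂ))
      * realFourier h ξ ^ 2) := by
    refine integrable_exp_mul ?_ (by fun_prop)
    simp only [sq]
    exact integrable_realFourier_mul h h
  rw [e0, integral_add i1 i2, Complex.ofReal_add, ← integral_realFourier_mul_conj,
    ← integral_realFourier_mul_conj]
  congr 1
  · refine integral_congr_ae ?_
    filter_upwards [realFourier_shift s h, realFourier_shift t h] with ξ h1 h2
    rw [h1, h2, map_mul, ← Complex.exp_conj, ← Complex.normSq_eq_norm_sq, ← Complex.mul_conj]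
    have : Complex.exp (Complex.I * (((s - t) * (2 * Real.pi * ξ) : ℝ) : ℂ))
        = Complex.exp (Complex.I * ((2 * Real.pi * s * ξ : ℝ) : ℂ))
          * Complex.exp ((starRingEnd ℂ) (Complex.I * ((2 * Real.pi * t * ξ : ℝ) : ℂ))) := by
      rw [← Complex.exp_add]
      congr 1
      simp only [map_mul, Complex.conj_I, Complex.conj_ofReal]
      push_cast; ring
    rw [this]; ring
  · refine integral_congr_ae ?_
    filter_upwards [realFourier_shift s h, realFourier_shift t h,
      realFourier_reflect (shift t h)] with ξ h1 h2 h3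
    rw [h1, h3, h2, Complex.conj_conj]
    have : Complex.exp (Complex.I * (((s + t) * (2 * Real.pi * ξ) : ℝ) : ℂ))
        = Complex.exp (Complex.I * ((2 * Real.pi * s * ξ : ℝ) : ℂ))
          * Complex.exp (Complex.I * ((2 * Real.pi * t * ξ : ℝ) : ℂ)) := by
      rw [← Complex.exp_add]; congr 1; push_cast; ring
    rw [this]; ring

/-- The limit variance for the impulse response `h`. -/
def limitVar (h : Lp ℝ 2 (volume : Measure ℝ)) : ℝ := ‖h‖ ^ 2 + inner ℝ h (reflectAt 0 h)

theorem continuous_limitVar : Continuous limitVar := by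
  have h1 : Continuous fun h : Lp ℝ 2 (volume : Measure ℝ) => reflectAt 0 h :=
    (reflectAt 0).continuous
  unfold limitVar
  fun_prop

/-- The limit variance in terms of the Fourier integral of an integrable function. -/
theorem limitVar_eq {h : Lp ℝ 2 (volume : Measure ℝ)} (hi : Integrable h) :
    2 * Real.pi * ((limitVar h : ℝ) : ℂ)
      = (∫ lam, ((‖fourierInt h lam‖ ^ 2 : ℝ) : ℂ)) + ∫ lam, fourierInt h lam ^ 2 := by
  have hpi : (0:ℝ) < 2 * Real.pi := by positivity
  rw [integral_complex_ofReal, (plancherel hi (Lp.memLp h)).2, integral_sq_eq_norm_sq, limitVar]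
  have e := Measure.integral_comp_mul_left (fun lam => fourierInt h lam ^ 2) (2 * Real.pi)
  have e2 : ∫ ξ, fourierInt h (2 * Real.pi * ξ) ^ 2 = ((inner ℝ h (reflectAt 0 h) : ℝ) : ℂ) := by
    rw [← integral_realFourier_mul_conj]
    refine integral_congr_ae ?_
    filter_upwards [realFourier_apply hi, realFourier_reflect h] with ξ h1 h2
    rw [h2, Complex.conj_conj, h1, sq]
  rw [e2, abs_of_pos (inv_pos.2 hpi), Complex.real_smul] at e
  have h2 : ((2 * Real.pi : ℝ) : ℂ) ≠ 0 := by exact_mod_cast hpi.ne'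
  have e3 : ∫ lam, fourierInt h lam ^ 2
      = ((2 * Real.pi : ℝ) : ℂ) * ((inner ℝ h (reflectAt 0 h) : ℝ) : ℂ) := by
    rw [e, ← mul_assoc, Complex.ofReal_inv, mul_inv_cancel₀ h2, one_mul]
  rw [e3]
  push_cast
  ring

end

/-! ### Variance of the fluctuations and distance from a Gaussian law -/

noncomputable section

variable {Ω : Type*} [MeasurableSpace Ω] {P : Measure Ω} [IsProbabilityMeasure P]

namespace IsInput

variable {X : ℝ → Ω → ℝ} {f : ℝ → ℝ} {M : ℝ}

theorem output_add (hX : IsInput P X f M) (g h : Lp ℝ 2 (volume : Measure ℝ)) (t : ℝ) :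
    hX.output (g + h) t = hX.output g t + hX.output h t := by
  refine Subtype.ext ?_
  change hX.hasSpectralDensity.stochInt (reflectAt t (g + h)) = _
  rw [map_add, map_add]
  rfl

theorem output_smul (hX : IsInput P X f M) (r : ℝ) (h : Lp ℝ 2 (volume : Measure ℝ)) (t : ℝ) :
    hX.output (r • h) t = r • hX.output h t := by
  refine Subtype.ext ?_
  change hX.hasSpectralDensity.stochInt (reflectAt t (r • h)) = _
  rw [map_smul, map_smul]
  rfl

theorem quad_add (hX : IsInput P X f M) (T : ℝ) (g h : Lp ℝ 2 (volume : Measure ℝ)) :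
    hX.quad T (g + h) = hX.quad T g + hX.quad T h := by
  rw [quad, quad, quad, ← intervalIntegral.integral_add
    ((hX.continuous_quad_integrand g).intervalIntegrable 0 T)
    ((hX.continuous_quad_integrand h).intervalIntegrable 0 T)]
  refine intervalIntegral.integral_congr fun t _ => ?_
  simp only [hX.output_add]
  change hX.isGaussianSubspace.centeredMulCLM (_ + _) _ = _
  rw [map_add]
  rfl

theorem quad_smul (hX : IsInput P X f M) (T r : ℝ) (h : Lp ℝ 2 (volume : Measure ℝ)) :
    hX.quad T (r • h) = r • hX.quad T h := by
  rw [quad, quad, ← intervalIntegral.integral_smul]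
  refine intervalIntegral.integral_congr fun t _ => ?_
  simp only [hX.output_smul]
  change hX.isGaussianSubspace.centeredMulCLM (r • _) _ = _
  rw [map_smul]
  rfl

/-- A crude bound that grows with T. It serves only to make the fluctuation a continuous linear map;
the uniform bound is `norm_fluct_le`. -/
theorem norm_quad_le (hX : IsInput P X f M) (T : ℝ) (h : Lp ℝ 2 (volume : Measure ℝ)) :
    ‖hX.quad T h‖ ≤ (2 * √(2 * Real.pi * M) * √(∫ lam, f lam) * |T|) * ‖h‖ := by
  rw [quad]
  refine (intervalIntegral.norm_integral_le_of_norm_le_const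
    (C := 2 * (√(2 * Real.pi * M) * ‖h‖) * √(∫ lam, f lam)) fun t _ => ?_).trans (le_of_eq ?_)
  · refine (hX.isGaussianSubspace.norm_centeredMul_le _ _).trans ?_
    have h1 : ‖hX.output h t‖ ≤ √(2 * Real.pi * M) * ‖h‖ :=
      hX.hasSpectralDensity.norm_filtered_le hX.le h t
    have h2 : ‖hX.input t‖ ≤ √(∫ lam, f lam) := hX.hasSpectralDensity.norm_le t
    gcongr
  · rw [sub_zero]; ring

/-- The fluctuation as a continuous linear map of the impulse response. -/
def fluctCLM (hX : IsInput P X f M) (c T : ℝ) :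
    Lp ℝ 2 (volume : Measure ℝ) →L[ℝ] Lp ℝ 2 P :=
  (√T * (1 / (c * T))) • LinearMap.mkContinuous
    { toFun := hX.quad T
      map_add' := hX.quad_add T
      map_smul' := hX.quad_smul T } _ (hX.norm_quad_le T)

theorem fluctCLM_apply (hX : IsInput P X f M) (c T : ℝ) (h : Lp ℝ 2 (volume : Measure ℝ)) :
    hX.fluctCLM c T h = hX.fluct c T h := rfl

theorem inner_quad_quad (hX : IsInput P X f M) (T : ℝ) (h : Lp ℝ 2 (volume : Measure ℝ)) :
    ‖hX.quad T h‖ ^ 2 = ∫ t in (0:ℝ)..T, ∫ s in (0:ℝ)..T,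
      (inner ℝ (hX.output h t) (hX.output h s) * inner ℝ (hX.input t) (hX.input s)
        + inner ℝ (hX.output h t) (hX.input s) * inner ℝ (hX.input t) (hX.output h s)) := by
  have hc := hX.continuous_quad_integrand h
  rw [← real_inner_self_eq_norm_sq]
  have e1 : ∀ v : Lp ℝ 2 P, inner ℝ v (hX.quad T h) = ∫ s in (0:ℝ)..T,
      inner ℝ v (hX.isGaussianSubspace.centeredMul (hX.output h s) (hX.input s)) := by
    intro v
    have := (innerSL ℝ v).intervalIntegral_comp_comm
      (hc.intervalIntegrable (μ := volume) 0 T)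
    simp only [innerSL_apply_apply] at this
    exact this.symm
  rw [e1]
  refine intervalIntegral.integral_congr fun t _ => ?_
  rw [real_inner_comm, e1]
  refine intervalIntegral.integral_congr fun s _ => ?_
  rw [hX.isGaussianSubspace.inner_centeredMul]

/-- The two pairings left by centering: response covariance times input covariance, and the product
of the two cross-covariances. In this form the Fejér averages apply to both. -/
theorem norm_sq_fluct (hX : IsInput P X f M) {c T : ℝ} (hc : 0 < c) (hT : 0 < T)
    {h : Lp ℝ 2 (volume : Measure ℝ)} (hi : Integrable h) :
    ((‖hX.fluct c T h‖ ^ 2 : ℝ) : ℂ) = ((1 / c ^ 2 : ℝ) : ℂ) *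
      (((1 / T : ℝ) : ℂ) * (∫ t in (0:ℝ)..T, ∫ s in (0:ℝ)..T,
          spectralInt (fun lam => ((‖fourierInt h lam‖ ^ 2 : ℝ) : ℂ) * (f lam : ℂ)) (t - s)
            * spectralInt (fun lam => 1 * (f lam : ℂ)) (s - t))
        + ((1 / T : ℝ) : ℂ) * (∫ t in (0:ℝ)..T, ∫ s in (0:ℝ)..T,
          spectralInt (fun lam => fourierInt h lam * (f lam : ℂ)) (t - s)
            * spectralInt (fun lam => fourierInt h lam * (f lam : ℂ)) (s - t))) := by
  have hx := hX.hasSpectralDensity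
  have hfi : Integrable (fun lam => (f lam : ℂ)) := hX.integrable.ofReal
  have hm := continuous_fourierInt hi
  have c1 : Continuous (spectralInt
      (fun lam => ((‖fourierInt h lam‖ ^ 2 : ℝ) : ℂ) * (f lam : ℂ))) :=
    continuous_spectralInt (by
      have := (hx.filtered_hasSpectralDensity hX.le hi).integrable.ofReal (𝕜 := ℂ)
      refine this.congr (ae_of_all _ fun lam => ?_)
      simp)
  have c2 : Continuous (spectralInt (fun lam => 1 * (f lam : ℂ))) := by
    simp only [one_mul]
    exact continuous_spectralInt hfi
  have c3 : Continuous (spectralInt (fun lam => fourierInt h lam * (f lam : ℂ))) :=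
    continuous_spectralInt (hfi.bdd_mul hm.aestronglyMeasurable
      (ae_of_all _ fun lam => norm_fourierInt_le h lam))
  have e1 : ‖hX.fluct c T h‖ ^ 2 = 1 / c ^ 2 * (1 / T * ‖hX.quad T h‖ ^ 2) := by
    rw [fluct, norm_smul, mul_pow, Real.norm_eq_abs, sq_abs, mul_pow, Real.sq_sqrt hT.le]
    field_simp
  have e2 : ((‖hX.quad T h‖ ^ 2 : ℝ) : ℂ) = (∫ t in (0:ℝ)..T, ∫ s in (0:ℝ)..T,
          spectralInt (fun lam => ((‖fourierInt h lam‖ ^ 2 : ℝ) : ℂ) * (f lam : ℂ)) (t - s)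
            * spectralInt (fun lam => 1 * (f lam : ℂ)) (s - t))
        + (∫ t in (0:ℝ)..T, ∫ s in (0:ℝ)..T,
          spectralInt (fun lam => fourierInt h lam * (f lam : ℂ)) (t - s)
            * spectralInt (fun lam => fourierInt h lam * (f lam : ℂ)) (s - t)) := by
    rw [hX.inner_quad_quad, ← intervalIntegral.integral_ofReal, ← intervalIntegral.integral_add]
    · refine intervalIntegral.integral_congr fun t _ => ?_
      rw [← intervalIntegral.integral_ofReal, ← intervalIntegral.integral_add]
      · refine intervalIntegral.integral_congr fun s _ => ?_
        simp only [Complex.ofReal_add, Complex.ofReal_mul, one_mul]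
        have a1 : ((inner ℝ (hX.output h t) (hX.output h s) : ℝ) : ℂ) = _ :=
          hx.inner_filtered_filtered hX.le hi s t
        have a2 : ((inner ℝ (hX.input t) (hX.input s) : ℝ) : ℂ) = spectralCov f (s - t) := by
          rw [real_inner_comm]
          exact hx.inner_eq s t
        have a3 : ((inner ℝ (hX.output h t) (hX.input s) : ℝ) : ℂ) = _ :=
          hx.inner_filtered_left hX.le hi s t
        have a4 : ((inner ℝ (hX.input t) (hX.output h s) : ℝ) : ℂ)
            = spectralInt (fun lam => fourierInt h lam * (f lam : ℂ)) (s - t) := by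
          rw [real_inner_comm]
          exact hx.inner_filtered_left hX.le hi t s
        rw [a1, a2, a3, a4, spectralCov_eq_spectralInt]
      · exact Continuous.intervalIntegrable (by fun_prop) _ _
      · exact Continuous.intervalIntegrable (by fun_prop) _ _
    · refine Continuous.intervalIntegrable ?_ _ _
      exact intervalIntegral.continuous_parametric_intervalIntegral_of_continuous' (by fun_prop) _ _
    · refine Continuous.intervalIntegrable ?_ _ _
      exact intervalIntegral.continuous_parametric_intervalIntegral_of_continuous' (by fun_prop) _ _
  rw [e1, Complex.ofReal_mul, Complex.ofReal_mul, e2, mul_add]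

/-- Each of the two terms of `norm_sq_fluct` contributes 4π²M²‖h‖²: the first by the L¹–L^∞ bound,
the second by the L²–L² bound. -/
theorem norm_fluct_le_of_integrable (hX : IsInput P X f M) {c T : ℝ} (hc : 0 < c) (hT : 0 < T)
    {h : Lp ℝ 2 (volume : Measure ℝ)} (hi : Integrable h) :
    ‖hX.fluct c T h‖ ≤ √(8 * Real.pi ^ 2 * M ^ 2 / c ^ 2) * ‖h‖ := by
  have hx := hX.hasSpectralDensity
  have hM0 : 0 ≤ M := (hX.nonneg 0).trans (hX.le 0)
  have hfi : Integrable (fun lam => (f lam : ℂ)) := hX.integrable.ofReal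
  have hm := continuous_fourierInt hi
  have hfc := hX.continuous
  have hfn : ∀ lam, ‖(f lam : ℂ)‖ ≤ M := fun lam => by
    rw [Complex.norm_real, Real.norm_of_nonneg (hX.nonneg lam)]; exact hX.le lam
  obtain ⟨hpi, hpv⟩ := plancherel hi (Lp.memLp h)
  rw [integral_sq_eq_norm_sq] at hpv
  have i1 : Integrable (fun lam => ((‖fourierInt h lam‖ ^ 2 : ℝ) : ℂ) * (f lam : ℂ)) := by
    have := (hx.filtered_hasSpectralDensity hX.le hi).integrable.ofReal (𝕜 := ℂ)
    refine this.congr (ae_of_all _ fun lam => ?_)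
    simp
  have i3 : Integrable (fun lam => fourierInt h lam * (f lam : ℂ)) :=
    hfi.bdd_mul hm.aestronglyMeasurable (ae_of_all _ fun lam => norm_fourierInt_le h lam)
  have b1 := norm_average_spectralInt_mul_le i1 (b := fun lam => 1 * (f lam : ℂ))
    (by simpa using hfi) (by fun_prop) (B := M) (by simpa using hfn) hT
  have v1 : ∫ lam, ‖((‖fourierInt h lam‖ ^ 2 : ℝ) : ℂ) * (f lam : ℂ)‖
      ≤ M * (2 * Real.pi * ‖h‖ ^ 2) := by
    rw [← hpv, ← integral_const_mul]
    refine integral_mono_of_nonneg (ae_of_all _ fun lam => norm_nonneg _) (hpi.const_mul M)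
      (ae_of_all _ fun lam => ?_)
    simp only
    rw [norm_mul, Complex.norm_real, Real.norm_of_nonneg (sq_nonneg _), mul_comm]
    exact mul_le_mul_of_nonneg_right (hfn lam) (sq_nonneg _)
  have hsq : ∀ lam, ‖fourierInt h lam * (f lam : ℂ)‖ ^ 2 ≤ M ^ 2 * ‖fourierInt h lam‖ ^ 2 := by
    intro lam
    rw [norm_mul, mul_pow, mul_comm]
    exact mul_le_mul_of_nonneg_right (pow_le_pow_left₀ (norm_nonneg _) (hfn lam) 2) (sq_nonneg _)
  have i4 : Integrable (fun lam => ‖fourierInt h lam * (f lam : ℂ)‖ ^ 2) := by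
    refine (hpi.const_mul (M ^ 2)).mono'
      (Continuous.aestronglyMeasurable (by fun_prop)) (ae_of_all _ fun lam => ?_)
    rw [Real.norm_of_nonneg (sq_nonneg _)]
    exact hsq lam
  have v2 : ∫ lam, ‖fourierInt h lam * (f lam : ℂ)‖ ^ 2 ≤ M ^ 2 * (2 * Real.pi * ‖h‖ ^ 2) := by
    rw [← hpv, ← integral_const_mul]
    exact integral_mono i4 (hpi.const_mul _) hsq
  have b2 := norm_average_spectralInt_mul_le' i3 i3 (by fun_prop)
    (B := (∫ x, ‖h x‖) * M) (fun x => by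
      rw [norm_mul]
      exact mul_le_mul (norm_fourierInt_le h x) (hfn x) (norm_nonneg _)
        (integral_nonneg fun _ => norm_nonneg _)) i4 i4 hT
  have h0 : ‖hX.fluct c T h‖ ^ 2 ≤ 8 * Real.pi ^ 2 * M ^ 2 / c ^ 2 * ‖h‖ ^ 2 := by
    have e := congrArg norm (hX.norm_sq_fluct hc hT hi)
    rw [Complex.norm_real, Real.norm_of_nonneg (sq_nonneg _)] at e
    rw [e, norm_mul, Complex.norm_real, Real.norm_of_nonneg (by positivity)]
    have hle := (norm_add_le _ _).trans (add_le_add b1 b2)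
    have hp : 0 ≤ 2 * Real.pi * M := by positivity
    have h1 := mul_le_mul_of_nonneg_left v1 hp
    have h2 := mul_le_mul_of_nonneg_left (add_le_add v2 v2) Real.pi_pos.le
    have h3 := mul_le_mul_of_nonneg_left (hle.trans (add_le_add h1 h2))
      (by positivity : (0:ℝ) ≤ 1 / c ^ 2)
    refine h3.trans (le_of_eq ?_)
    field_simp
    ring
  have h1 := Real.sqrt_le_sqrt h0
  rwa [Real.sqrt_sq (norm_nonneg _), Real.sqrt_mul (by positivity),
    Real.sqrt_sq (norm_nonneg _)] at h1

/-- By density of the integrable functions. The constant depends neither on T nor on the input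
process beyond M, which makes all later approximations of h uniform in (T, Δ). -/
theorem norm_fluct_le (hX : IsInput P X f M) {c T : ℝ} (hc : 0 < c) (hT : 0 < T)
    (h : Lp ℝ 2 (volume : Measure ℝ)) :
    ‖hX.fluct c T h‖ ≤ √(8 * Real.pi ^ 2 * M ^ 2 / c ^ 2) * ‖h‖ := by
  refine denseRange_integrableSubmodule.induction_on
    (p := fun h => ‖hX.fluctCLM c T h‖ ≤ √(8 * Real.pi ^ 2 * M ^ 2 / c ^ 2) * ‖h‖) h
    (isClosed_le (by fun_prop) (by fun_prop)) fun g => ?_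
  exact hX.norm_fluct_le_of_integrable hc hT g.2

theorem fluct_eq_integral (hX : IsInput P X f M) (c T r : ℝ) (h : Lp ℝ 2 (volume : Measure ℝ)) :
    r • hX.fluct c T h = ∫ t in (0:ℝ)..T, hX.isGaussianSubspace.centeredMul
      (((r * (√T * (1 / (c * T)))) • hX.output h) t) (hX.input t) := by
  rw [fluct, quad, smul_smul, ← intervalIntegral.integral_smul]
  refine intervalIntegral.integral_congr fun t _ => ?_
  simp only [Pi.smul_apply]
  change _ = hX.isGaussianSubspace.centeredMulCLM (_ • _) _
  rw [map_smul]
  rfl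

/-- Comparison of the law of the fluctuation with the Gaussian one. -/
theorem norm_charInt_fluct_sub_le (hX : IsInput P X f M) {c T : ℝ} (hc : 0 < c) (hT : 0 < T)
    {h : Lp ℝ 2 (volume : Measure ℝ)} (hi : Integrable h) {ρ : ℝ} (hρ1 : ρ ≤ 1)
    (hρ : ρ = √T * (1 / (c * T)) * (Real.pi * M * ((∫ x, ‖h x‖) ^ 2 + 1))) :
    ‖charInt P (hX.fluct c T h) - Complex.exp (-((‖hX.fluct c T h‖ ^ 2 / 2 : ℝ) : ℂ))‖
      ≤ chiSqConst * ρ * ‖hX.fluct c T h‖ ^ 2 := by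
  set κ := √T * (1 / (c * T)) with hκ
  have hκ0 : 0 ≤ κ := by positivity
  have hM0 : 0 ≤ M := (hX.nonneg 0).trans (hX.le 0)
  have hQ := hX.fluct_eq_integral c T 1 h
  rw [one_smul, one_mul, ← hκ] at hQ
  refine hX.isGaussianSubspace.norm_charInt_integral_sub_le
    ((hX.continuous_output h).const_smul κ) hX.continuous_input hT.le hρ1 (fun φ => ?_) hQ
  have hx := hX.hasSpectralDensity
  have hy := hx.filtered_hasSpectralDensity hX.le hi
  have bx := hx.integral_inner_sq_le hX.le hT.le (φ : Lp ℝ 2 P)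
  have by' := hy.integral_inner_sq_le (M := (∫ x, ‖h x‖) ^ 2 * M) (fun lam =>
    mul_le_mul (pow_le_pow_left₀ (norm_nonneg _) (norm_fourierInt_le _ _) 2) (hX.le lam)
      (hX.nonneg lam) (sq_nonneg _)) hT.le (φ : Lp ℝ 2 P)
  have cx : Continuous fun t => inner ℝ (hX.input t) φ := hX.continuous_input.inner continuous_const
  have cy : Continuous fun t => inner ℝ (hX.output h t) φ :=
    (hX.continuous_output h).inner continuous_const
  have hsm : ∀ t, inner ℝ ((κ • hX.output h) t) φ * inner ℝ (hX.input t) φ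
      = κ * (inner ℝ (hX.output h t) φ * inner ℝ (hX.input t) φ) := by
    intro t
    have : inner ℝ ((κ • hX.output h) t) φ = κ * inner ℝ (hX.output h t) φ :=
      real_inner_smul_left ((hX.output h t : hX.space) : Lp ℝ 2 P) (φ : Lp ℝ 2 P) κ
    rw [this, mul_assoc]
  simp_rw [hsm]
  rw [intervalIntegral.integral_const_mul, abs_mul, abs_of_nonneg hκ0, hρ,
    mul_assoc κ (Real.pi * M * _) (‖φ‖ ^ 2)]
  refine mul_le_mul_of_nonneg_left ?_ hκ0
  have sx : Continuous fun t => (inner ℝ (hX.input t) φ : ℝ) ^ 2 := cx.pow 2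
  have sy : Continuous fun t => (inner ℝ (hX.output h t) φ : ℝ) ^ 2 := cy.pow 2
  -- From 2|yx| ≤ y² + x² and the Bessel inequality for both curves, with density bounds (∫|h|)² M
  -- for the response and M for the input. Integrability of h is essential here, since the transform
  -- of a general L² function is unbounded.
  have i1 : ∫ t in (0:ℝ)..T, (inner ℝ (hX.output h t) φ ^ 2 + inner ℝ (hX.input t) φ ^ 2) / 2
      ≤ Real.pi * M * ((∫ x, ‖h x‖) ^ 2 + 1) * ‖φ‖ ^ 2 := by
    rw [intervalIntegral.integral_div, intervalIntegral.integral_add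
      (sy.intervalIntegrable _ _) (sx.intervalIntegrable _ _)]
    have bx' : ∫ t in (0:ℝ)..T, inner ℝ (hX.input t) φ ^ 2 ≤ 2 * Real.pi * M * ‖φ‖ ^ 2 := bx
    have by'' : ∫ t in (0:ℝ)..T, inner ℝ (hX.output h t) φ ^ 2
        ≤ 2 * Real.pi * ((∫ x, ‖h x‖) ^ 2 * M) * ‖φ‖ ^ 2 := by'
    linarith
  refine le_trans ?_ i1
  refine (intervalIntegral.abs_integral_le_integral_abs hT.le).trans ?_
  refine intervalIntegral.integral_mono_on hT.le ((cy.mul cx).abs.intervalIntegrable _ _)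
    (((sy.add sx).div_const 2).intervalIntegrable _ _) fun t _ => ?_
  rw [abs_le]
  constructor <;> nlinarith [sq_nonneg (inner ℝ (hX.output h t) φ - inner ℝ (hX.input t) φ),
    sq_nonneg (inner ℝ (hX.output h t) φ + inner ℝ (hX.input t) φ)]

end IsInput

end

/-! ### Uniform moment bounds -/

noncomputable section

variable {Ω : Type*} [MeasurableSpace Ω] {P : Measure Ω} [IsProbabilityMeasure P]

theorem abs_pow_le_exp {θ : ℝ} (hθ : 0 < θ) (n : ℕ) (x : ℝ) :
    |x| ^ n ≤ n.factorial / θ ^ n * (Real.exp (θ * x) + Real.exp (-θ * x)) := by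
  have h1 := Real.pow_div_factorial_le_exp (θ * |x|) (by positivity) n
  have h2 : Real.exp (θ * |x|) ≤ Real.exp (θ * x) + Real.exp (-θ * x) := by
    rcases abs_cases x with ⟨h, _⟩ | ⟨h, _⟩
    · rw [h]; linarith [Real.exp_pos (-θ * x)]
    · rw [h, show θ * -x = -θ * x by ring]; linarith [Real.exp_pos (θ * x)]
  have h3 := h1.trans h2
  rw [mul_pow, div_le_iff₀ (by positivity)] at h3
  rw [div_mul_eq_mul_div, le_div_iff₀ (by positivity)]
  linarith

/-- All moments of the fluctuations are bounded uniformly in the input process and in `T`. -/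
theorem exists_moment_bound (P : Measure Ω) [IsProbabilityMeasure P] (M : ℝ) {c : ℝ} (hc : 0 < c)
    (h : Lp ℝ 2 (volume : Measure ℝ)) (n : ℕ) :
    ∃ C : ℝ, ∀ (X : ℝ → Ω → ℝ) (f : ℝ → ℝ) (hX : IsInput P X f M) (T : ℝ), 0 < T →
      Integrable (fun ω => |hX.fluct c T h ω| ^ n) P
        ∧ ∫ ω, |hX.fluct c T h ω| ^ n ∂P ≤ C := by
  set K := √(8 * Real.pi ^ 2 * M ^ 2 / c ^ 2) * ‖h‖ with hK
  have hK0 : 0 ≤ K := by positivity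
  -- With this θ the variable θ · fluct has norm at most θK ≤ 1/4, hence squared norm at most 1/16 <
  -- 1/8, the range of the exponential bound. The value e^{1/4} below is e^{2 · 1/8}.
  set θ : ℝ := 1 / (4 * (K + 1)) with hθ
  have hθ0 : 0 < θ := by positivity
  have hθK : (θ * K) ^ 2 < 1 / 8 := by
    have h1 : θ * K ≤ 1 / 4 := by
      rw [hθ, one_div_mul_eq_div, div_le_div_iff₀ (by positivity) (by norm_num)]
      linarith
    have h0 : 0 ≤ θ * K := by positivity
    nlinarith
  refine ⟨n.factorial / θ ^ n * (2 * Real.exp (1 / 4)), fun X f hX T hT => ?_⟩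
  set Q := hX.fluct c T h with hQ
  have hexp : ∀ r : ℝ, |r| = θ →
      ∫⁻ ω, ENNReal.ofReal (Real.exp (r * Q ω)) ∂P ≤ ENNReal.ofReal (Real.exp (1 / 4)) := by
    intro r hr
    have hn : ‖r • Q‖ ^ 2 < 1 / 8 := by
      refine lt_of_le_of_lt ?_ hθK
      rw [norm_smul, Real.norm_eq_abs, hr]
      exact pow_le_pow_left₀ (by positivity)
        (mul_le_mul_of_nonneg_left (hX.norm_fluct_le hc hT h) hθ0.le) 2
    have h1 := hX.isGaussianSubspace.lintegral_exp_integral_le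
      ((hX.continuous_output h).const_smul (r * (√T * (1 / (c * T))))) hX.continuous_input hT.le
      (hX.fluct_eq_integral c T r h) hn
    calc ∫⁻ ω, ENNReal.ofReal (Real.exp (r * Q ω)) ∂P
        = ∫⁻ ω, ENNReal.ofReal (Real.exp ((r • Q : Lp ℝ 2 P) ω)) ∂P := by
          refine lintegral_congr_ae ?_
          filter_upwards [Lp.coeFn_smul r Q] with ω hω
          rw [hω, Pi.smul_apply, smul_eq_mul]
      _ ≤ _ := h1
      _ ≤ _ := by
          refine ENNReal.ofReal_le_ofReal (Real.exp_le_exp.2 ?_)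
          linarith
  have hb : ∫⁻ ω, ENNReal.ofReal (|Q ω| ^ n) ∂P
      ≤ ENNReal.ofReal (n.factorial / θ ^ n * (2 * Real.exp (1 / 4))) := by
    have hm : AEMeasurable (fun ω => ENNReal.ofReal (Real.exp (θ * Q ω))) P := by
      have := (Lp.aestronglyMeasurable Q).aemeasurable
      fun_prop
    calc ∫⁻ ω, ENNReal.ofReal (|Q ω| ^ n) ∂P
        ≤ ∫⁻ ω, ENNReal.ofReal (n.factorial / θ ^ n)
            * (ENNReal.ofReal (Real.exp (θ * Q ω)) + ENNReal.ofReal (Real.exp (-θ * Q ω))) ∂P := by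
          refine lintegral_mono fun ω => ?_
          simp only
          rw [← ENNReal.ofReal_add (Real.exp_pos _).le (Real.exp_pos _).le,
            ← ENNReal.ofReal_mul (by positivity)]
          exact ENNReal.ofReal_le_ofReal (abs_pow_le_exp hθ0 n (Q ω))
      _ = ENNReal.ofReal (n.factorial / θ ^ n)
            * (∫⁻ ω, ENNReal.ofReal (Real.exp (θ * Q ω)) ∂P
              + ∫⁻ ω, ENNReal.ofReal (Real.exp (-θ * Q ω)) ∂P) := by
          rw [lintegral_const_mul' _ _ ENNReal.ofReal_ne_top, lintegral_add_left' hm]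
      _ ≤ ENNReal.ofReal (n.factorial / θ ^ n)
            * (ENNReal.ofReal (Real.exp (1 / 4)) + ENNReal.ofReal (Real.exp (1 / 4))) := by
          gcongr
          · exact hexp θ (abs_of_pos hθ0)
          · exact hexp (-θ) (by rw [abs_neg, abs_of_pos hθ0])
      _ = _ := by
          rw [← ENNReal.ofReal_add (Real.exp_pos _).le (Real.exp_pos _).le,
            ← ENNReal.ofReal_mul (by positivity)]
          congr 2; ring
  have hmeas : AEStronglyMeasurable (fun ω => |Q ω| ^ n) P :=
    ((Lp.aestronglyMeasurable Q).norm).pow n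
  constructor
  · refine ⟨hmeas, ?_⟩
    rw [hasFiniteIntegral_iff_ofReal (ae_of_all _ fun ω => by positivity)]
    exact hb.trans_lt ENNReal.ofReal_lt_top
  · rw [integral_eq_lintegral_of_nonneg_ae (ae_of_all _ fun ω => by positivity) hmeas]
    exact ENNReal.toReal_le_of_le_ofReal (by positivity) hb

/-! ### Convergence of the characteristic functions of the fluctuations -/

section Family

variable {X : ℝ → ℝ → Ω → ℝ} {f : ℝ → ℝ → ℝ} {M c : ℝ}

open Classical in
/-- The fluctuations of the family of input processes, indexed by `(T, Δ)`. -/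
def fluctFamily (hX : ∀ Δ, 0 < Δ → IsInput P (X Δ) (f Δ) M) (c : ℝ)
    (h : Lp ℝ 2 (volume : Measure ℝ)) (p : ℝ × ℝ) : Lp ℝ 2 P :=
  if hp : 0 < p.2 then (hX p.2 hp).fluct c p.1 h else 0

theorem fluctFamily_of_pos (hX : ∀ Δ, 0 < Δ → IsInput P (X Δ) (f Δ) M) (c : ℝ)
    (h : Lp ℝ 2 (volume : Measure ℝ)) {p : ℝ × ℝ} (hp : 0 < p.2) :
    fluctFamily hX c h p = (hX p.2 hp).fluct c p.1 h := dif_pos hp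

theorem eventually_pos_prod : ∀ᶠ p : ℝ × ℝ in atTop ×ˢ atTop, 0 < p.1 ∧ 0 < p.2 :=
  (eventually_gt_atTop 0).prod_mk (eventually_gt_atTop 0)

/-- The Fejér limit is applied with (a, b) = (|ĥ|², 1) and with (ĥ, ĥ), at density level c/2π. The
constants combine to c⁻² · 2π · (c/2π)² = 1/2π, which matches `limitVar_eq`. -/
theorem tendsto_norm_sq_fluct_schwartz
    (hX : ∀ Δ, 0 < Δ → IsInput P (X Δ) (f Δ) M) (hc : 0 < c)
    (hft : ∀ a : ℝ, 0 < a →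
      TendstoUniformlyOn f (fun _ => c / (2 * Real.pi)) atTop (Set.Icc (-a) a))
    (h : SchwartzMap ℝ ℝ) :
    Tendsto (fun p => ‖fluctFamily hX c (h.toLp 2 volume) p‖ ^ 2) (atTop ×ˢ atTop)
      (𝓝 (limitVar (h.toLp 2 volume))) := by
  set g : Lp ℝ 2 (volume : Measure ℝ) := h.toLp 2 volume with hg
  have hgh : g =ᵐ[volume] h := h.coeFn_toLp 2 volume
  have hi : Integrable g := h.integrable.congr hgh.symm
  have hFi : Integrable (fourierInt g) :=
    (fourierInt_schwartz_integrable h).congr (ae_of_all _ fun lam => (fourierInt_congr hgh lam).symm)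
  have hFc := continuous_fourierInt hi
  have hFb := norm_fourierInt_le g
  have hFs := (plancherel hi (Lp.memLp g)).1
  have t1 := tendsto_average_spectralInt_mul (f := f) (M := M) (γ := c / (2 * Real.pi))
    (a := fun lam => ((‖fourierInt g lam‖ ^ 2 : ℝ) : ℂ)) (b := fun _ => (1:ℂ))
    (fun Δ hΔ => (hX Δ hΔ).nonneg) (fun Δ hΔ => (hX Δ hΔ).le) (fun Δ hΔ => (hX Δ hΔ).continuous)
    (fun Δ hΔ => (hX Δ hΔ).integrable) hft hFs.ofReal (A := (∫ x, ‖g x‖) ^ 2) (fun lam => by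
      rw [Complex.norm_real, Real.norm_of_nonneg (sq_nonneg _)]
      exact pow_le_pow_left₀ (norm_nonneg _) (hFb lam) 2) continuous_const (B := 1) (by simp)
  have t2 := tendsto_average_spectralInt_mul (f := f) (M := M) (γ := c / (2 * Real.pi))
    (a := fourierInt g) (b := fourierInt g)
    (fun Δ hΔ => (hX Δ hΔ).nonneg) (fun Δ hΔ => (hX Δ hΔ).le) (fun Δ hΔ => (hX Δ hΔ).continuous)
    (fun Δ hΔ => (hX Δ hΔ).integrable) hft hFi hFb hFc hFb
  have t3 := (t1.add t2).const_mul (((1 / c ^ 2 : ℝ)) : ℂ)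
  have hlim : (((1 / c ^ 2 : ℝ)) : ℂ) * ((2 * Real.pi * ((c / (2 * Real.pi) : ℝ) : ℂ) ^ 2
        * ∫ x, ((‖fourierInt g x‖ ^ 2 : ℝ) : ℂ) * 1)
      + 2 * Real.pi * ((c / (2 * Real.pi) : ℝ) : ℂ) ^ 2 * ∫ x, fourierInt g x * fourierInt g x)
      = ((limitVar g : ℝ) : ℂ) := by
    have e := limitVar_eq hi
    simp only [sq (fourierInt g _)] at e
    simp only [mul_one]
    rw [← mul_add, ← e]
    have h1 : (c : ℂ) ≠ 0 := by exact_mod_cast hc.ne'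
    have h2 : (Real.pi : ℂ) ≠ 0 := by exact_mod_cast Real.pi_pos.ne'
    push_cast
    field_simp
  rw [hlim] at t3
  have t4 := (Complex.continuous_re.tendsto _).comp t3
  rw [Complex.ofReal_re] at t4
  refine t4.congr' ?_
  filter_upwards [eventually_pos_prod] with p hp
  rw [fluctFamily_of_pos hX c g hp.2]
  simp only [Function.comp_apply]
  rw [← (hX p.2 hp.2).norm_sq_fluct hc hp.1 hi, Complex.ofReal_re]

/-- The coefficient bound ρ is of order T^{-1/2} while the variance converges, so the distance from
the Gaussian characteristic function of the same variance tends to 0. -/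
theorem tendsto_charInt_fluct_schwartz
    (hX : ∀ Δ, 0 < Δ → IsInput P (X Δ) (f Δ) M) (hc : 0 < c)
    (hft : ∀ a : ℝ, 0 < a →
      TendstoUniformlyOn f (fun _ => c / (2 * Real.pi)) atTop (Set.Icc (-a) a))
    (h : SchwartzMap ℝ ℝ) :
    Tendsto (fun p => charInt P (fluctFamily hX c (h.toLp 2 volume) p)) (atTop ×ˢ atTop)
      (𝓝 (Complex.exp (-((limitVar (h.toLp 2 volume) / 2 : ℝ) : ℂ)))) := by
  set g : Lp ℝ 2 (volume : Measure ℝ) := h.toLp 2 volume with hg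
  have hgh : g =ᵐ[volume] h := h.coeFn_toLp 2 volume
  have hi : Integrable g := h.integrable.congr hgh.symm
  have t1 := tendsto_norm_sq_fluct_schwartz hX hc hft h
  rw [← hg] at t1
  have t2 : Tendsto (fun p => Complex.exp (-((‖fluctFamily hX c g p‖ ^ 2 / 2 : ℝ) : ℂ)))
      (atTop ×ˢ atTop) (𝓝 (Complex.exp (-((limitVar g / 2 : ℝ) : ℂ)))) := by
    have : Continuous fun r : ℝ => Complex.exp (-((r / 2 : ℝ) : ℂ)) := by fun_prop
    exact (this.tendsto _).comp t1
  have hρ : Tendsto (fun p : ℝ × ℝ => √p.1 * (1 / (c * p.1))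
      * (Real.pi * M * ((∫ x, ‖g x‖) ^ 2 + 1))) (atTop ×ˢ atTop) (𝓝 0) := by
    have h0 : Tendsto (fun T : ℝ => 1 / c * (√T)⁻¹) atTop (𝓝 0) := by
      simpa using (tendsto_inv_atTop_zero.comp Real.tendsto_sqrt_atTop).const_mul (1 / c)
    have h1 : Tendsto (fun T : ℝ => √T * (1 / (c * T))) atTop (𝓝 0) := by
      refine h0.congr' ?_
      filter_upwards [eventually_gt_atTop 0] with T hT
      have h2 : √T ≠ 0 := (Real.sqrt_pos.2 hT).ne'
      have h3 : T = √T * √T := (Real.mul_self_sqrt hT.le).symm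
      rw [show √T * (1 / (c * T)) = √T * (1 / (c * (√T * √T))) by rw [← h3]]
      field_simp
    simpa using (h1.comp tendsto_fst).mul_const (Real.pi * M * ((∫ x, ‖g x‖) ^ 2 + 1))
  have t3 : Tendsto (fun p => charInt P (fluctFamily hX c g p)
      - Complex.exp (-((‖fluctFamily hX c g p‖ ^ 2 / 2 : ℝ) : ℂ))) (atTop ×ˢ atTop) (𝓝 0) := by
    have hb := (hρ.const_mul chiSqConst).mul t1
    rw [mul_zero, zero_mul] at hb
    refine squeeze_zero_norm' ?_ hb
    filter_upwards [eventually_pos_prod, hρ.eventually (eventually_le_nhds one_pos)] with p hp hp1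
    rw [fluctFamily_of_pos hX c g hp.2]
    exact (hX p.2 hp.2).norm_charInt_fluct_sub_le hc hp.1 hi hp1 rfl
  simpa using t3.add t2

/-- The characteristic functions of the fluctuations converge to Gaussian ones. -/
theorem tendsto_charInt_fluct
    (hX : ∀ Δ, 0 < Δ → IsInput P (X Δ) (f Δ) M) (hc : 0 < c)
    (hft : ∀ a : ℝ, 0 < a →
      TendstoUniformlyOn f (fun _ => c / (2 * Real.pi)) atTop (Set.Icc (-a) a))
    (h : Lp ℝ 2 (volume : Measure ℝ)) :
    Tendsto (fun p => charInt P (fluctFamily hX c h p)) (atTop ×ˢ atTop)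
      (𝓝 (Complex.exp (-((limitVar h / 2 : ℝ) : ℂ)))) := by
  set K := √(8 * Real.pi ^ 2 * M ^ 2 / c ^ 2) with hK
  have hK0 : 0 ≤ K := by positivity
  have hV : Continuous fun g => Complex.exp (-((limitVar g / 2 : ℝ) : ℂ)) := by
    have := continuous_limitVar
    fun_prop
  rw [Metric.tendsto_nhds]
  intro ε hε
  -- Replacing h by a nearby Schwartz function costs at most K‖h - g‖ in the characteristic
  -- function, uniformly in T and Δ, and little in the limit variance by continuity; the rest is an
  -- ε/3 argument.
  have hnear : ∀ᶠ g in 𝓝 h, K * ‖h - g‖ < ε / 3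
      ∧ dist (Complex.exp (-((limitVar g / 2 : ℝ) : ℂ)))
        (Complex.exp (-((limitVar h / 2 : ℝ) : ℂ))) < ε / 3 := by
    refine Filter.Eventually.and ?_
      ((Metric.tendsto_nhds.1 (hV.tendsto h)) (ε / 3) (by linarith))
    have : Tendsto (fun g => K * ‖h - g‖) (𝓝 h) (𝓝 (K * ‖h - h‖)) :=
      Continuous.tendsto (by fun_prop) h
    rw [sub_self, norm_zero, mul_zero] at this
    exact this.eventually (eventually_lt_nhds (by linarith))
  obtain ⟨u, hu, g, hgu⟩ := mem_closure_iff_nhds.1 (denseRange_schwartz h) _ hnear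
  obtain ⟨hg1, hg2⟩ : K * ‖h - g.toLp 2 volume‖ < ε / 3
      ∧ dist (Complex.exp (-((limitVar (g.toLp 2 volume) / 2 : ℝ) : ℂ)))
        (Complex.exp (-((limitVar h / 2 : ℝ) : ℂ))) < ε / 3 := by
    rw [← hgu] at hu
    exact hu
  filter_upwards [eventually_pos_prod, Metric.tendsto_nhds.1
    (tendsto_charInt_fluct_schwartz hX hc hft g) (ε / 3) (by linarith)] with p hp hpg
  have h1 : dist (charInt P (fluctFamily hX c h p))
      (charInt P (fluctFamily hX c (g.toLp 2 volume) p)) < ε / 3 := by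
    rw [dist_eq_norm]
    refine lt_of_le_of_lt ?_ hg1
    rw [fluctFamily_of_pos hX c _ hp.2, fluctFamily_of_pos hX c _ hp.2]
    refine (norm_charInt_sub_le _ _).trans ?_
    rw [← IsInput.fluctCLM_apply, ← IsInput.fluctCLM_apply, ← map_sub]
    exact (hX p.2 hp.2).norm_fluct_le hc hp.1 _
  have h2 := dist_triangle4 (charInt P (fluctFamily hX c h p))
    (charInt P (fluctFamily hX c (g.toLp 2 volume) p))
    (Complex.exp (-((limitVar (g.toLp 2 volume) / 2 : ℝ) : ℂ)))
    (Complex.exp (-((limitVar h / 2 : ℝ) : ℂ)))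
  linarith

end Family

end

/-! ### Weak convergence of random vectors and convergence of means -/

noncomputable section

section Weak

variable {Ω Ω' : Type*} [MeasurableSpace Ω] {P : Measure Ω} [IsProbabilityMeasure P]
  [MeasurableSpace Ω'] {P' : Measure Ω'} [IsProbabilityMeasure P']

theorem charFun_map_toLp {m : ℕ} {Y : Fin m → Ω → ℝ} (hY : ∀ j, AEMeasurable (Y j) P)
    (u : EuclideanSpace ℝ (Fin m)) :
    charFun (P.map fun ω => (WithLp.toLp 2 fun j => Y j ω : EuclideanSpace ℝ (Fin m))) u
      = charInt P fun ω => ∑ j, u j * Y j ω := by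
  have hm : AEMeasurable
      (fun ω => (WithLp.toLp 2 fun j => Y j ω : EuclideanSpace ℝ (Fin m))) P :=
    (MeasurableEquiv.toLp 2 (Fin m → ℝ)).measurable.comp_aemeasurable (aemeasurable_pi_lambda _ hY)
  rw [charFun_apply, integral_map hm (Continuous.aestronglyMeasurable (by fun_prop)), charInt]
  refine integral_congr_ae (ae_of_all _ fun ω => ?_)
  simp only [PiLp.inner_apply, RCLike.inner_apply, conj_trivial]
  rw [mul_comm]

/-- Lévy's continuity theorem for random vectors, along a countably generated filter. -/
theorem tendstoInDistribution_of_charInt {ι : Type*} {l : Filter ι} [l.IsCountablyGenerated]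
    {m : ℕ} {Y : ι → Fin m → Ω → ℝ} {Z : Fin m → Ω' → ℝ} (hY : ∀ i j, AEMeasurable (Y i j) P)
    (hZ : ∀ j, AEMeasurable (Z j) P')
    (h : ∀ u : Fin m → ℝ, Tendsto (fun i => charInt P fun ω => ∑ j, u j * Y i j ω) l
      (𝓝 (charInt P' fun ω => ∑ j, u j * Z j ω))) :
    TendstoInDistribution (fun i ω j => Y i j ω) l (fun ω j => Z j ω) (fun _ => P) P' := by
  have hYm : ∀ i, AEMeasurable
      (fun ω => (WithLp.toLp 2 fun j => Y i j ω : EuclideanSpace ℝ (Fin m))) P := fun i =>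
    (MeasurableEquiv.toLp 2 (Fin m → ℝ)).measurable.comp_aemeasurable
      (aemeasurable_pi_lambda _ (hY i))
  have hZm : AEMeasurable
      (fun ω => (WithLp.toLp 2 fun j => Z j ω : EuclideanSpace ℝ (Fin m))) P' :=
    (MeasurableEquiv.toLp 2 (Fin m → ℝ)).measurable.comp_aemeasurable
      (aemeasurable_pi_lambda _ hZ)
  have key : TendstoInDistribution
      (fun i ω => (WithLp.toLp 2 fun j => Y i j ω : EuclideanSpace ℝ (Fin m))) l
      (fun ω => (WithLp.toLp 2 fun j => Z j ω : EuclideanSpace ℝ (Fin m))) (fun _ => P) P' := by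
    refine ⟨hYm, hZm, ?_⟩
    -- Along a countably generated filter convergence may be checked on sequences, to which Lévy's
    -- theorem applies.
    refine tendsto_of_seq_tendsto fun s hs => ?_
    refine ProbabilityMeasure.tendsto_of_tendsto_charFun fun u => ?_
    simp only [ProbabilityMeasure.coe_mk]
    rw [charFun_map_toLp hZ]
    exact ((h u).comp hs).congr fun n => (charFun_map_toLp (hY (s n)) u).symm
  exact key.continuous_comp (g := fun v : EuclideanSpace ℝ (Fin m) => (v : Fin m → ℝ))
    (PiLp.continuous_ofLp 2 _)

/-- The difference vanishes for |x| ≤ R and is at most |x| ≤ x²/R otherwise. A bounded second moment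
thus controls the error of truncation. -/
theorem abs_sub_clamp_le {R : ℝ} (hR : 0 < R) (x : ℝ) :
    |x - max (-R) (min R x)| ≤ x ^ 2 / R := by
  rw [le_div_iff₀ hR]
  rcases le_total x R with h1 | h1
  · rw [min_eq_right h1]
    rcases le_total (-R) x with h2 | h2
    · rw [max_eq_right h2]; simp; positivity
    · rw [max_eq_left h2, abs_of_nonpos (by linarith)]; nlinarith
  · rw [min_eq_left h1, max_eq_right (by linarith), abs_of_nonneg (by linarith)]; nlinarith

theorem abs_integral_sub_clamp_le {W : Ω → ℝ} (hm : AEStronglyMeasurable W P)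
    (hi : Integrable (fun ω => W ω ^ 2) P) {C : ℝ} (hle : ∫ ω, W ω ^ 2 ∂P ≤ C)
    {R : ℝ} (hR : 0 < R) :
    |∫ ω, W ω ∂P - ∫ ω, max (-R) (min R (W ω)) ∂P| ≤ C / R := by
  have hWi : Integrable W P := ((memLp_two_iff_integrable_sq hm).2 hi).integrable (by norm_num)
  have hci : Integrable (fun ω => max (-R) (min R (W ω))) P := by
    refine Integrable.mono' (integrable_const R)
      ((continuous_const.max (continuous_const.min continuous_id)).comp_aestronglyMeasurable hm)
      (ae_of_all _ fun ω => ?_)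
    rw [Real.norm_eq_abs, abs_le]
    exact ⟨le_max_left _ _, max_le (by linarith) (min_le_left _ _)⟩
  rw [← integral_sub hWi hci]
  refine (abs_integral_le_integral_abs).trans ?_
  calc ∫ ω, |W ω - max (-R) (min R (W ω))| ∂P ≤ ∫ ω, W ω ^ 2 / R ∂P :=
        integral_mono (hWi.sub hci).abs (hi.div_const R) fun ω => abs_sub_clamp_le hR (W ω)
    _ = (∫ ω, W ω ^ 2 ∂P) / R := integral_div _ _
    _ ≤ C / R := by gcongr

/-- Convergence in distribution with bounded second moments entails convergence of means. -/
theorem tendsto_integral_of_tendstoInDistribution {E ι : Type*} [TopologicalSpace E]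
    [MeasurableSpace E] [OpensMeasurableSpace E] {l : Filter ι}
    {Y : ι → Ω → E} {Z : Ω' → E} (h : TendstoInDistribution Y l Z (fun _ => P) P')
    {G : E → ℝ} (hG : Continuous G) {C : ℝ}
    (hY : ∀ᶠ i in l, Integrable (fun ω => G (Y i ω) ^ 2) P ∧ ∫ ω, G (Y i ω) ^ 2 ∂P ≤ C)
    (hZ : Integrable (fun ω => G (Z ω) ^ 2) P') :
    Tendsto (fun i => ∫ ω, G (Y i ω) ∂P) l (𝓝 (∫ ω, G (Z ω) ∂P')) := by
  set C' := max (max C (∫ ω, G (Z ω) ^ 2 ∂P')) 0 with hC'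
  have hC0 : 0 ≤ C' := le_max_right _ _
  rw [Metric.tendsto_nhds]
  intro ε hε
  -- The level at which truncation costs less than ε/3; C' bounds the second moments of the family
  -- and of the limit at once.
  set R := 3 * (C' + 1) / ε with hR
  have hR0 : 0 < R := by positivity
  have hCR : C' / R < ε / 3 := by
    rw [hR, div_div_eq_mul_div, div_lt_div_iff₀ (by positivity) (by norm_num)]
    nlinarith
  let B : BoundedContinuousFunction E ℝ := BoundedContinuousFunction.ofNormedAddCommGroup
    (fun e => max (-R) (min R (G e))) (by fun_prop) R (fun e => by
      rw [Real.norm_eq_abs, abs_le]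
      exact ⟨le_max_left _ _, max_le (by linarith) (min_le_left _ _)⟩)
  have t := (ProbabilityMeasure.tendsto_iff_forall_integral_tendsto.1 h.tendsto) B
  simp only [ProbabilityMeasure.coe_mk] at t
  rw [integral_map h.aemeasurable_limit B.continuous.measurable.aestronglyMeasurable] at t
  have t2 : ∀ i, ∫ e, B e ∂(P.map (Y i)) = ∫ ω, B (Y i ω) ∂P := fun i =>
    integral_map (h.forall_aemeasurable i) B.continuous.measurable.aestronglyMeasurable
  simp_rw [t2] at t
  filter_upwards [hY, Metric.tendsto_nhds.1 t (ε / 3) (by linarith)] with i hi ht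
  have b1 := abs_integral_sub_clamp_le (hG.measurable.comp_aemeasurable (h.forall_aemeasurable i)).aestronglyMeasurable
    hi.1 (C := C') (hi.2.trans ((le_max_left _ _).trans (le_max_left _ _))) hR0
  have b2 := abs_integral_sub_clamp_le (hG.measurable.comp_aemeasurable h.aemeasurable_limit).aestronglyMeasurable
    hZ (C := C') ((le_max_right _ _).trans (le_max_left _ _)) hR0
  rw [Real.dist_eq] at ht ⊢
  have ht' : |∫ ω, max (-R) (min R (G (Y i ω))) ∂P - ∫ ω, max (-R) (min R (G (Z ω))) ∂P'|
    < ε / 3 := ht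
  simp only [Function.comp_apply] at b1 b2
  rw [abs_le] at b1 b2
  rw [abs_lt] at ht' ⊢
  constructor <;> linarith

end Weak

end

/-! ### Existence and characteristic functions of the limit process -/

noncomputable section

/-- Every real Hilbert space is isometric to a Gaussian one. -/
theorem exists_isonormal (E : Type) [NormedAddCommGroup E] [InnerProductSpace ℝ E]
    [CompleteSpace E] :
    ∃ (Ω : Type) (_ : MeasurableSpace Ω) (P : Measure Ω) (_ : IsProbabilityMeasure P)
      (S : Submodule ℝ (Lp ℝ 2 P)) (W : E →ₗᵢ[ℝ] Lp ℝ 2 P),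
      IsGaussianSubspace S ∧ ∀ e, W e ∈ S := by
  classical
  obtain ⟨w, b, -⟩ := exists_hilbertBasis ℝ E
  -- Independent standard normal coordinates, one for each vector of a Hilbert basis; the isometry
  -- sends the basis to the coordinates.
  let P : Measure (w → ℝ) := Measure.infinitePi fun _ => gaussianReal 0 1
  have hlaw : ∀ i : w, P.map (fun ω => ω i) = gaussianReal 0 1 := fun i =>
    Measure.infinitePi_map_eval _ i
  have hindep : iIndepFun (fun (i : w) (ω : w → ℝ) => ω i) P :=
    iIndepFun_infinitePi (X := fun _ => id) fun _ => measurable_id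
  have hgauss : ∀ i : w, HasGaussianLaw (fun ω : w → ℝ => ω i) P := fun i =>
    ⟨by rw [hlaw i]; infer_instance⟩
  have hproc : IsGaussianProcess (fun (i : w) (ω : w → ℝ) => ω i) P := by
    refine ⟨fun I => ?_⟩
    exact iIndepFun.hasGaussianLaw (X := fun (i : I) (ω : w → ℝ) => ω i) (fun i => hgauss i)
      (hindep.precomp Subtype.val_injective)
  have hmean : ∀ i : w, ∫ ω, ω i ∂P = 0 := fun i => by
    have := integral_map (μ := P) (φ := fun ω => ω i) (measurable_pi_apply i).aemeasurable
      (f := fun x : ℝ => x) (by fun_prop)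
    rw [← this, hlaw, integral_id_gaussianReal]
  have hsq : ∀ i : w, ∫ ω, ω i * ω i ∂P = 1 := fun i => by
    have := integral_map (μ := P) (φ := fun ω => ω i) (measurable_pi_apply i).aemeasurable
      (f := fun x : ℝ => x * x) (by fun_prop)
    rw [← this, hlaw]
    have hv := variance_id_gaussianReal (μ := 0) (v := 1)
    rw [variance_of_integral_eq_zero (by fun_prop) (by simp [integral_id_gaussianReal])] at hv
    simpa [sq] using hv
  let x : w → Lp ℝ 2 P := fun i => (hgauss i).memLp_two.toLp _
  have hx : ∀ i, x i =ᵐ[P] fun ω => ω i := fun i => MemLp.coeFn_toLp _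
  have hinner : ∀ i j, inner ℝ (x i) (x j) = ∫ ω, ω i * ω j ∂P := fun i j => by
    rw [inner_eq_integral_mul]
    refine integral_congr_ae ?_
    filter_upwards [hx i, hx j] with ω h1 h2
    rw [h1, h2]
  have hon : Orthonormal ℝ x := by
    rw [orthonormal_iff_ite]
    intro i j
    rw [hinner]
    split_ifs with hij
    · rw [hij, hsq]
    · rw [(hindep.indepFun hij).integral_fun_mul_eq_mul_integral
        (measurable_pi_apply i).aestronglyMeasurable
        (measurable_pi_apply j).aestronglyMeasurable, hmean, zero_mul]
  refine ⟨w → ℝ, inferInstance, P, inferInstance,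
    (Submodule.span ℝ (Set.range x)).topologicalClosure,
    hon.orthogonalFamily.linearIsometry.comp b.repr.toLinearIsometry,
    (isGaussianSubspace_span hproc hmean x hx).topologicalClosure, fun e => ?_⟩
  refine mem_closure_of_tendsto (hon.orthogonalFamily.hasSum_linearIsometry (b.repr e))
    (Eventually.of_forall fun s => Submodule.sum_mem _ fun i _ => ?_)
  rw [LinearIsometry.toSpanSingleton_apply]
  exact Submodule.smul_mem _ _ (Submodule.subset_span ⟨i, rfl⟩)

theorem reflect_reflect (h : Lp ℝ 2 (volume : Measure ℝ)) : reflectAt 0 (reflectAt 0 h) = h := by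
  refine Lp.ext ?_
  have h1 := (Measure.measurePreserving_sub_left volume (0:ℝ)).quasiMeasurePreserving.ae_eq_comp
    (coeFn_reflectAt 0 h)
  filter_upwards [coeFn_reflectAt 0 (reflectAt 0 h), h1] with s h2 h3
  rw [h2]
  simp only [Function.comp_apply] at h3
  rw [h3]
  congr 1
  ring

theorem inner_reflect_left (g h : Lp ℝ 2 (volume : Measure ℝ)) :
    inner ℝ (reflectAt 0 g) h = inner ℝ g (reflectAt 0 h) := by
  rw [← (reflectAt 0).inner_map_map, reflect_reflect]

/-- The limit covariance as a real bilinear form. -/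
def limitForm (g h : Lp ℝ 2 (volume : Measure ℝ)) : ℝ := inner ℝ g h + inner ℝ g (reflectAt 0 h)

theorem limitForm_comm (g h : Lp ℝ 2 (volume : Measure ℝ)) : limitForm g h = limitForm h g := by
  rw [limitForm, limitForm, real_inner_comm, ← inner_reflect_left, real_inner_comm h (reflectAt 0 g)]

/-- There is a centered Gaussian process with the limit covariance. -/
theorem exists_limit_process {H : ℝ → ℝ} (hH : MemLp H 2 volume) :
    ∃ (Ω' : Type) (_ : MeasurableSpace Ω') (P' : Measure Ω') (Z : ℝ → Ω' → ℝ),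
      IsProbabilityMeasure P' ∧ IsCenteredGaussian P' Z (limitCov H hH) := by
  obtain ⟨Ω', m', P', hP', S, W, hS, hW⟩ := exists_isonormal (Lp ℝ 2 (volume : Measure ℝ))
  -- With R the reflection, k = (1 + R)h_τ/√2. Since R is self-adjoint with R² = 1, one has (1 +
  -- R)²/2 = 1 + R, so the inner products of k are exactly the limit covariance.
  let k : ℝ → Lp ℝ 2 (volume : Measure ℝ) := fun τ =>
    (√2)⁻¹ • (shift τ (hH.toLp H) + reflectAt 0 (shift τ (hH.toLp H)))
  refine ⟨Ω', m', P', fun τ => W (k τ), hP', ⟨⟨fun I => ?_⟩, fun t => ?_, fun s t => ?_⟩⟩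
  · exact hS.hasGaussianLaw (ξ := fun i : I => W (k i)) fun i => hW _
  · exact hS.integral_eq_zero (hW _)
  · rw [← inner_eq_integral_mul, W.inner_map_map, limitCov_eq]
    congr 1
    simp only [k]
    rw [real_inner_smul_left, real_inner_smul_right, inner_add_left, inner_add_right,
      inner_add_right, (reflectAt 0).inner_map_map, inner_reflect_left, ← mul_assoc, ← mul_inv,
      Real.mul_self_sqrt (by norm_num)]
    ring

section Limit

variable {Ω' : Type*} [MeasurableSpace Ω'] {P' : Measure Ω'} [IsProbabilityMeasure P']
  {Z : ℝ → Ω' → ℝ} {H : ℝ → ℝ} {hH : MemLp H 2 volume}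

/-- A centered Gaussian process as a curve in `L²`. -/
def IsCenteredGaussian.vec {C : ℝ → ℝ → ℂ} (hZ : IsCenteredGaussian P' Z C) (t : ℝ) :
    Lp ℝ 2 P' :=
  (hZ.gaussian.hasGaussianLaw_eval t).memLp_two.toLp (Z t)

theorem IsCenteredGaussian.coeFn_vec {C : ℝ → ℝ → ℂ} (hZ : IsCenteredGaussian P' Z C) (t : ℝ) :
    hZ.vec t =ᵐ[P'] Z t := MemLp.coeFn_toLp _

theorem IsCenteredGaussian.isGaussianSubspace {C : ℝ → ℝ → ℂ} (hZ : IsCenteredGaussian P' Z C) :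
    IsGaussianSubspace (Submodule.span ℝ (Set.range hZ.vec)) :=
  isGaussianSubspace_span hZ.gaussian hZ.centered _ hZ.coeFn_vec

theorem IsCenteredGaussian.inner_vec (hZ : IsCenteredGaussian P' Z (limitCov H hH)) (s t : ℝ) :
    inner ℝ (hZ.vec s) (hZ.vec t)
      = limitForm (shift s (hH.toLp H)) (shift t (hH.toLp H)) := by
  have h := hZ.cov s t
  rw [limitCov_eq] at h
  rw [inner_eq_integral_mul, limitForm, ← Complex.ofReal_inj.1 h]
  refine integral_congr_ae ?_
  filter_upwards [hZ.coeFn_vec s, hZ.coeFn_vec t] with ω h1 h2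
  rw [h1, h2]

theorem limitVar_sum {ι : Type*} (s : Finset ι) (u : ι → ℝ)
    (h : ι → Lp ℝ 2 (volume : Measure ℝ)) :
    limitVar (∑ j ∈ s, u j • h j) = ∑ j ∈ s, ∑ k ∈ s, u j * (u k * limitForm (h j) (h k)) := by
  rw [limitVar, ← real_inner_self_eq_norm_sq, map_sum]
  simp only [sum_inner, inner_sum, real_inner_smul_left, real_inner_smul_right, map_smul]
  rw [← Finset.sum_add_distrib]
  refine Finset.sum_congr rfl fun j _ => ?_
  rw [← Finset.sum_add_distrib]
  refine Finset.sum_congr rfl fun k _ => ?_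
  rw [limitForm_comm, limitForm]
  ring

/-- The variance of Σ u_j Z(τ_j) is `limitVar` of the same combination of translates, which is the
limit found for the fluctuations. -/
theorem IsCenteredGaussian.charInt_sum (hZ : IsCenteredGaussian P' Z (limitCov H hH)) {m : ℕ}
    (τ : Fin m → ℝ) (u : Fin m → ℝ) :
    charInt P' (fun ω => ∑ j, u j * Z (τ j) ω)
      = Complex.exp (-((limitVar (∑ j, u j • shift (τ j) (hH.toLp H)) / 2 : ℝ) : ℂ)) := by
  have hmem : ∑ j, u j • hZ.vec (τ j) ∈ Submodule.span ℝ (Set.range hZ.vec) :=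
    Submodule.sum_mem _ fun j _ => Submodule.smul_mem _ _ (Submodule.subset_span ⟨τ j, rfl⟩)
  have h1 := hZ.isGaussianSubspace _ hmem
  have h2 : ‖∑ j, u j • hZ.vec (τ j)‖ ^ 2
      = limitVar (∑ j, u j • shift (τ j) (hH.toLp H)) := by
    rw [limitVar_sum, ← real_inner_self_eq_norm_sq]
    simp only [sum_inner, inner_sum, real_inner_smul_left, real_inner_smul_right, hZ.inner_vec]
    exact Finset.sum_congr rfl fun j _ => Finset.sum_congr rfl fun k _ => by rw [limitForm_comm]
  rw [h2] at h1
  rw [← h1]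
  refine charInt_congr ?_
  have h3 : ∀ᵐ ω ∂P', ∀ j, hZ.vec (τ j) ω = Z (τ j) ω := ae_all_iff.2 fun j => hZ.coeFn_vec _
  filter_upwards [coeFn_sum_smul (P := P') Finset.univ u (fun j => hZ.vec (τ j)), h3] with ω h4 h5
  rw [h4]
  exact Finset.sum_congr rfl fun j _ => by rw [h5]

end Limit

end

/-! ### Convergence of finite-dimensional distributions and mixed moments -/

noncomputable section

theorem IsInputFamily.exists_isInput {Ω : Type*} [MeasurableSpace Ω] {P : Measure Ω}
    {X : ℝ → ℝ → Ω → ℝ} {f : ℝ → ℝ → ℝ} {c : ℝ} (hX : IsInputFamily P X f c) :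
    ∃ M : ℝ, ∀ Δ, 0 < Δ → IsInput P (X Δ) (f Δ) M := by
  obtain ⟨M, hM⟩ := hX.density_bounded
  exact ⟨M, fun Δ hΔ => ⟨hX.measurable Δ hΔ, hX.gaussian Δ hΔ, hX.density_nonneg Δ hΔ,
    hX.density_continuous Δ hΔ, hX.density_integrable Δ hΔ, hM Δ hΔ⟩⟩

/-- The largest factor dominates the others, so that moments of single variables control those of
products. The summand 1 is needed only for the empty product. -/
theorem prod_sq_le {m : ℕ} (x : Fin m → ℝ) :
    (∏ j, x j) ^ 2 ≤ 1 + ∑ j, |x j| ^ (2 * m) := by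
  rcases Nat.eq_zero_or_pos m with rfl | hm
  · simp
  have : Nonempty (Fin m) := ⟨⟨0, hm⟩⟩
  obtain ⟨k, -, hk⟩ := Finset.exists_max_image Finset.univ (fun j => |x j|) Finset.univ_nonempty
  have h1 : |∏ j, x j| ≤ |x k| ^ m := by
    rw [Finset.abs_prod]
    refine (Finset.prod_le_prod (fun j _ => abs_nonneg _) fun j hj => hk j hj).trans (le_of_eq ?_)
    simp
  have h2 : (∏ j, x j) ^ 2 ≤ |x k| ^ (2 * m) := by
    rw [← sq_abs, mul_comm 2 m, pow_mul]
    exact pow_le_pow_left₀ (abs_nonneg _) h1 2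
  have h3 := Finset.single_le_sum (f := fun j => |x j| ^ (2 * m)) (fun j _ => by positivity)
    (Finset.mem_univ k)
  linarith

variable {Ω : Type*} [MeasurableSpace Ω] {P : Measure Ω} [IsProbabilityMeasure P]
  {X : ℝ → ℝ → Ω → ℝ} {f : ℝ → ℝ → ℝ} {c : ℝ} {H : ℝ → ℝ}

theorem exists_prod_normalized_bound (hX : IsInputFamily P X f c) (hH : MemLp H 2 volume)
    {m : ℕ} (τ : Fin m → ℝ) :
    ∃ C : ℝ, ∀ T Δ : ℝ, 0 < T → 0 < Δ →
      Integrable (fun ω => (∏ j, normalized P H X c T Δ (τ j) ω) ^ 2) P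
        ∧ ∫ ω, (∏ j, normalized P H X c T Δ (τ j) ω) ^ 2 ∂P ≤ C := by
  obtain ⟨M, hM⟩ := hX.exists_isInput
  choose C hC using fun j : Fin m =>
    exists_moment_bound P M hX.c_pos (shift (τ j) (hH.toLp H)) (2 * m)
  refine ⟨1 + ∑ j, C j, fun T Δ hT hΔ => ?_⟩
  have hj : ∀ j, Integrable (fun ω => |normalized P H X c T Δ (τ j) ω| ^ (2 * m)) P
      ∧ ∫ ω, |normalized P H X c T Δ (τ j) ω| ^ (2 * m) ∂P ≤ C j := by
    intro j
    obtain ⟨h1, h2⟩ := hC j (X Δ) (f Δ) (hM Δ hΔ) T hT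
    have hae : (fun ω => |(hM Δ hΔ).fluct c T (shift (τ j) (hH.toLp H)) ω| ^ (2 * m))
        =ᵐ[P] fun ω => |normalized P H X c T Δ (τ j) ω| ^ (2 * m) := by
      filter_upwards [normalized_ae_eq (hM Δ hΔ) hH c (τ j) hT.le] with ω hω
      rw [hω]
    exact ⟨h1.congr hae, (integral_congr_ae hae).symm.le.trans h2⟩
  have hdom : Integrable (fun ω => 1 + ∑ j, |normalized P H X c T Δ (τ j) ω| ^ (2 * m)) P :=
    (integrable_const _).add (integrable_finsetSum _ fun j _ => (hj j).1)
  have hm : AEStronglyMeasurable (fun ω => (∏ j, normalized P H X c T Δ (τ j) ω) ^ 2) P := by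
    refine AEStronglyMeasurable.pow ?_ 2
    exact Finset.aestronglyMeasurable_fun_prod _ fun j _ => aestronglyMeasurable_normalized H c T Δ (τ j)
  have hint : Integrable (fun ω => (∏ j, normalized P H X c T Δ (τ j) ω) ^ 2) P := by
    refine hdom.mono' hm (ae_of_all _ fun ω => ?_)
    rw [Real.norm_of_nonneg (sq_nonneg _)]
    exact prod_sq_le _
  refine ⟨hint, (integral_mono hint hdom fun ω => prod_sq_le _).trans ?_⟩
  rw [integral_add (integrable_const _) (integrable_finsetSum _ fun j _ => (hj j).1),
    integral_finsetSum _ fun j _ => (hj j).1]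
  simp only [integral_const, probReal_univ, one_smul]
  have := Finset.sum_le_sum fun (j : Fin m) (_ : j ∈ Finset.univ) => (hj j).2
  linarith

theorem integrable_prod_normalized (hX : IsInputFamily P X f c) (hH : MemLp H 2 volume)
    {T Δ : ℝ} (hT : 0 < T) (hΔ : 0 < Δ) {m : ℕ} (τ : Fin m → ℝ) :
    Integrable (fun ω => ∏ j, normalized P H X c T Δ (τ j) ω) P := by
  obtain ⟨C, hC⟩ := exists_prod_normalized_bound hX hH τ
  have hm : AEStronglyMeasurable (fun ω => ∏ j, normalized P H X c T Δ (τ j) ω) P :=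
    Finset.aestronglyMeasurable_fun_prod _ fun j _ => aestronglyMeasurable_normalized H c T Δ (τ j)
  exact ((memLp_two_iff_integrable_sq hm).2 (hC T Δ hT hΔ).1).integrable (by norm_num)

variable {Ω' : Type*} [MeasurableSpace Ω'] {P' : Measure Ω'} [IsProbabilityMeasure P']
  {Z : ℝ → Ω' → ℝ} {hH : MemLp H 2 volume}

/-- The finite-dimensional distributions converge. -/
theorem tendstoInDistribution_normalized (hX : IsInputFamily P X f c)
    (hZ : IsCenteredGaussian P' Z (limitCov H hH)) {m : ℕ} (τ : Fin m → ℝ) :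
    TendstoInDistribution (fun (p : ℝ × ℝ) ω (j : Fin m) => normalized P H X c p.1 p.2 (τ j) ω)
      (atTop ×ˢ atTop) (fun ω j => Z (τ j) ω) (fun _ => P) P' := by
  obtain ⟨M, hM⟩ := hX.exists_isInput
  refine tendstoInDistribution_of_charInt
    (Y := fun (p : ℝ × ℝ) (j : Fin m) => normalized P H X c p.1 p.2 (τ j))
    (Z := fun j => Z (τ j))
    (fun p j => (aestronglyMeasurable_normalized H c p.1 p.2 (τ j)).aemeasurable)
    (fun j => hZ.gaussian.aemeasurable _) fun u => ?_
  rw [hZ.charInt_sum τ u]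
  -- Cramér–Wold: the linear combination of the normalized estimators is the fluctuation for the
  -- same combination of translates of H.
  refine (tendsto_charInt_fluct hM hX.c_pos hX.density_tendsto
    (∑ j, u j • shift (τ j) (hH.toLp H))).congr' ?_
  filter_upwards [eventually_pos_prod] with p hp
  refine charInt_congr ?_
  rw [fluctFamily_of_pos hM c _ hp.2, ← IsInput.fluctCLM_apply, map_sum]
  simp only [map_smul]
  have h3 : ∀ᵐ ω ∂P, ∀ j, normalized P H X c p.1 p.2 (τ j) ω
      = (hM p.2 hp.2).fluct c p.1 (shift (τ j) (hH.toLp H)) ω :=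
    ae_all_iff.2 fun j => normalized_ae_eq (hM p.2 hp.2) hH c (τ j) hp.1.le
  filter_upwards [coeFn_sum_smul (P := P) Finset.univ u
    (fun j => (hM p.2 hp.2).fluctCLM c p.1 (shift (τ j) (hH.toLp H))), h3] with ω h4 h5
  rw [h4]
  exact Finset.sum_congr rfl fun j _ => by rw [h5, IsInput.fluctCLM_apply]

theorem IsCenteredGaussian.memLp_prod {C : ℝ → ℝ → ℂ} (hZ : IsCenteredGaussian P' Z C) {m : ℕ}
    (τ : Fin m → ℝ) : MemLp (fun ω => ∏ j, Z (τ j) ω) 2 P' :=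
  memLp_prod_of_forall Finset.univ (fun j _ _ hp =>
    (hZ.gaussian.hasGaussianLaw_eval (τ j)).memLp hp) (by norm_num)

/-- The mixed moments converge. -/
theorem tendsto_moment_normalized (hX : IsInputFamily P X f c)
    (hZ : IsCenteredGaussian P' Z (limitCov H hH)) {m : ℕ} (τ : Fin m → ℝ) :
    Tendsto (fun p : ℝ × ℝ => ∫ ω, ∏ j, normalized P H X c p.1 p.2 (τ j) ω ∂P)
      (atTop ×ˢ atTop) (𝓝 (∫ ω, ∏ j, Z (τ j) ω ∂P')) := by
  obtain ⟨C, hC⟩ := exists_prod_normalized_bound hX hH τ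
  refine tendsto_integral_of_tendstoInDistribution (tendstoInDistribution_normalized hX hZ τ)
    (G := fun x : Fin m → ℝ => ∏ j, x j) (by fun_prop) (C := C) ?_
    (hZ.memLp_prod τ).integrable_sq
  filter_upwards [eventually_pos_prod] with p hp
  exact hC p.1 p.2 hp.1 hp.2

end

/-! ### Set partitions and the cumulants of Wick moments -/

noncomputable section

section Combinatorics

variable {ι : Type*} [DecidableEq ι]

/-- `Q` is a partition of the finite set `S` into nonempty blocks. -/
structure IsPartition (S : Finset ι) (Q : Finset (Finset ι)) : Prop where
  nonempty : ∀ B ∈ Q, B.Nonempty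
  mem_iff : ∀ x, x ∈ S ↔ ∃ B ∈ Q, x ∈ B
  eq_of_mem : ∀ B ∈ Q, ∀ B' ∈ Q, ∀ x, x ∈ B → x ∈ B' → B = B'

theorem IsPartition.subset {S : Finset ι} {Q : Finset (Finset ι)} (h : IsPartition S Q)
    {B : Finset ι} (hB : B ∈ Q) : B ⊆ S := fun x hx => (h.mem_iff x).2 ⟨B, hB, hx⟩

theorem isPartition_parts {S : Finset ι} (π : Finpartition S) : IsPartition S π.parts where
  nonempty _ hB := π.nonempty_of_mem_parts hB
  mem_iff x := ⟨fun hx => ⟨π.part x, π.part_mem.2 hx, π.mem_part hx⟩,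
    fun ⟨_, hB, hx⟩ => π.le hB hx⟩
  eq_of_mem _ hB _ hB' _ hx hx' := π.eq_of_mem_parts hB hB' hx hx'

theorem IsPartition.exists_finpartition {S : Finset ι} {Q : Finset (Finset ι)}
    (h : IsPartition S Q) : ∃ π : Finpartition S, π.parts = Q := by
  refine ⟨⟨Q, ?_, ?_, ?_⟩, rfl⟩
  · refine Finset.supIndep_iff_pairwiseDisjoint.2 fun B hB B' hB' hne => ?_
    exact Finset.disjoint_left.2 fun x hx hx' => hne (h.eq_of_mem B hB B' hB' x hx hx')
  · ext x
    rw [Finset.mem_sup, h.mem_iff x]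
    rfl
  · exact fun hbot => (h.nonempty _ hbot).ne_empty rfl

/-- The set of all partitions of a finite set. -/
def partitions (S : Finset ι) : Finset (Finset (Finset ι)) :=
  @Finset.filter _ (IsPartition S) (Classical.decPred _) S.powerset.powerset

theorem mem_partitions {S : Finset ι} {Q : Finset (Finset ι)} :
    Q ∈ partitions S ↔ IsPartition S Q := by
  refine (@Finset.mem_filter _ _ (Classical.decPred _) _ _).trans ?_
  rw [Finset.mem_powerset, and_iff_right_iff_imp]
  exact fun h B hB => Finset.mem_powerset.2 (h.subset hB)

/-- Plain sets of blocks allow a block to be inserted or removed while the underlying set changes,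
without dependent types. -/
theorem sum_finpartition {S : Finset ι} (g : Finset (Finset ι) → ℝ) :
    ∑ π : Finpartition S, g π.parts = ∑ Q ∈ partitions S, g Q := by
  refine Finset.sum_bij (fun π _ => π.parts) (fun π _ => mem_partitions.2 (isPartition_parts π))
    (fun π _ π' _ h => Finpartition.ext h) (fun Q hQ => ?_) fun _ _ => rfl
  obtain ⟨π, hπ⟩ := (mem_partitions.1 hQ).exists_finpartition
  exact ⟨π, Finset.mem_univ _, hπ⟩

theorem IsPartition.insert_sdiff {S B : Finset ι} {Q : Finset (Finset ι)} (hQ : IsPartition B Q)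
    (hBS : B ⊆ S) (hne : B ≠ S) : IsPartition S (insert (S \ B) Q) ∧ S \ B ∉ Q := by
  have hn : (S \ B).Nonempty := by
    rw [Finset.sdiff_nonempty]
    exact fun h => hne (Finset.Subset.antisymm hBS h)
  refine ⟨⟨?_, ?_, ?_⟩, ?_⟩
  · intro D hD
    rcases Finset.mem_insert.1 hD with rfl | hD
    · exact hn
    · exact hQ.nonempty D hD
  · intro x
    constructor
    · intro hx
      by_cases hxB : x ∈ B
      · obtain ⟨D, hD, hxD⟩ := (hQ.mem_iff x).1 hxB
        exact ⟨D, Finset.mem_insert_of_mem hD, hxD⟩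
      · exact ⟨S \ B, Finset.mem_insert_self _ _, Finset.mem_sdiff.2 ⟨hx, hxB⟩⟩
    · rintro ⟨D, hD, hxD⟩
      rcases Finset.mem_insert.1 hD with rfl | hD
      · exact (Finset.mem_sdiff.1 hxD).1
      · exact hBS (hQ.subset hD hxD)
  · intro D hD D' hD' x hx hx'
    rcases Finset.mem_insert.1 hD with rfl | hD <;> rcases Finset.mem_insert.1 hD' with rfl | hD'
    · rfl
    · exact absurd (hQ.subset hD' hx') (Finset.mem_sdiff.1 hx).2
    · exact absurd (hQ.subset hD hx) (Finset.mem_sdiff.1 hx').2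
    · exact hQ.eq_of_mem D hD D' hD' x hx hx'
  · intro h
    obtain ⟨x, hx⟩ := hn
    exact (Finset.mem_sdiff.1 hx).2 (hQ.subset h hx)

theorem IsPartition.erase {S D : Finset ι} {Q : Finset (Finset ι)} (hQ : IsPartition S Q)
    (hD : D ∈ Q) : IsPartition (S \ D) (Q.erase D) where
  nonempty B hB := hQ.nonempty B (Finset.mem_of_mem_erase hB)
  mem_iff x := by
    rw [Finset.mem_sdiff]
    constructor
    · rintro ⟨hx, hxD⟩
      obtain ⟨B, hB, hxB⟩ := (hQ.mem_iff x).1 hx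
      exact ⟨B, Finset.mem_erase.2 ⟨fun h => hxD (h ▸ hxB), hB⟩, hxB⟩
    · rintro ⟨B, hB, hxB⟩
      obtain ⟨hBD, hB⟩ := Finset.mem_erase.1 hB
      exact ⟨hQ.subset hB hxB, fun hxD => hBD (hQ.eq_of_mem B hB D hD x hxB hxD)⟩
  eq_of_mem B hB B' hB' := hQ.eq_of_mem B (Finset.mem_of_mem_erase hB) B'
    (Finset.mem_of_mem_erase hB')

/-- The coefficient of the partitions into `p` blocks in the definition of cumulants. -/
def cumulantCoeff (p : ℕ) : ℝ := (-1 : ℝ) ^ (p - 1) * ((p - 1).factorial : ℝ)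

/-- The cumulant of the set `S` of indices, from the moments `M`. -/
def setCumulant (M : Finset ι → ℝ) (S : Finset ι) : ℝ :=
  ∑ Q ∈ partitions S, cumulantCoeff Q.card * ∏ B ∈ Q, M B

/-- A proper subset B containing a, together with a partition of B, is the same thing as a partition
of S with a marked block avoiding a: the marked block is S \ B. -/
theorem sum_partitions_sdiff (M : Finset ι → ℝ) {S : Finset ι} {a : ι} (ha : a ∈ S) :
    ∑ B ∈ S.powerset.filter (fun B => a ∈ B ∧ B ≠ S), setCumulant M B * M (S \ B)
      = ∑ Q ∈ partitions S, ∑ _D ∈ Q.filter (fun D => a ∉ D),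
          cumulantCoeff (Q.card - 1) * ∏ B ∈ Q, M B := by
  simp only [setCumulant, Finset.sum_mul]
  rw [Finset.sum_sigma', Finset.sum_sigma']
  refine Finset.sum_bij' (fun z _ => (⟨insert (S \ z.1) z.2, S \ z.1⟩ :
      (_ : Finset (Finset ι)) × Finset ι))
    (fun z _ => (⟨S \ z.2, z.1.erase z.2⟩ : (_ : Finset ι) × Finset (Finset ι)))
    ?_ ?_ ?_ ?_ ?_
  · rintro ⟨B, Q⟩ hz
    simp only [Finset.mem_sigma, Finset.mem_filter, Finset.mem_powerset, mem_partitions] at hz ⊢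
    obtain ⟨⟨hBS, haB, hne⟩, hQ⟩ := hz
    exact ⟨(hQ.insert_sdiff hBS hne).1, Finset.mem_insert_self _ _, by simp [haB]⟩
  · rintro ⟨Q, D⟩ hz
    simp only [Finset.mem_sigma, Finset.mem_filter, Finset.mem_powerset, mem_partitions] at hz ⊢
    obtain ⟨hQ, hD, haD⟩ := hz
    refine ⟨⟨Finset.sdiff_subset, Finset.mem_sdiff.2 ⟨ha, haD⟩, fun h => ?_⟩, hQ.erase hD⟩
    obtain ⟨x, hx⟩ := hQ.nonempty D hD
    have : x ∈ S \ D := h.symm ▸ hQ.subset hD hx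
    exact (Finset.mem_sdiff.1 this).2 hx
  · rintro ⟨B, Q⟩ hz
    simp only [Finset.mem_sigma, Finset.mem_filter, Finset.mem_powerset, mem_partitions] at hz
    obtain ⟨⟨hBS, haB, hne⟩, hQ⟩ := hz
    simp only [Finset.sdiff_sdiff_eq_self hBS,
      Finset.erase_insert (hQ.insert_sdiff hBS hne).2]
  · rintro ⟨Q, D⟩ hz
    simp only [Finset.mem_sigma, Finset.mem_filter, mem_partitions] at hz
    obtain ⟨hQ, hD, haD⟩ := hz
    simp only [Finset.sdiff_sdiff_eq_self (hQ.subset hD), Finset.insert_erase hD]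
  · rintro ⟨B, Q⟩ hz
    simp only [Finset.mem_sigma, Finset.mem_filter, Finset.mem_powerset, mem_partitions] at hz
    obtain ⟨⟨hBS, haB, hne⟩, hQ⟩ := hz
    simp only
    rw [Finset.card_insert_of_notMem (hQ.insert_sdiff hBS hne).2,
      Finset.prod_insert (hQ.insert_sdiff hBS hne).2, Nat.add_sub_cancel]
    ring

theorem IsPartition.card_filter_notMem {S : Finset ι} {Q : Finset (Finset ι)}
    (hQ : IsPartition S Q) {a : ι} (ha : a ∈ S) :
    (Q.filter fun D => a ∉ D).card = Q.card - 1 := by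
  obtain ⟨D, hD, haD⟩ := (hQ.mem_iff a).1 ha
  have : Q.filter (fun B => a ∉ B) = Q.erase D := by
    ext B
    simp only [Finset.mem_filter, Finset.mem_erase]
    constructor
    · rintro ⟨hB, haB⟩
      exact ⟨fun h => haB (h ▸ haD), hB⟩
    · rintro ⟨hBD, hB⟩
      exact ⟨hB, fun haB => hBD (hQ.eq_of_mem B hB D hD a haB haD)⟩
  rw [this, Finset.card_erase_of_mem hD]

theorem isPartition_singleton {S : Finset ι} (hS : S.Nonempty) : IsPartition S {S} where
  nonempty B hB := by rw [Finset.mem_singleton.1 hB]; exact hS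
  mem_iff x := by simp
  eq_of_mem B hB B' hB' _ _ _ := by rw [Finset.mem_singleton.1 hB, Finset.mem_singleton.1 hB']

theorem IsPartition.eq_singleton {S : Finset ι} {Q : Finset (Finset ι)}
    (hQ : IsPartition S Q) (h1 : Q.card = 1) : Q = {S} := by
  obtain ⟨D, rfl⟩ := Finset.card_eq_one.1 h1
  congr 1
  ext x
  rw [hQ.mem_iff]
  simp

/-- Moments in terms of cumulants: summation over the block that contains a given index. -/
theorem moment_eq_sum_setCumulant {M : Finset ι → ℝ} (hM : M ∅ = 1) {S : Finset ι} {a : ι}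
    (ha : a ∈ S) :
    M S = ∑ B ∈ S.powerset.filter (fun B => a ∈ B), setCumulant M B * M (S \ B) := by
  have h1 : S.powerset.filter (fun B => a ∈ B)
      = insert S (S.powerset.filter (fun B => a ∈ B ∧ B ≠ S)) := by
    ext B
    simp only [Finset.mem_filter, Finset.mem_powerset, Finset.mem_insert]
    constructor
    · rintro ⟨h1, h2⟩
      by_cases h : B = S
      · exact Or.inl h
      · exact Or.inr ⟨h1, h2, h⟩
    · rintro (rfl | ⟨h1, h2, _⟩)
      · exact ⟨subset_rfl, ha⟩
      · exact ⟨h1, h2⟩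
  rw [h1, Finset.sum_insert (by simp), sum_partitions_sdiff M ha, Finset.sdiff_self, hM, mul_one,
    setCumulant, ← Finset.sum_add_distrib]
  -- A partition into p blocks has p - 1 blocks avoiding a, so its total coefficient is that of p
  -- plus (p - 1) times that of p - 1. This vanishes for p ≥ 2, and only {S} remains.
  rw [Finset.sum_eq_single_of_mem {S} (mem_partitions.2 (isPartition_singleton ⟨a, ha⟩))]
  · rw [Finset.sum_const, (isPartition_singleton ⟨a, ha⟩).card_filter_notMem ha]
    simp [cumulantCoeff]
  · intro Q hQ hne
    have hQ' := mem_partitions.1 hQ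
    rw [Finset.sum_const, hQ'.card_filter_notMem ha, nsmul_eq_mul, ← mul_assoc, ← add_mul]
    obtain ⟨D, hD, -⟩ := (hQ'.mem_iff a).1 ha
    have hc : 0 < Q.card := Finset.card_pos.2 ⟨D, hD⟩
    have hc1 : Q.card ≠ 1 := fun h => hne (hQ'.eq_singleton h)
    obtain ⟨p, hp⟩ : ∃ p, Q.card = p + 2 := ⟨Q.card - 2, by omega⟩
    rw [hp]
    have : cumulantCoeff (p + 2) + ((p + 2 - 1 : ℕ) : ℝ) * cumulantCoeff (p + 2 - 1) = 0 := by
      simp only [cumulantCoeff]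
      have e1 : p + 2 - 1 = p + 1 := rfl
      have e2 : p + 1 - 1 = p := rfl
      rw [e1, e2, Nat.factorial_succ, pow_succ]
      push_cast
      ring
    rw [this, zero_mul]

/-- The cumulants of moments that satisfy the Wick recursion. -/
def pairCumulant (C : ι → ι → ℝ) (B : Finset ι) : ℝ :=
  if B.card = 2 then (∑ i ∈ B, ∑ j ∈ B.erase i, C i j) / 2 else 0

theorem pairCumulant_pair {C : ι → ι → ℝ} (hC : ∀ i j, C i j = C j i) {a b : ι} (hab : a ≠ b) :
    pairCumulant C {a, b} = C a b := by
  have hba : b ∉ ({a} : Finset ι) := by simpa using hab.symm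
  have e1 : ({a, b} : Finset ι).erase a = {b} := by
    rw [Finset.erase_insert (by simpa using hab)]
  have e2 : ({a, b} : Finset ι).erase b = {a} := by
    rw [Finset.pair_comm, Finset.erase_insert (by simpa using hab.symm)]
  rw [pairCumulant, if_pos (Finset.card_pair hab), Finset.sum_pair hab, e1, e2,
    Finset.sum_singleton, Finset.sum_singleton, hC b a]
  ring

/-- Only the two-element sets {a, b} contribute. The Wick recursion is therefore the moment–cumulant
recursion with `pairCumulant` in the role of the cumulants. -/
theorem sum_pairCumulant {C : ι → ι → ℝ} (hC : ∀ i j, C i j = C j i) (M : Finset ι → ℝ)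
    {S : Finset ι} {a : ι} (ha : a ∈ S) :
    ∑ B ∈ S.powerset.filter (fun B => a ∈ B), pairCumulant C B * M (S \ B)
      = ∑ b ∈ S.erase a, C a b * M ((S.erase a).erase b) := by
  have hinj : Set.InjOn (fun b => ({a, b} : Finset ι)) (S.erase a : Set ι) := by
    intro b hb b' hb' h
    have hb0 : b ∈ ({a, b'} : Finset ι) := by
      rw [← show ({a, b} : Finset ι) = {a, b'} from h]; simp
    rcases Finset.mem_insert.1 hb0 with h1 | h1
    · exact absurd h1 (Finset.mem_erase.1 (Finset.mem_coe.1 hb)).1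
    · exact Finset.mem_singleton.1 h1
  have hsub : (S.erase a).image (fun b => ({a, b} : Finset ι))
      ⊆ S.powerset.filter (fun B => a ∈ B) := by
    intro B hB
    obtain ⟨b, hb, rfl⟩ := Finset.mem_image.1 hB
    rw [Finset.mem_filter, Finset.mem_powerset]
    refine ⟨?_, by simp⟩
    intro x hx
    rcases Finset.mem_insert.1 hx with rfl | hx
    · exact ha
    · rw [Finset.mem_singleton.1 hx]; exact Finset.mem_of_mem_erase hb
  rw [← Finset.sum_subset hsub, Finset.sum_image hinj]
  · refine Finset.sum_congr rfl fun b hb => ?_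
    have hab : a ≠ b := (Finset.ne_of_mem_erase hb).symm
    rw [pairCumulant_pair hC hab]
    congr 2
    ext x
    simp only [Finset.mem_sdiff, Finset.mem_insert, Finset.mem_singleton, Finset.mem_erase]
    tauto
  · intro B hB hnot
    rw [Finset.mem_filter, Finset.mem_powerset] at hB
    rw [pairCumulant, if_neg, zero_mul]
    intro hcard
    refine hnot (Finset.mem_image.2 ?_)
    have h1 : (B.erase a).card = 1 := by rw [Finset.card_erase_of_mem hB.2, hcard]
    obtain ⟨b, hb⟩ := Finset.card_eq_one.1 h1
    have hbB : b ∈ B.erase a := by rw [hb]; simp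
    refine ⟨b, Finset.mem_erase.2 ⟨Finset.ne_of_mem_erase hbB,
      hB.1 (Finset.mem_of_mem_erase hbB)⟩, ?_⟩
    rw [← Finset.insert_erase hB.2, hb]

/-- Moments satisfying the Wick recursion have vanishing cumulants of orders other than two. -/
theorem setCumulant_eq_pairCumulant {M : Finset ι → ℝ} (hM : M ∅ = 1) {C : ι → ι → ℝ}
    (hC : ∀ i j, C i j = C j i)
    (hW : ∀ (S : Finset ι) (a : ι), a ∈ S →
      M S = ∑ b ∈ S.erase a, C a b * M ((S.erase a).erase b))
    (S : Finset ι) (hS : S.Nonempty) : setCumulant M S = pairCumulant C S := by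
  induction S using Finset.strongInduction with
  | H S ih =>
    obtain ⟨a, ha⟩ := hS
    -- Both families satisfy the same recursion. The terms for proper subsets containing a agree by
    -- induction, which leaves equality of the terms for S itself.
    have h1 := moment_eq_sum_setCumulant hM ha
    rw [hW S a ha, ← sum_pairCumulant hC M ha] at h1
    have hmem : S ∈ S.powerset.filter (fun B => a ∈ B) := by simp [ha]
    rw [← Finset.add_sum_erase _ _ hmem, ← Finset.add_sum_erase _ _ hmem] at h1
    have h2 : ∑ B ∈ (S.powerset.filter (fun B => a ∈ B)).erase S, pairCumulant C B * M (S \ B)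
        = ∑ B ∈ (S.powerset.filter (fun B => a ∈ B)).erase S, setCumulant M B * M (S \ B) := by
      refine Finset.sum_congr rfl fun B hB => ?_
      rw [Finset.mem_erase, Finset.mem_filter, Finset.mem_powerset] at hB
      rw [ih B (Finset.ssubset_iff_subset_ne.2 ⟨hB.2.1, hB.1⟩) ⟨a, hB.2.2⟩]
    rw [h2, Finset.sdiff_self, hM, mul_one, mul_one] at h1
    linarith

end Combinatorics

end

/-! ### Limits of the cumulants -/

noncomputable section

section CumulantLimit

variable {Ω : Type*} [MeasurableSpace Ω] {P : Measure Ω} [IsProbabilityMeasure P]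
  {X : ℝ → ℝ → Ω → ℝ} {f : ℝ → ℝ → ℝ} {c : ℝ} {H : ℝ → ℝ} {hH : MemLp H 2 volume}
  {Ω' : Type*} [MeasurableSpace Ω'] {P' : Measure Ω'} [IsProbabilityMeasure P']
  {Z : ℝ → Ω' → ℝ}

theorem cumulant_eq_setCumulant {m : ℕ} (ξ : Fin m → Ω → ℝ) :
    cumulant P ξ = setCumulant (fun B => ∫ ω, ∏ j ∈ B, ξ j ω ∂P) Finset.univ :=
  sum_finpartition (S := Finset.univ)
    (fun Q => cumulantCoeff Q.card * ∏ B ∈ Q, ∫ ω, ∏ j ∈ B, ξ j ω ∂P)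

theorem tendsto_subset_moment_normalized (hX : IsInputFamily P X f c)
    (hZ : IsCenteredGaussian P' Z (limitCov H hH)) {m : ℕ} (τ : Fin m → ℝ)
    (B : Finset (Fin m)) :
    Tendsto (fun p : ℝ × ℝ => ∫ ω, ∏ j ∈ B, normalized P H X c p.1 p.2 (τ j) ω ∂P)
      (atTop ×ˢ atTop) (𝓝 (∫ ω, ∏ j ∈ B, Z (τ j) ω ∂P')) := by
  have h : ∀ g : Fin m → ℝ, ∏ k : Fin B.card, g (B.equivFin.symm k) = ∏ j ∈ B, g j := fun g => by
    rw [← Finset.prod_coe_sort B g]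
    exact B.equivFin.symm.prod_comp fun j : B => g j
  have h1 := tendsto_moment_normalized hX hZ fun k : Fin B.card => τ (B.equivFin.symm k)
  have e1 := fun (p : ℝ × ℝ) ω => h fun j => normalized P H X c p.1 p.2 (τ j) ω
  have e2 := fun ω => h fun j => Z (τ j) ω
  simpa only [e1, e2] using h1

/-- A cumulant is a fixed polynomial in the mixed moments of subfamilies, all of which converge. -/
theorem tendsto_cumulant_normalized (hX : IsInputFamily P X f c)
    (hZ : IsCenteredGaussian P' Z (limitCov H hH)) {m : ℕ} (τ : Fin m → ℝ) :
    Tendsto (fun p : ℝ × ℝ => cumulant P fun j => normalized P H X c p.1 p.2 (τ j))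
      (atTop ×ˢ atTop) (𝓝 (cumulant P' fun j => Z (τ j))) := by
  unfold cumulant
  exact tendsto_finsetSum _ fun π _ => tendsto_const_nhds.mul <|
    tendsto_finsetProd _ fun B _ => tendsto_subset_moment_normalized hX hZ τ B

/-- The cumulants of a centered Gaussian process vanish except for those of order two. -/
theorem IsCenteredGaussian.cumulant_eq {C : ℝ → ℝ → ℂ} (hZ : IsCenteredGaussian P' Z C)
    {m : ℕ} (hm : 0 < m) (τ : Fin m → ℝ) :
    cumulant P' (fun j => Z (τ j))
      = pairCumulant (fun j k => inner ℝ (hZ.vec (τ j)) (hZ.vec (τ k))) Finset.univ := by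
  have hM : ∀ B : Finset (Fin m),
      ∫ ω, ∏ j ∈ B, Z (τ j) ω ∂P' = ∫ ω, ∏ j ∈ B, hZ.vec (τ j) ω ∂P' := fun B => by
    refine integral_congr_ae ?_
    filter_upwards [ae_all_iff.2 fun j => hZ.coeFn_vec (τ j)] with ω hω
    exact Finset.prod_congr rfl fun j _ => (hω j).symm
  rw [cumulant_eq_setCumulant]
  refine setCumulant_eq_pairCumulant (by simp) (fun i j => real_inner_comm _ _)
    (fun S a ha => ?_) _ ⟨⟨0, hm⟩, Finset.mem_univ _⟩
  simp only [hM]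
  have hmem : ∀ j, hZ.vec (τ j) ∈ Submodule.span ℝ (Set.range hZ.vec) := fun j =>
    Submodule.subset_span ⟨τ j, rfl⟩
  rw [← hZ.isGaussianSubspace.wick hmem (S.erase a) (hmem a)]
  refine integral_congr_ae (ae_of_all _ fun ω => ?_)
  exact (Finset.mul_prod_erase S (fun j => hZ.vec (τ j) ω) ha).symm

theorem IsCenteredGaussian.cumulant_eq_zero {C : ℝ → ℝ → ℂ} (hZ : IsCenteredGaussian P' Z C)
    {m : ℕ} (hm : 0 < m) (hm2 : m ≠ 2) (τ : Fin m → ℝ) : cumulant P' (fun j => Z (τ j)) = 0 := by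
  rw [hZ.cumulant_eq hm, pairCumulant, if_neg (by simpa using hm2)]

theorem IsCenteredGaussian.cumulant_two {C : ℝ → ℝ → ℂ} (hZ : IsCenteredGaussian P' Z C)
    (τ : Fin 2 → ℝ) : ((cumulant P' (fun j => Z (τ j)) : ℝ) : ℂ) = C (τ 0) (τ 1) := by
  have hu : (Finset.univ : Finset (Fin 2)) = {0, 1} := rfl
  rw [hZ.cumulant_eq two_pos, hu, pairCumulant_pair (fun i j => real_inner_comm _ _) (by decide),
    ← hZ.cov, inner_eq_integral_mul]
  congr 1
  refine integral_congr_ae ?_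
  filter_upwards [hZ.coeFn_vec (τ 0), hZ.coeFn_vec (τ 1)] with ω h1 h2
  rw [h1, h2]

end CumulantLimit

end

end Correlogram

/-! ### Assembly of the theorem -/

theorem mainTheorem1 {Ω : Type*} [MeasurableSpace Ω] (P : Measure Ω) [IsProbabilityMeasure P]
    (X : ℝ → ℝ → Ω → ℝ) (f : ℝ → ℝ → ℝ) (c : ℝ)
    (hX : Correlogram.IsInputFamily P X f c)
    (H : ℝ → ℝ) (hH : MemLp H 2 volume) :
    -- the mean-square integrals that define the response and the estimator exist
    (∀ Δ : ℝ, 0 < Δ → ∀ t : ℝ,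
      Correlogram.IsMSLim P (atTop ×ˢ atTop) (Correlogram.truncatedResponse H (X Δ) t)
        (Correlogram.response P H (X Δ) t)) ∧
    (∀ T Δ : ℝ, 0 < T → 0 < Δ → ∀ τ : ℝ,
      Correlogram.IsMSLim P (Correlogram.meshFilter 0 T)
        (Correlogram.riemannSum (Correlogram.corrIntegrand P H (X Δ) τ))
        (Correlogram.msIntegral P (Correlogram.corrIntegrand P H (X Δ) τ) 0 T)) ∧
    -- all mixed moments exist
    (∀ T Δ : ℝ, 0 < T → 0 < Δ → ∀ (m : ℕ) (τ : Fin m → ℝ),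
      Integrable (fun ω => ∏ j, Correlogram.normalized P H X c T Δ (τ j) ω) P) ∧
    -- limits of the cumulants of orders one, two, and at least three
    (∀ τ : Fin 1 → ℝ,
      Tendsto (fun p : ℝ × ℝ =>
          Correlogram.cumulant P (fun j => Correlogram.normalized P H X c p.1 p.2 (τ j)))
        (atTop ×ˢ atTop) (𝓝 0)) ∧
    (∀ τ : Fin 2 → ℝ,
      Tendsto (fun p : ℝ × ℝ =>
          ((Correlogram.cumulant P
            (fun j => Correlogram.normalized P H X c p.1 p.2 (τ j)) : ℝ) : ℂ))
        (atTop ×ˢ atTop) (𝓝 (Correlogram.limitCov H hH (τ 0) (τ 1)))) ∧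
    (∀ m : ℕ, 3 ≤ m → ∀ τ : Fin m → ℝ,
      Tendsto (fun p : ℝ × ℝ =>
          Correlogram.cumulant P (fun j => Correlogram.normalized P H X c p.1 p.2 (τ j)))
        (atTop ×ˢ atTop) (𝓝 0)) ∧
    -- there is a centered Gaussian process with covariance `C_∞`
    (∃ (Ω' : Type) (_ : MeasurableSpace Ω') (P' : Measure Ω') (Z : ℝ → Ω' → ℝ),
      IsProbabilityMeasure P' ∧
        Correlogram.IsCenteredGaussian P' Z (Correlogram.limitCov H hH)) ∧
    -- for every such process, finite-dimensional distributions and mixed moments converge to its own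
    (∀ (Ω' : Type*) [MeasurableSpace Ω'] (P' : Measure Ω') [IsProbabilityMeasure P']
      (Z : ℝ → Ω' → ℝ), Correlogram.IsCenteredGaussian P' Z (Correlogram.limitCov H hH) →
      ∀ (m : ℕ) (τ : Fin m → ℝ),
        TendstoInDistribution
          (fun (p : ℝ × ℝ) ω (j : Fin m) => Correlogram.normalized P H X c p.1 p.2 (τ j) ω)
          (atTop ×ˢ atTop) (fun ω j => Z (τ j) ω) (fun _ => P) P' ∧
        Tendsto (fun p : ℝ × ℝ =>
            ∫ ω, ∏ j, Correlogram.normalized P H X c p.1 p.2 (τ j) ω ∂P)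
          (atTop ×ˢ atTop) (𝓝 (∫ ω, ∏ j, Z (τ j) ω ∂P'))) := by
  obtain ⟨M, hM⟩ := hX.exists_isInput
  -- One limit process is fixed in advance: the cumulant limits, whose statements mention no
  -- process, are computed as its cumulants.
  obtain ⟨Ω₀, m₀, P₀, Z₀, hP₀, hZ₀⟩ := Correlogram.exists_limit_process hH
  refine ⟨fun Δ hΔ t => (hM Δ hΔ).isMSLim_response hH t,
    fun T Δ hT hΔ τ => (hM Δ hΔ).isMSLim_msIntegral hH τ hT.le,
    fun T Δ hT hΔ m τ => Correlogram.integrable_prod_normalized hX hH hT hΔ τ,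
    fun τ => ?_, fun τ => ?_, fun m hm τ => ?_, ⟨Ω₀, m₀, P₀, Z₀, hP₀, hZ₀⟩,
    fun Ω' _ P' _ Z hZ m τ => ⟨Correlogram.tendstoInDistribution_normalized hX hZ τ,
      Correlogram.tendsto_moment_normalized hX hZ τ⟩⟩
  · rw [← hZ₀.cumulant_eq_zero one_pos (by norm_num) τ]
    exact Correlogram.tendsto_cumulant_normalized hX hZ₀ τ
  · rw [← hZ₀.cumulant_two τ]
    exact (Complex.continuous_ofReal.tendsto _).comp
      (Correlogram.tendsto_cumulant_normalized hX hZ₀ τ)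
  · rw [← hZ₀.cumulant_eq_zero (by omega) (by omega) τ]
    exact Correlogram.tendsto_cumulant_normalized hX hZ₀ τ
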